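/- Let $k\ge 1$ and $d=2k$. Work in $\mathbb{CP}^d$ with homogeneous coordinates $[x_0,\dots,x_d]$, where $\mathbb{R}^d\subset\mathbb{C}^d$ is contained in the affine part $x_0\ne0$. Write $q(x)=x_1^2+\dots+x_d^2$, and let $\Sigma_\infty=\{x_0=0,\ q(x)=0\}$ be the imaginary sphere at infinity. A rational curve $C\subset\mathbb{CP}^d$ is an irreducible projective curve birational to $\mathbb{CP}^1$; it is non-degenerate if it is not contained in a hyperplane, and real if it contains infinitely many points of $\mathbb{RP}^d$. Its degree is the largest number of points in which a hyperplane meets it, among the hyperplanes that meet it in finitely many points. A rational normal curve in $\mathbb{CP}^d$ is the image of $\mathbb{CP}^1$ under a map $[\varphi_0,\dots,\varphi_d]$ given by $d+1$ linearly independent binary forms of degree $d$. A curve is bounded if its set of points in $\mathbb{R}^d$ is bounded. A rational curve is $\ell$-spherical if it is real and contains exactly $\ell$ pairs of complex conjugate points of $\Sigma_\infty$, counted with multiplicity; here, if $\varphi=[\varphi_0,\dots,\varphi_d]:\mathbb{CP}^1\to C$ is a birational parametrization by binary forms without common zeros, the multiplicity is the sum, over the parameter values $t$ that are mapped to the point,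 of $\min(\operatorname{ord}_t\varphi_0,\operatorname{ord}_t(\varphi_1^2+\dots+\varphi_d^2))$. An acnode of a real rational curve is a real point through which exactly two branches of the curve pass, both smooth, with distinct complex conjugate tangent lines. The inverse of $C$ in a point $r\in\mathbb{R}^d$ is the Zariski closure in $\mathbb{CP}^d$ of the image of $\{x\in C\cap\mathbb{C}^d : q(x-r)\neq0\}$ under the inversion $x\mapsto r+(x-r)/q(x-r)$. 1. If $C$ is a bounded $(k-1)$-spherical rational normal curve in $\mathbb{CP}^d$ and $r\in C\cap\mathbb{R}^d$, then the inverse of $C$ in $r$ is a non-degenerate $k$-spherical rational curve of degree $d+1$ that has an acnode at $r$ and is smooth at every other point. 2. If $C$ is a non-degenerate $k$-spherical rational curve of degree $d+1$ in $\mathbb{CP}^d$ that has an acnode at a point $r\in\mathbb{R}^d$ and is smooth at every other point, then the inverse of $C$ in $r$ is a bounded $(k-1)$-spherical rational normal curve. -/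

import Mathlib

namespace SphCurve

noncomputable section

/-- Complex projective `d`-space with homogeneous coordinates `[x₀, x₁, …, x_d]`; the hyperplane
at infinity is `x₀ = 0`. -/
abbrev CP (d : ℕ) : Type := Projectivization ℂ (Fin (d + 1) → ℂ)

/-- The point `[1, x₁, …, x_d]`; this identifies `ℂ^d` with the affine part `x₀ ≠ 0`. -/
def affinePt {d : ℕ} (x : Fin d → ℂ) : CP d :=
  Projectivization.mk ℂ (Fin.cons 1 x : Fin (d + 1) → ℂ)
    (fun h => one_ne_zero (α := ℂ) (by simpa using congrFun h 0))

/-- The complex coordinates of a point of `ℝ^d`. -/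
def toComplex {d : ℕ} (r : EuclideanSpace ℝ (Fin d)) : Fin d → ℂ := fun i => (r i : ℂ)

/-- `ℝ^d` inside `ℂℙ^d`. -/
def realPt {d : ℕ} (r : EuclideanSpace ℝ (Fin d)) : CP d := affinePt (toComplex r)

/-- The points of `ℝℙ^d`, i.e. those with real homogeneous coordinates. -/
def IsRealPoint {d : ℕ} (p : CP d) : Prop :=
  ∃ v : Fin (d + 1) → ℝ, (fun i => (v i : ℂ)) ∈ p.submodule ∧ v ≠ 0

/-- The homogeneous polynomial `F` of degree `n` belongs to the homogeneous ideal of `S`.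
(For a homogeneous polynomial, vanishing at a point of projective space does not depend on the
representative.) -/
def VanishesOn {d : ℕ} (S : Set (CP d)) (n : ℕ) (F : MvPolynomial (Fin (d + 1)) ℂ) : Prop :=
  F.IsHomogeneous n ∧ ∀ q ∈ S, MvPolynomial.eval q.rep F = 0

/-- Zariski closure in `ℂℙ^d`: the common zeros of all forms that vanish on `S`. -/
def zariskiClosure {d : ℕ} (S : Set (CP d)) : Set (CP d) :=
  {p | ∀ n F, VanishesOn S n F → MvPolynomial.eval p.rep F = 0}

/-- The hyperplane `∑ aᵢ xᵢ = 0` (for `a ≠ 0`). -/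
def hyperplane {d : ℕ} (a : Fin (d + 1) → ℂ) : Set (CP d) :=
  {p | ∑ i, a i * p.rep i = 0}

/-- `C` is not contained in a hyperplane. -/
def NonDegenerate {d : ℕ} (C : Set (CP d)) : Prop :=
  ∀ a : Fin (d + 1) → ℂ, a ≠ 0 → ¬ C ⊆ hyperplane a

/-- The curve `C` has degree `e`: the largest number of points in which a hyperplane
that meets `C` in finitely many points meets `C` is `e` (a generic hyperplane attains it). -/
def HasDegree {d : ℕ} (C : Set (CP d)) (e : ℕ) : Prop :=
  IsGreatest {n : ℕ | ∃ a : Fin (d + 1) → ℂ, a ≠ 0 ∧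
    (C ∩ hyperplane a).Finite ∧ (C ∩ hyperplane a).ncard = n} e

/-- An irreducible curve is real if it contains infinitely many points of `ℝℙ^d`. -/
def IsReal {d : ℕ} (C : Set (CP d)) : Prop := {p ∈ C | IsRealPoint p}.Infinite

/-- The set of points of `C` in `ℝ^d` is bounded. -/
def IsBoundedCurve {d : ℕ} (C : Set (CP d)) : Prop :=
  Bornology.IsBounded {x : EuclideanSpace ℝ (Fin d) | realPt x ∈ C}

/-- A morphism from the projective line to `ℂℙ^d`, given by binary forms of the same degree
without common zeros, that is injective up to finitely many points, hence birational onto its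
image. It is the normalization of its image; its points are the branches of the image curve. -/
structure BirationalParam (d : ℕ) where
  deg : ℕ
  form : Fin (d + 1) → MvPolynomial (Fin 2) ℂ
  homog : ∀ i, (form i).IsHomogeneous deg
  no_common_zero : ∀ v : Fin 2 → ℂ, v ≠ 0 → (fun i => MvPolynomial.eval v (form i)) ≠ 0
  finite_noninj : {t : CP 1 | ∃ u : CP 1, u ≠ t ∧
    Projectivization.mk ℂ (fun i => MvPolynomial.eval u.rep (form i))
        (no_common_zero _ u.rep_nonzero) =
      Projectivization.mk ℂ (fun i => MvPolynomial.eval t.rep (form i))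
        (no_common_zero _ t.rep_nonzero)}.Finite

/-- The underlying map `ℂℙ¹ → ℂℙ^d`. -/
def BirationalParam.map {d : ℕ} (φ : BirationalParam d) (t : CP 1) : CP d :=
  Projectivization.mk ℂ (fun i => MvPolynomial.eval t.rep (φ.form i))
    (φ.no_common_zero _ t.rep_nonzero)

/-- `φ` parametrizes the curve `C` birationally. -/
def BirationalParam.Parametrizes {d : ℕ} (φ : BirationalParam d) (C : Set (CP d)) : Prop :=
  Set.range φ.map = C

/-- A rational curve: an irreducible projective curve that is birational to the projective line. -/
def IsRationalCurve {d : ℕ} (C : Set (CP d)) : Prop :=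
  ∃ φ : BirationalParam d, φ.Parametrizes C

/-- A rational normal curve in `ℂℙ^d`: the image of the projective line under the map given by
`d + 1` linearly independent binary forms of degree `d` (equivalently, up to a projective
transformation, the moment curve). -/
def IsRationalNormalCurve {d : ℕ} (C : Set (CP d)) : Prop :=
  ∃ φ : BirationalParam d, φ.deg = d ∧ LinearIndependent ℂ φ.form ∧ φ.Parametrizes C

/-- Order of vanishing of a binary form at a point of the projective line: the exponent of the
linear form vanishing at `t`. -/
def ordAt (F : MvPolynomial (Fin 2) ℂ) (t : CP 1) : ℕ∞ :=
  emultiplicity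
    (MvPolynomial.C (t.rep 1) * MvPolynomial.X 0 - MvPolynomial.C (t.rep 0) * MvPolynomial.X 1) F

/-- The intersection multiplicity of the branch `t` with the imaginary sphere at infinity
`Σ_∞`, which has the equations `x₀ = 0` and `x₁² + ⋯ + x_d² = 0`: the order at `t` of the
pulled-back ideal `(x₀, x₁² + ⋯ + x_d²)`. It is positive exactly if the branch is centred on
`Σ_∞`. -/
def BirationalParam.multSigma {d : ℕ} (φ : BirationalParam d) (t : CP 1) : ℕ∞ :=
  min (ordAt (φ.form 0) t) (ordAt (∑ i : Fin d, φ.form i.succ ^ 2) t)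

/-- `C` is an `ℓ`-spherical (rational) curve: it is real and contains exactly `ℓ` pairs of
complex conjugate points on `Σ_∞`, counted with multiplicity. As `Σ_∞` has no real points and a
real curve is invariant under conjugation, this says that the total multiplicity is `2 ℓ`.
Only finitely many terms of the sum are nonzero, because a real curve does not lie on `Σ_∞`. -/
def IsSpherical {d : ℕ} (ℓ : ℕ) (C : Set (CP d)) : Prop :=
  IsReal C ∧ ∃ φ : BirationalParam d, φ.Parametrizes C ∧
    ∑ᶠ t : CP 1, φ.multSigma t = ((2 * ℓ : ℕ) : ℕ∞)

/-- The Zariski tangent space of `C` at `p`, as a linear subspace of `ℂ^(d+1)` (the cone over the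
projective tangent space): the common kernel at `p` of the differentials of the forms in the
ideal of `C`. -/
def zariskiTangent {d : ℕ} (C : Set (CP d)) (p : CP d) : Submodule ℂ (Fin (d + 1) → ℂ) where
  carrier := {w | ∀ n F, VanishesOn C n F →
    ∑ i, MvPolynomial.eval p.rep (MvPolynomial.pderiv i F) * w i = 0}
  zero_mem' := by
    intro n F _
    simp
  add_mem' := by
    intro a b ha hb n F hF
    simp [mul_add, Finset.sum_add_distrib, ha n F hF, hb n F hF]
  smul_mem' := by
    intro c a ha n F hF
    have h := ha n F hF
    simp only [Pi.smul_apply, smul_eq_mul, mul_left_comm _ c, ← Finset.mul_sum, h, mul_zero]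

/-- The curve `C` is smooth at `p ∈ C`: the projective tangent space at `p` is a line. -/
def IsSmoothAt {d : ℕ} (C : Set (CP d)) (p : CP d) : Prop :=
  Module.finrank ℂ (zariskiTangent C p) = 2

/-- The span of the partial derivatives of the parametrization at `t`. If it has dimension `2`,
then the branch `t` is smooth and this is (the cone over) its tangent line. -/
def BirationalParam.branchTangent {d : ℕ} (φ : BirationalParam d) (t : CP 1) :
    Submodule ℂ (Fin (d + 1) → ℂ) :=
  Submodule.span ℂ (Set.range fun j : Fin 2 => fun i : Fin (d + 1) =>
    MvPolynomial.eval t.rep (MvPolynomial.pderiv j (φ.form i)))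

/-- The real point `r` is an acnode of the rational curve `C`: exactly two branches of `C` pass
through `r`, both are smooth, and their tangent lines are distinct and complex conjugate. -/
def IsAcnode {d : ℕ} (C : Set (CP d)) (r : EuclideanSpace ℝ (Fin d)) : Prop :=
  ∃ φ : BirationalParam d, φ.Parametrizes C ∧ ∃ t₁ t₂ : CP 1, t₁ ≠ t₂ ∧
    φ.map ⁻¹' {realPt r} = {t₁, t₂} ∧
    Module.finrank ℂ (φ.branchTangent t₁) = 2 ∧ Module.finrank ℂ (φ.branchTangent t₂) = 2 ∧
    φ.branchTangent t₁ ≠ φ.branchTangent t₂ ∧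
    ∀ w : Fin (d + 1) → ℂ, w ∈ φ.branchTangent t₁ ↔ star w ∈ φ.branchTangent t₂

/-- The complex quadratic form `x₁² + ⋯ + x_d²` (no conjugation). -/
def quad {d : ℕ} (x : Fin d → ℂ) : ℂ := ∑ i, x i ^ 2

/-- Inversion `x ↦ r + (x - r) / q(x - r)`, `q = x₁² + ⋯ + x_d²`, in the unit sphere around `r`,
defined where `q(x - r) ≠ 0`. -/
def inversion {d : ℕ} (r x : Fin d → ℂ) : Fin d → ℂ := r + (quad (x - r))⁻¹ • (x - r)

/-- The inverse of the curve `C` in the point `r`: the Zariski closure of the image under inversion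
of all the affine points of `C` at which inversion is defined. -/
def inverseCurve {d : ℕ} (r : EuclideanSpace ℝ (Fin d)) (C : Set (CP d)) : Set (CP d) :=
  zariskiClosure {p | ∃ x : Fin d → ℂ, affinePt x ∈ C ∧ quad (x - toComplex r) ≠ 0 ∧
    p = affinePt (inversion (toComplex r) x)}

end

end SphCurve

open SphCurve

/-! Project the curve from `r`. For a real parametrization φ of a curve through `r` put x = φ₀. Then
φᵢ - rᵢ x = c zᵢ, where the zeros of the form c are the parameters of `r` and the d forms zᵢ have
degree e = d - 1 and are linearly independent, hence a basis of all forms of degree e. So the curve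
lies on the cone with vertex `r` over a rational normal curve of degree e (`IsCone`).

Let Q = ∑ zᵢ², let g be the greatest common divisor of x and Q, and write x = g a, Q = g b. The
affine point minus `r` is c z / (g a), on which the quadratic form has the value c² b / (g a²);
inversion therefore turns it into a z / (c b). The inverse curve lies on the same cone, with x
replaced by c b and c by a, and inversion merely exchanges the pairs (a, b) and (c, g)
(`InversePair`). Modulo x the sum of squares of the other coordinates is c² Q, so the total
multiplicity on the sphere at infinity is deg g for the curve and deg b for its inverse
(`IsCone.multSigma_eq`, `IsCone.exists_inverse`).

The numbers follow from e = 2k - 1 and deg g + deg b = 4k - 2. In the first half deg c = 1, deg x =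
2k and deg g = 2k - 2, so deg a = 2, deg b = 2k, and the inverse has degree deg a + e = 2k + 1. In
the second half deg c = 2, deg x = 2k + 1 and deg g = 2k, so deg a = 1, deg b = 2k - 2, and the
inverse has degree 2k.

Reality gives the rest. A bounded curve has x without real zeros; then the two zeros of a are not
real, and they are conjugate because a / b = x / Q is real, so `r` becomes an acnode
(`IsCone.isAcnode`). Off the vertex, equations of the cone and one cubic family show smoothness
(`IsCone.isSmoothAt`). Conversely, at an acnode the zeros of c are not real, and Q has no real zero
because c z is real at real parameters and a real sum of squares is definite; so c b has no real
zero and the inverse is bounded.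

Since curves are bare point sets, this rests on three general facts: the image of a parametrization
is Zariski closed (`zariskiClosure_range`), two parametrizations of one curve differ by a linear
substitution (`exists_comp_eq`), and a real rational curve has a real parametrization
(`exists_isRealParam`). -/

namespace SphCurve

open MvPolynomial

/-! ### Binary forms and their linear factors -/

/-- The linear form vanishing at `v`. -/
noncomputable def lin (v : Fin 2 → ℂ) : MvPolynomial (Fin 2) ℂ := C (v 1) * X 0 - C (v 0) * X 1

@[simp] lemma eval_lin (v w : Fin 2 → ℂ) : eval w (lin v) = v 1 * w 0 - v 0 * w 1 := by
  simp [lin]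

lemma lin_isHomogeneous (v : Fin 2 → ℂ) : (lin v).IsHomogeneous 1 :=
  (isHomogeneous_C_mul_X _ _).sub (isHomogeneous_C_mul_X _ _)

lemma eval_lin_self (v : Fin 2 → ℂ) : eval v (lin v) = 0 := by simp; ring

lemma exists_smul_of_eval_lin {v w : Fin 2 → ℂ} (hv : v ≠ 0) (h : eval w (lin v) = 0) :
    ∃ c : ℂ, w = c • v := by
  rw [eval_lin] at h
  by_cases h0 : v 0 = 0
  · have h1 : v 1 ≠ 0 := fun h1 => hv (by ext i; fin_cases i <;> simp [h0, h1])
    refine ⟨w 1 / v 1, ?_⟩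
    have : w 0 = 0 := by simpa [h0, h1] using h
    ext i; fin_cases i
    · simp [this, h0]
    · simp [h1]
  · refine ⟨w 0 / v 0, ?_⟩
    ext i; fin_cases i
    · simp [h0]
    · simp only [Fin.mk_one, Pi.smul_apply, smul_eq_mul]
      field_simp
      linear_combination -h

lemma mk_eq_mk_iff_lin {v w : Fin 2 → ℂ} (hv : v ≠ 0) (hw : w ≠ 0) :
    (Projectivization.mk ℂ w hw = Projectivization.mk ℂ v hv) ↔ eval w (lin v) = 0 := by
  rw [Projectivization.mk_eq_mk_iff']
  constructor
  · rintro ⟨c, rfl⟩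
    simp; ring
  · intro h
    obtain ⟨c, rfl⟩ := exists_smul_of_eval_lin hv h
    exact ⟨c, rfl⟩

lemma eval_rep_lin_rep {s t : CP 1} : eval s.rep (lin t.rep) = 0 ↔ s = t := by
  rw [← mk_eq_mk_iff_lin t.rep_nonzero s.rep_nonzero, Projectivization.mk_rep,
    Projectivization.mk_rep]

/-- Restriction of a polynomial to the line spanned by `v`. -/
noncomputable def restrict {σ : Type*} (v : σ → ℂ) : MvPolynomial σ ℂ →ₐ[ℂ] Polynomial ℂ :=
  aeval fun i => Polynomial.C (v i) * Polynomial.X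

lemma eval_smul {σ : Type*} {F : MvPolynomial σ ℂ} {n : ℕ} (hF : F.IsHomogeneous n) (c : ℂ)
    (v : σ → ℂ) : eval (c • v) F = c ^ n * eval v F := by
  rw [eval_eq, eval_eq, Finset.mul_sum]
  refine Finset.sum_congr rfl fun m hm => ?_
  rw [hF.degree_eq_sum_deg_support hm]
  simp only [Pi.smul_apply, smul_eq_mul, mul_pow, Finset.prod_mul_distrib, Finset.prod_pow_eq_pow_sum]
  ring

lemma eval_aeval_poly {σ : Type*} (g : σ → Polynomial ℂ) (F : MvPolynomial σ ℂ) (x : ℂ) :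
    (aeval g F).eval x = eval (fun i => (g i).eval x) F := by
  induction F using MvPolynomial.induction_on with
  | C a => simp
  | add p q hp hq => simp [hp, hq]
  | mul_X p i hp => simp [hp]

lemma eval_bind₁_eq {σ τ : Type*} (g : σ → MvPolynomial τ ℂ) (F : MvPolynomial σ ℂ)
    (v : τ → ℂ) : eval v (bind₁ g F) = eval (fun i => eval v (g i)) F := by
  induction F using MvPolynomial.induction_on with
  | C a => simp
  | add p q hp hq => simp [hp, hq]
  | mul_X p i hp => simp [hp]

lemma eval_restrict {σ : Type*} (v : σ → ℂ) (F : MvPolynomial σ ℂ) (x : ℂ) :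
    (restrict v F).eval x = eval (x • v) F := by
  rw [restrict, eval_aeval_poly]
  congr 2
  ext i
  simp only [Polynomial.eval_mul, Polynomial.eval_C, Polynomial.eval_X, Pi.smul_apply, smul_eq_mul]
  exact mul_comm _ _

lemma restrict_of_isHomogeneous {σ : Type*} {F : MvPolynomial σ ℂ} {n : ℕ}
    (hF : F.IsHomogeneous n) (v : σ → ℂ) :
    restrict v F = Polynomial.C (eval v F) * Polynomial.X ^ n := by
  refine Polynomial.funext fun x => ?_
  rw [eval_restrict, eval_smul hF, Polynomial.eval_mul, Polynomial.eval_C, Polynomial.eval_pow,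
    Polynomial.eval_X, mul_comm]

lemma lin_dvd_iff {v : Fin 2 → ℂ} (hv : v ≠ 0) (P : MvPolynomial (Fin 2) ℂ) :
    lin v ∣ P ↔ restrict v P = 0 := by
  constructor
  · rintro ⟨Q, rfl⟩
    rw [map_mul, restrict_of_isHomogeneous (lin_isHomogeneous v), eval_lin_self]
    simp
  · intro h
    rw [← Ideal.mem_span_singleton, ← Ideal.Quotient.eq_zero_iff_mem]
    set I := Ideal.span {lin v}
    have hI : (Ideal.Quotient.mk I) (lin v) = 0 :=
      Ideal.Quotient.eq_zero_iff_mem.2 (Ideal.mem_span_singleton_self _)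
    have key : ∀ i : Fin 2, v i ≠ 0 → Ideal.Quotient.mk I P = 0 := by
      intro i hi
      -- Modulo `lin v` the variable X_j equals (v_j / v_i) X_i, so the quotient map factors through
      -- restriction to the line spanned by `v`.
      have e : (Ideal.Quotient.mkₐ ℂ I) =
          ((Ideal.Quotient.mkₐ ℂ I).comp
            (Polynomial.aeval (C (v i)⁻¹ * X i : MvPolynomial (Fin 2) ℂ))).comp (restrict v) := by
        ext j
        have h2 : Ideal.Quotient.mk I (C (v i) * X j) = Ideal.Quotient.mk I (C (v j) * X i) := by
          rw [← sub_eq_zero, ← map_sub, Ideal.Quotient.eq_zero_iff_mem, Ideal.mem_span_singleton]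
          fin_cases i <;> fin_cases j
          · simp
          · exact ⟨-1, by simp [lin]⟩
          · exact ⟨1, by simp [lin]⟩
          · simp
        have h3 : (X j : MvPolynomial (Fin 2) ℂ) = C (v i)⁻¹ * (C (v i) * X j) := by
          rw [← mul_assoc, ← C_mul, inv_mul_cancel₀ hi, C_1, one_mul]
        simp only [restrict, AlgHom.comp_apply, aeval_X, map_mul, Polynomial.aeval_X,
          Ideal.Quotient.mkₐ_eq_mk, Polynomial.aeval_C]
        conv_lhs => rw [h3, map_mul, h2]
        rw [MvPolynomial.algebraMap_eq, map_mul]; ring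
      have := DFunLike.congr_fun e P
      simpa [h] using this
    by_cases h0 : v 0 = 0
    · exact key 1 fun h1 => hv (by ext i; fin_cases i <;> simp [h0, h1])
    · exact key 0 h0

lemma lin_dvd_iff_eval {v : Fin 2 → ℂ} (hv : v ≠ 0) {F : MvPolynomial (Fin 2) ℂ} {n : ℕ}
    (hF : F.IsHomogeneous n) : lin v ∣ F ↔ eval v F = 0 := by
  rw [lin_dvd_iff hv, restrict_of_isHomogeneous hF]
  simp

lemma lin_ne_zero {v : Fin 2 → ℂ} (hv : v ≠ 0) : lin v ≠ 0 := by
  intro h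
  apply hv
  have h0 := eval_lin v ![1, 0]
  have h1 := eval_lin v ![0, 1]
  simp [h] at h0 h1
  ext i; fin_cases i <;> simp [h0, h1]

/-- `lin v` generates the kernel of `restrict v`, a homomorphism into the domain ℂ[X]. -/
lemma lin_prime {v : Fin 2 → ℂ} (hv : v ≠ 0) : Prime (lin v) := by
  refine ⟨lin_ne_zero hv, fun h => ?_, fun P Q h => ?_⟩
  · have := (lin_dvd_iff hv 1).1 h.dvd
    simp at this
  · rw [lin_dvd_iff hv, map_mul, mul_eq_zero] at h
    rwa [lin_dvd_iff hv, lin_dvd_iff hv]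

/-- A factor of a form by a form can be chosen to be a form. -/
lemma exists_isHomogeneous_of_mul {σ : Type*} {F L G : MvPolynomial σ ℂ} {m n : ℕ}
    (hL : L.IsHomogeneous m) (hF : F.IsHomogeneous n) (h : F = L * G) (h0 : F ≠ 0) :
    G.IsHomogeneous (n - m) ∧ m ≤ n := by
  have hL0 : L ≠ 0 := by rintro rfl; simp at h; exact h0 h
  -- Multiplication by L shifts degrees by m and has no kernel, while the product lives in degree n
  -- alone.
  have hk : ∀ k, k + m ≠ n → homogeneousComponent k G = 0 := by
    intro k hkn
    by_contra hne
    have h1 : F = ∑ i ∈ Finset.range (G.totalDegree + 1), L * homogeneousComponent i G := by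
      rw [← Finset.mul_sum, sum_homogeneousComponent, h]
    have h2 := congrArg (homogeneousComponent (k + m)) h1
    rw [homogeneousComponent_of_mem hF, if_neg hkn, map_sum, Finset.sum_eq_single k] at h2
    · rw [homogeneousComponent_of_mem (n := k + m) (by
        rw [mem_homogeneousSubmodule, add_comm]
        exact hL.mul (homogeneousComponent_isHomogeneous k G)), if_pos rfl] at h2
      exact mul_ne_zero hL0 hne h2.symm
    · intro b _ hb
      rw [homogeneousComponent_of_mem (n := b + m) (by
        rw [mem_homogeneousSubmodule, add_comm]
        exact hL.mul (homogeneousComponent_isHomogeneous b G)), if_neg (by omega)]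
    · intro hk'
      rw [homogeneousComponent_eq_zero (n := k) (φ := G) (by simpa using hk'), mul_zero, map_zero]
  have hmn : m ≤ n := by
    by_contra hlt
    apply h0
    rw [h, ← sum_homogeneousComponent G, Finset.sum_eq_zero, mul_zero]
    exact fun i _ => hk i (by omega)
  refine ⟨?_, hmn⟩
  rw [← sum_homogeneousComponent G]
  refine IsHomogeneous.sum _ _ _ fun i _ => ?_
  by_cases hi : i + m = n
  · rw [show n - m = i by omega]
    exact homogeneousComponent_isHomogeneous i G
  · rw [hk i hi]; exact isHomogeneous_zero _ _ _

lemma exists_eq_lin_mul {v : Fin 2 → ℂ} (hv : v ≠ 0) {F : MvPolynomial (Fin 2) ℂ} {n : ℕ}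
    (hF : F.IsHomogeneous (n + 1)) (h : eval v F = 0) :
    ∃ G, G.IsHomogeneous n ∧ F = lin v * G := by
  by_cases h0 : F = 0
  · exact ⟨0, isHomogeneous_zero _ _ _, by simp [h0]⟩
  obtain ⟨G, hG⟩ := (lin_dvd_iff_eval hv hF).2 h
  exact ⟨G, (exists_isHomogeneous_of_mul (lin_isHomogeneous v) hF hG h0).1, hG⟩

/-- Dehomogenization of a binary form. -/
noncomputable def dehom : MvPolynomial (Fin 2) ℂ →ₐ[ℂ] Polynomial ℂ := aeval ![Polynomial.X, 1]

lemma eval_dehom (F : MvPolynomial (Fin 2) ℂ) (x : ℂ) : (dehom F).eval x = eval ![x, 1] F := by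
  rw [dehom, eval_aeval_poly]
  congr 2
  ext i; fin_cases i <;> simp

lemma vec_eq_smul {v : Fin 2 → ℂ} (h : v 1 ≠ 0) : v = v 1 • ![v 0 / v 1, 1] := by
  ext i; fin_cases i
  · simp; field_simp
  · simp

lemma vec_eq_smul' {v : Fin 2 → ℂ} (h : v 1 = 0) : v = v 0 • ![1, 0] := by
  ext i; fin_cases i
  · simp
  · simpa using h

lemma eq_zero_of_dehom {F : MvPolynomial (Fin 2) ℂ} {n : ℕ} (hF : F.IsHomogeneous n)
    (h : dehom F = 0) : F = 0 := by
  have h1 : ∀ v : Fin 2 → ℂ, v 1 ≠ 0 → eval v F = 0 := by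
    intro v hv
    rw [vec_eq_smul hv, eval_smul hF, ← eval_dehom, h]
    simp
  -- The factor X 1 takes care of the point at infinity, which dehomogenization does not see.
  have h2 : F * X 1 = 0 := by
    refine MvPolynomial.funext fun v => ?_
    by_cases hv : v 1 = 0
    · simp [hv]
    · simp [h1 v hv]
  exact (mul_eq_zero.1 h2).resolve_right (X_ne_zero _)

lemma eval_ne_zero_ext {v : Fin 2 → ℂ} (h : v 0 ≠ 0 ∨ v 1 ≠ 0) : v ≠ 0 := by
  rintro rfl; simp at h

lemma exists_eval_eq_zero {F : MvPolynomial (Fin 2) ℂ} {n : ℕ} (hF : F.IsHomogeneous (n + 1)) :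
    ∃ v : Fin 2 → ℂ, v ≠ 0 ∧ eval v F = 0 := by
  -- Degree 0 means a nonzero constant: then all zeros lie at infinity. The zero polynomial has
  -- degree `⊥` and falls into the other case.
  by_cases hd : (dehom F).degree = 0
  · refine ⟨![1, 0], eval_ne_zero_ext (by simp), ?_⟩
    by_contra h1
    obtain ⟨c, hc⟩ : ∃ c, dehom F = Polynomial.C c := ⟨_, Polynomial.eq_C_of_degree_eq_zero hd⟩
    have hh : F = C c * X 1 ^ (n + 1) := by
      rw [← sub_eq_zero]
      refine eq_zero_of_dehom (n := n + 1) (hF.sub (isHomogeneous_C_mul_X_pow _ _ _)) ?_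
      rw [map_sub, hc]; simp [dehom]
    rw [hh] at h1
    simp at h1
  · obtain ⟨x, hx⟩ := IsAlgClosed.exists_root (dehom F) hd
    refine ⟨![x, 1], eval_ne_zero_ext (by simp), ?_⟩
    rw [← eval_dehom]; exact hx

lemma eq_C_of_isHomogeneous_zero {σ : Type*} {F : MvPolynomial σ ℂ} (hF : F.IsHomogeneous 0) :
    ∃ c, F = C c := by
  rw [← totalDegree_zero_iff_isHomogeneous, totalDegree_eq_zero_iff_eq_C] at hF
  exact ⟨_, hF⟩

/-- Induction on the linear factors of a nonzero binary form. -/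
lemma form_induction {p : ℕ → MvPolynomial (Fin 2) ℂ → Prop}
    (h0 : ∀ c : ℂ, c ≠ 0 → p 0 (C c))
    (h1 : ∀ n (v : Fin 2 → ℂ) (G : MvPolynomial (Fin 2) ℂ), v ≠ 0 → G ≠ 0 → G.IsHomogeneous n →
      p n G → p (n + 1) (lin v * G)) :
    ∀ n (F : MvPolynomial (Fin 2) ℂ), F.IsHomogeneous n → F ≠ 0 → p n F := by
  intro n
  induction n with
  | zero =>
    intro F hF hne
    obtain ⟨c, rfl⟩ := eq_C_of_isHomogeneous_zero hF
    exact h0 c (by rintro rfl; simp at hne)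
  | succ n ih =>
    intro F hF hne
    obtain ⟨v, hv, hv0⟩ := exists_eval_eq_zero hF
    obtain ⟨G, hG, rfl⟩ := exists_eq_lin_mul hv hF hv0
    have hG0 : G ≠ 0 := by rintro rfl; simp at hne
    exact h1 n v G hv hG0 hG (ih G hG hG0)

/-! ### Zeros of binary forms on the projective line and their orders -/

lemma eval_rep_mk {σ : Type*} {F : MvPolynomial σ ℂ} {n : ℕ} (hF : F.IsHomogeneous n)
    {v : σ → ℂ} (hv : v ≠ 0) :
    eval (Projectivization.mk ℂ v hv).rep F = 0 ↔ eval v F = 0 := by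
  obtain ⟨a, ha⟩ := Projectivization.exists_smul_eq_mk_rep ℂ v hv
  rw [← ha, Units.smul_def, eval_smul hF]
  simp

/-- The point of the projective line with affine coordinate `x`. -/
noncomputable def pt (x : ℂ) : CP 1 := Projectivization.mk ℂ ![x, 1] (eval_ne_zero_ext (by simp))

lemma pt_injective : Function.Injective pt := by
  intro x y h
  unfold pt at h
  rw [mk_eq_mk_iff_lin] at h
  simp at h
  linear_combination h

instance : Infinite (CP 1) := Infinite.of_injective pt pt_injective

lemma zeros_finite {n : ℕ} {F : MvPolynomial (Fin 2) ℂ} (hF : F.IsHomogeneous n) (h0 : F ≠ 0) :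
    {t : CP 1 | eval t.rep F = 0}.Finite ∧ {t : CP 1 | eval t.rep F = 0}.ncard ≤ n := by
  refine form_induction (p := fun n F => {t : CP 1 | eval t.rep F = 0}.Finite ∧
    {t : CP 1 | eval t.rep F = 0}.ncard ≤ n) ?_ ?_ n F hF h0
  · intro c hc
    simp [hc]
  · intro n v G hv hG0 hG ⟨ih1, ih2⟩
    have : {t : CP 1 | eval t.rep (lin v * G) = 0} =
        insert (Projectivization.mk ℂ v hv) {t : CP 1 | eval t.rep G = 0} := by
      ext t
      simp only [map_mul, mul_eq_zero, Set.mem_ofPred_eq, Set.mem_insert_iff]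
      rw [← mk_eq_mk_iff_lin hv t.rep_nonzero, Projectivization.mk_rep]
    rw [this]
    exact ⟨ih1.insert _, (Set.ncard_insert_le _ _).trans (by omega)⟩

lemma eq_zero_of_infinite_zeros {n : ℕ} {F : MvPolynomial (Fin 2) ℂ} (hF : F.IsHomogeneous n)
    (h : {t : CP 1 | eval t.rep F = 0}.Infinite) : F = 0 := by
  by_contra h0
  exact h (zeros_finite hF h0).1

lemma eq_zero_of_finite_nonzeros {n : ℕ} {F : MvPolynomial (Fin 2) ℂ} (hF : F.IsHomogeneous n)
    {B : Set (CP 1)} (hB : B.Finite) (h : ∀ t ∉ B, eval t.rep F = 0) : F = 0 :=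
  eq_zero_of_infinite_zeros hF (hB.infinite_compl.mono h)

lemma ordAt_eq_zero_iff {n : ℕ} {F : MvPolynomial (Fin 2) ℂ} (hF : F.IsHomogeneous n) (t : CP 1) :
    ordAt F t = 0 ↔ eval t.rep F ≠ 0 := by
  rw [ne_eq, ← lin_dvd_iff_eval t.rep_nonzero hF]
  exact emultiplicity_eq_zero

lemma ordAt_mul (F G : MvPolynomial (Fin 2) ℂ) (t : CP 1) :
    ordAt (F * G) t = ordAt F t + ordAt G t :=
  emultiplicity_mul (lin_prime t.rep_nonzero)

lemma ordAt_C {c : ℂ} (hc : c ≠ 0) (t : CP 1) : ordAt (C c) t = 0 := by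
  rw [ordAt_eq_zero_iff (isHomogeneous_C _ _)]
  simpa

lemma lin_smul (c : ℂ) (v : Fin 2 → ℂ) : lin (c • v) = C c * lin v := by
  simp [lin]; ring

lemma isUnit_C_iff' {c : ℂ} (hc : c ≠ 0) : IsUnit (C c : MvPolynomial (Fin 2) ℂ) :=
  (IsUnit.mk0 c hc).map C

lemma ordAt_lin {v : Fin 2 → ℂ} (hv : v ≠ 0) (t : CP 1) [Decidable (t = Projectivization.mk ℂ v hv)] :
    ordAt (lin v) t = if t = Projectivization.mk ℂ v hv then 1 else 0 := by
  split_ifs with h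
  · subst h
    obtain ⟨a, ha⟩ := Projectivization.exists_smul_eq_mk_rep ℂ v hv
    have h1 : Associated (lin v) (lin (Projectivization.mk ℂ v hv).rep) := by
      rw [← ha, Units.smul_def, lin_smul, mul_comm]
      exact ⟨(isUnit_C_iff' a.ne_zero).unit, rfl⟩
    have hp := lin_prime (Projectivization.mk ℂ v hv).rep_nonzero
    have := (FiniteMultiplicity.of_prime_left hp hp.ne_zero).emultiplicity_self
    exact (emultiplicity_eq_of_associated_right h1).trans this
  · rw [ordAt_eq_zero_iff (lin_isHomogeneous v), ne_eq, ← mk_eq_mk_iff_lin hv t.rep_nonzero,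
      Projectivization.mk_rep]
    exact h

lemma ordAt_support_finite {n : ℕ} {F : MvPolynomial (Fin 2) ℂ} (hF : F.IsHomogeneous n)
    (h0 : F ≠ 0) : (Function.support fun t => ordAt F t).Finite := by
  refine (zeros_finite hF h0).1.subset fun t ht => ?_
  by_contra h
  exact ht ((ordAt_eq_zero_iff hF t).2 h)

/-- A nonzero form of degree `n` has `n` zeros, counted with multiplicity. -/
lemma finsum_ordAt {n : ℕ} {F : MvPolynomial (Fin 2) ℂ} (hF : F.IsHomogeneous n) (h0 : F ≠ 0) :
    ∑ᶠ t, ordAt F t = n := by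
  classical
  refine form_induction (p := fun n F => ∑ᶠ t, ordAt F t = n) ?_ ?_ n F hF h0
  · intro c hc
    simp [ordAt_C hc]
  · intro n v G hv hG0 hG ih
    simp only [ordAt_mul]
    rw [finsum_add_distrib (ordAt_support_finite (lin_isHomogeneous v) (lin_ne_zero hv))
      (ordAt_support_finite hG hG0), ih]
    simp only [ordAt_lin hv]
    rw [finsum_eq_single _ (Projectivization.mk ℂ v hv) (fun x hx => by simp [hx])]
    simp [add_comm]

/-! ### Common factors, and bases of the forms of a given degree -/

/-- The forms have no common zero on the projective line. -/
def NoCommonZero (F G : MvPolynomial (Fin 2) ℂ) : Prop :=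
  ∀ v : Fin 2 → ℂ, v ≠ 0 → eval v F = 0 → eval v G ≠ 0

/-- At each point one of the coprime cofactors has order 0. This is how multiplicities on the sphere
at infinity are read off from a common factor. -/
lemma min_ordAt_mul {m n : ℕ} {F G : MvPolynomial (Fin 2) ℂ} (hF : F.IsHomogeneous m)
    (hG : G.IsHomogeneous n) (h : NoCommonZero F G) (g : MvPolynomial (Fin 2) ℂ) (t : CP 1) :
    min (ordAt (g * F) t) (ordAt (g * G) t) = ordAt g t := by
  rw [ordAt_mul, ordAt_mul, min_add_add_left]
  have : min (ordAt F t) (ordAt G t) = 0 := by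
    by_cases hF0 : eval t.rep F = 0
    · rw [(ordAt_eq_zero_iff hG t).2 (h _ t.rep_nonzero hF0)]; simp
    · rw [(ordAt_eq_zero_iff hF t).2 hF0]; simp
  rw [this, add_zero]

/-- Two forms have a greatest common divisor; its degree is their intersection multiplicity. -/
lemma exists_gcd {m n : ℕ} {F G : MvPolynomial (Fin 2) ℂ} (hF : F.IsHomogeneous m)
    (hG : G.IsHomogeneous n) (hF0 : F ≠ 0) (hG0 : G ≠ 0) :
    ∃ k m' n' g F' G', g.IsHomogeneous k ∧ F'.IsHomogeneous m' ∧ G'.IsHomogeneous n' ∧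
      k + m' = m ∧ k + n' = n ∧ F = g * F' ∧ G = g * G' ∧ NoCommonZero F' G' ∧
      ∑ᶠ t, min (ordAt F t) (ordAt G t) = k := by
  suffices H : ∃ k m' n' g F' G', g.IsHomogeneous k ∧ F'.IsHomogeneous m' ∧ G'.IsHomogeneous n' ∧
      k + m' = m ∧ k + n' = n ∧ F = g * F' ∧ G = g * G' ∧ NoCommonZero F' G' by
    obtain ⟨k, m', n', g, F', G', hg, hF', hG', hm, hn, h1, h2, h3⟩ := H
    refine ⟨k, m', n', g, F', G', hg, hF', hG', hm, hn, h1, h2, h3, ?_⟩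
    rw [h1, h2]
    simp only [min_ordAt_mul hF' hG' h3]
    exact finsum_ordAt hg (by rintro rfl; simp at h1; exact hF0 h1)
  induction m generalizing n F G with
  | zero =>
    refine ⟨0, 0, n, 1, F, G, isHomogeneous_one _ _, hF, hG, rfl, by omega, by simp, by simp, ?_⟩
    obtain ⟨c, rfl⟩ := eq_C_of_isHomogeneous_zero hF
    intro v _ h
    simp at h
    simp [h] at hF0
  | succ m ih =>
    by_cases hc : NoCommonZero F G
    · exact ⟨0, m + 1, n, 1, F, G, isHomogeneous_one _ _, hF, hG, by omega, by omega, by simp,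
        by simp, hc⟩
    · simp only [NoCommonZero, not_forall, not_not] at hc
      obtain ⟨v, hv, hvF, hvG⟩ := hc
      obtain ⟨F₁, hF₁, rfl⟩ := exists_eq_lin_mul hv hF hvF
      cases n with
      | zero =>
        obtain ⟨c, rfl⟩ := eq_C_of_isHomogeneous_zero hG
        simp at hvG
        simp [hvG] at hG0
      | succ n =>
        obtain ⟨G₁, hG₁, rfl⟩ := exists_eq_lin_mul hv hG hvG
        obtain ⟨k, m', n', g, F', G', hg, hF', hG', hm, hn, h1, h2, h3⟩ :=
          ih hF₁ hG₁ (right_ne_zero_of_mul hF0) (right_ne_zero_of_mul hG0)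
        refine ⟨1 + k, m', n', lin v * g, F', G', (lin_isHomogeneous v).mul hg, hF', hG',
          by omega, by omega, by rw [h1, mul_assoc], by rw [h2, mul_assoc], h3⟩

/-- A form of degree `m + n` is a product of forms of degrees `m` and `n`. -/
lemma exists_mul_of_add {m n : ℕ} {F : MvPolynomial (Fin 2) ℂ} (hF : F.IsHomogeneous (m + n)) :
    ∃ G H, G.IsHomogeneous m ∧ H.IsHomogeneous n ∧ F = G * H := by
  induction m generalizing F with
  | zero => exact ⟨1, F, isHomogeneous_one _ _, by simpa using hF, by simp⟩
  | succ m ih =>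
    rw [show m + 1 + n = m + n + 1 by omega] at hF
    obtain ⟨v, hv, hv0⟩ := exists_eval_eq_zero hF
    obtain ⟨F₁, hF₁, rfl⟩ := exists_eq_lin_mul hv hF hv0
    obtain ⟨G, H, hG, hH, rfl⟩ := ih hF₁
    exact ⟨lin v * G, H, by rw [add_comm]; exact (lin_isHomogeneous v).mul hG, hH, by ring⟩

lemma form_mem_span {n : ℕ} {F : MvPolynomial (Fin 2) ℂ} (hF : F.IsHomogeneous n) :
    F ∈ Submodule.span ℂ (Set.range fun i : Fin (n + 1) =>
      (X 0 ^ (i : ℕ) * X 1 ^ (n - i) : MvPolynomial (Fin 2) ℂ)) := by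
  rw [F.as_sum]
  refine Submodule.sum_mem _ fun m hm => ?_
  have hd := hF.degree_eq_sum_deg_support hm
  have h2 : m 0 + m 1 = n := by
    rw [hd, Finset.sum_subset (Finset.subset_univ _)] <;> simp [Fin.sum_univ_two]
  have : monomial m (coeff m F) =
      coeff m F • (X 0 ^ (m 0) * X 1 ^ (n - m 0) : MvPolynomial (Fin 2) ℂ) := by
    rw [monomial_eq, Finsupp.prod_fintype _ _ (by simp), Fin.prod_univ_two, smul_eq_C_mul,
      show n - m 0 = m 1 by omega]
  rw [this]
  exact Submodule.smul_mem _ _ (Submodule.subset_span ⟨⟨m 0, by omega⟩, rfl⟩)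

/-- `n + 1` linearly independent binary forms of degree `n` span all binary forms of degree `n`. -/
lemma exists_sum_eq_of_linearIndependent {n d : ℕ} (hd : d = n + 1)
    {z : Fin d → MvPolynomial (Fin 2) ℂ} (hz : ∀ i, (z i).IsHomogeneous n)
    (hli : LinearIndependent ℂ z) {F : MvPolynomial (Fin 2) ℂ} (hF : F.IsHomogeneous n) :
    ∃ c : Fin d → ℂ, F = ∑ i, C (c i) * z i := by
  subst hd
  set W := Submodule.span ℂ (Set.range fun i : Fin (n + 1) =>
      (X 0 ^ (i : ℕ) * X 1 ^ (n - i) : MvPolynomial (Fin 2) ℂ)) with hW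
  have hle : Submodule.span ℂ (Set.range z) ≤ W := by
    rw [Submodule.span_le]
    rintro _ ⟨i, rfl⟩
    exact form_mem_span (hz i)
  have : FiniteDimensional ℂ W := FiniteDimensional.span_of_finite ℂ (Set.finite_range _)
  have h1 : Module.finrank ℂ W ≤ n + 1 := by
    have := finrank_range_le_card (R := ℂ) (fun i : Fin (n + 1) =>
      (X 0 ^ (i : ℕ) * X 1 ^ (n - i) : MvPolynomial (Fin 2) ℂ))
    simpa [Set.finrank] using this
  have h2 : Module.finrank ℂ (Submodule.span ℂ (Set.range z)) = n + 1 := by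
    rw [finrank_span_eq_card hli]; simp
  have h3 := Submodule.eq_of_le_of_finrank_le hle (by omega)
  have h4 : F ∈ Submodule.span ℂ (Set.range z) := h3 ▸ form_mem_span hF
  obtain ⟨c, hc⟩ := (Submodule.mem_span_range_iff_exists_fun ℂ).1 h4
  exact ⟨c, by rw [← hc]; simp [smul_eq_C_mul]⟩

/-! ### Finiteness of the ring of binary forms over forms without common zeros -/

lemma homogeneousComponent_mul_right {σ : Type*} {l : MvPolynomial σ ℂ} {n : ℕ}
    (hl : l.IsHomogeneous n) (h : MvPolynomial σ ℂ) (k : ℕ) :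
    homogeneousComponent (k + n) (h * l) = homogeneousComponent k h * l := by
  have hc : ∀ i, (homogeneousComponent i h * l).IsHomogeneous (i + n) :=
    fun i => (homogeneousComponent_isHomogeneous i h).mul hl
  conv_lhs => rw [← sum_homogeneousComponent h, Finset.sum_mul, map_sum]
  rw [Finset.sum_eq_single k]
  · rw [homogeneousComponent_of_mem (hc k), if_pos rfl]
  · intro b _ hb
    rw [homogeneousComponent_of_mem (hc b), if_neg (by omega)]
  · intro hk
    have : homogeneousComponent k h = 0 := homogeneousComponent_eq_zero _ _ (by simpa using hk)
    rw [this, zero_mul, map_zero]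

/-- Nullstellensatz: the `l j` have at most the origin as a common zero, so the variables lie in the
radical of their ideal. -/
lemma exists_X_pow_mem {ι : Type*} {l : ι → MvPolynomial (Fin 2) ℂ}
    (h0 : ∀ v : Fin 2 → ℂ, v ≠ 0 → ∃ j, eval v (l j) ≠ 0) (i : Fin 2) :
    ∃ N, (X i : MvPolynomial (Fin 2) ℂ) ^ N ∈ Ideal.span (Set.range l) := by
  change X i ∈ (Ideal.span (Set.range l)).radical
  rw [← vanishingIdeal_zeroLocus_eq_radical (K := ℂ), mem_vanishingIdeal_iff]
  intro v hv
  have : v = 0 := by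
    by_contra hne
    obtain ⟨j, hj⟩ := h0 v hne
    refine hj ?_
    have := hv (l j) (Ideal.subset_span ⟨j, rfl⟩)
    exact this
  simp [this]

/-- Binary forms of large degree lie in an ideal generated by forms without common zeros. -/
lemma exists_forall_mem_ideal {ι : Type*} {l : ι → MvPolynomial (Fin 2) ℂ}
    (h0 : ∀ v : Fin 2 → ℂ, v ≠ 0 → ∃ j, eval v (l j) ≠ 0) :
    ∃ N, ∀ m, N ≤ m → ∀ F : MvPolynomial (Fin 2) ℂ, F.IsHomogeneous m →
      F ∈ Ideal.span (Set.range l) := by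
  obtain ⟨N₀, h₀⟩ := exists_X_pow_mem h0 0
  obtain ⟨N₁, h₁⟩ := exists_X_pow_mem h0 1
  refine ⟨N₀ + N₁, fun m hm F hF => ?_⟩
  have h := form_mem_span hF
  refine Submodule.span_induction (p := fun x _ => x ∈ Ideal.span (Set.range l)) ?_ (by simp)
    (fun x y _ _ hx hy => Ideal.add_mem _ hx hy) ?_ h
  · rintro _ ⟨i, rfl⟩
    by_cases hi : N₀ ≤ i
    · exact Ideal.mul_mem_right _ _ (Ideal.pow_mem_of_pow_mem _ h₀ hi)
    · exact Ideal.mul_mem_left _ _ (Ideal.pow_mem_of_pow_mem _ h₁ (by omega))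
  · intro a x _ hx
    rw [smul_eq_C_mul]
    exact Ideal.mul_mem_left _ _ hx

/-- The ring of binary forms is finite over the subring generated by forms of positive degree
without common zeros. -/
lemma bind₁_finite {ι : Type*} [Fintype ι] {l : ι → MvPolynomial (Fin 2) ℂ} {n : ℕ} (hn : 0 < n)
    (hl : ∀ j, (l j).IsHomogeneous n)
    (h0 : ∀ v : Fin 2 → ℂ, v ≠ 0 → ∃ j, eval v (l j) ≠ 0) :
    (bind₁ l : MvPolynomial ι ℂ →ₐ[ℂ] MvPolynomial (Fin 2) ℂ).toRingHom.Finite := by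
  obtain ⟨N, hN⟩ := exists_forall_mem_ideal h0
  set f := (bind₁ l : MvPolynomial ι ℂ →ₐ[ℂ] MvPolynomial (Fin 2) ℂ).toRingHom with hf
  let _ := f.toAlgebra
  have hsmul : ∀ (b : MvPolynomial ι ℂ) (x : MvPolynomial (Fin 2) ℂ), b • x = f b * x :=
    fun b x => rfl
  set T : Set (MvPolynomial (Fin 2) ℂ) :=
    Set.range fun p : Fin (N + n) × Fin (N + n) => X 0 ^ (p.1 : ℕ) * X 1 ^ (p.2 : ℕ) with hT
  -- Low degrees are spanned by the monomials in `T`. From degree N + n on, F is a combination of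
  -- the `l j` with coefficients of degree m - n, to which induction applies.
  have key : ∀ m, ∀ F : MvPolynomial (Fin 2) ℂ, F.IsHomogeneous m →
      F ∈ Submodule.span (MvPolynomial ι ℂ) T := by
    intro m
    induction m using Nat.strong_induction_on with
    | _ m ih =>
      intro F hF
      by_cases hm : m < N + n
      · refine Submodule.span_induction
          (p := fun x _ => x ∈ Submodule.span (MvPolynomial ι ℂ) T) ?_ (Submodule.zero_mem _)
          (fun x y _ _ hx hy => Submodule.add_mem _ hx hy) ?_ (form_mem_span hF)
        · rintro _ ⟨i, rfl⟩
          exact Submodule.subset_span ⟨(⟨i, by omega⟩, ⟨m - i, by omega⟩), rfl⟩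
        · intro a x _ hx
          have : a • x = (C a : MvPolynomial ι ℂ) • x := by
            rw [hsmul, smul_eq_C_mul]; simp [hf]
          rw [this]
          exact Submodule.smul_mem _ _ hx
      · obtain ⟨h, hh⟩ := Ideal.mem_span_range_iff_exists_fun.1 (hN m (by omega) F hF)
        have h2 : F = ∑ j, homogeneousComponent (m - n) (h j) * l j := by
          have := congrArg (homogeneousComponent (m - n + n)) hh
          rw [map_sum] at this
          simp only [homogeneousComponent_mul_right (hl _)] at this
          rw [this, homogeneousComponent_of_mem hF, if_pos (by omega)]
        rw [h2]
        refine Submodule.sum_mem _ fun j _ => ?_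
        have := Submodule.smul_mem _ (X j : MvPolynomial ι ℂ)
          (ih (m - n) (by omega) _ (homogeneousComponent_isHomogeneous (m - n) (h j)))
        rw [hsmul] at this
        simpa [hf, mul_comm] using this
  change Module.Finite (MvPolynomial ι ℂ) (MvPolynomial (Fin 2) ℂ)
  refine ⟨Submodule.fg_def.2 ⟨T, Set.finite_range _, ?_⟩⟩
  rw [eq_top_iff]
  intro F _
  rw [← sum_homogeneousComponent F]
  exact Submodule.sum_mem _ fun i _ => key i _ (homogeneousComponent_isHomogeneous i F)

/-! ### The image of a parametrization is Zariski closed -/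

namespace BirationalParam

variable {d : ℕ} (φ : BirationalParam d)

/-- Values of the forms of a parametrization. -/
noncomputable def vec (v : Fin 2 → ℂ) : Fin (d + 1) → ℂ := fun i => eval v (φ.form i)

lemma vec_apply (v : Fin 2 → ℂ) (i : Fin (d + 1)) : φ.vec v i = eval v (φ.form i) := rfl

lemma vec_ne_zero {v : Fin 2 → ℂ} (hv : v ≠ 0) : φ.vec v ≠ 0 := φ.no_common_zero v hv

lemma vec_smul (c : ℂ) (v : Fin 2 → ℂ) : φ.vec (c • v) = c ^ φ.deg • φ.vec v := by
  ext i
  simp [vec, eval_smul (φ.homog i)]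

lemma map_mk (v : Fin 2 → ℂ) (hv : v ≠ 0) :
    φ.map (Projectivization.mk ℂ v hv) = Projectivization.mk ℂ (φ.vec v) (φ.vec_ne_zero hv) := by
  obtain ⟨a, ha⟩ := Projectivization.exists_smul_eq_mk_rep ℂ v hv
  refine (Projectivization.mk_eq_mk_iff' _ _ _ _ _).2 ⟨(a : ℂ) ^ φ.deg, ?_⟩
  rw [← vec_smul, ← Units.smul_def, ha]
  rfl

lemma map_eq (t : CP 1) :
    φ.map t = Projectivization.mk ℂ (φ.vec t.rep) (φ.vec_ne_zero t.rep_nonzero) := rfl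

lemma eval_rep_map {F : MvPolynomial (Fin (d + 1)) ℂ} {n : ℕ} (hF : F.IsHomogeneous n)
    (t : CP 1) : eval (φ.map t).rep F = 0 ↔ eval t.rep (bind₁ φ.form F) = 0 := by
  rw [map_eq, eval_rep_mk hF, eval_bind₁_eq]
  rfl

lemma bind₁_isHomogeneous {F : MvPolynomial (Fin (d + 1)) ℂ} {n : ℕ} (hF : F.IsHomogeneous n) :
    (bind₁ φ.form F).IsHomogeneous (φ.deg * n) :=
  hF.aeval _ φ.homog

lemma vanishesOn_range_iff {F : MvPolynomial (Fin (d + 1)) ℂ} {n : ℕ} :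
    VanishesOn (Set.range φ.map) n F ↔ F.IsHomogeneous n ∧ bind₁ φ.form F = 0 := by
  constructor
  · rintro ⟨hF, h⟩
    refine ⟨hF, eq_zero_of_finite_nonzeros (φ.bind₁_isHomogeneous hF) Set.finite_empty ?_⟩
    intro t _
    rw [← eval_rep_map φ hF]
    exact h _ ⟨t, rfl⟩
  · rintro ⟨hF, h⟩
    refine ⟨hF, ?_⟩
    rintro _ ⟨t, rfl⟩
    rw [eval_rep_map φ hF, h, map_zero]

/-- The finite set of parameters at which the parametrization is not injective. -/
def nonInj : Set (CP 1) := {t | ∃ u, u ≠ t ∧ φ.map u = φ.map t}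

lemma nonInj_finite : φ.nonInj.Finite := φ.finite_noninj

lemma eq_of_map_eq {s t : CP 1} (hs : s ∉ φ.nonInj) (h : φ.map s = φ.map t) : s = t := by
  by_contra hne
  exact hs ⟨t, Ne.symm hne, h.symm⟩

lemma injOn_compl : Set.InjOn φ.map φ.nonInjᶜ := fun _ hs _ _ h => φ.eq_of_map_eq hs h

lemma fiber_finite (p : CP d) : {t | φ.map t = p}.Finite := by
  by_cases h : ∃ t, t ∉ φ.nonInj ∧ φ.map t = p
  · obtain ⟨t, ht, rfl⟩ := h
    refine (Set.finite_singleton t).subset fun s hs => (φ.eq_of_map_eq ht (Eq.symm hs)).symm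
  · push Not at h
    exact φ.nonInj_finite.subset fun t ht => by_contra fun hn => h t hn ht

lemma preimage_finite {S : Set (CP d)} (hS : S.Finite) : (φ.map ⁻¹' S).Finite :=
  hS.preimage' fun p _ => φ.fiber_finite p

lemma image_infinite {T : Set (CP 1)} (hT : T.Infinite) : (φ.map '' T).Infinite := fun h =>
  hT ((φ.preimage_finite h).subset (Set.subset_preimage_image _ _))

lemma range_infinite : (Set.range φ.map).Infinite := by
  rw [← Set.image_univ]
  exact φ.image_infinite Set.infinite_univ

lemma deg_pos : 0 < φ.deg := by
  by_contra h
  have h0 : φ.deg = 0 := by omega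
  have hv : ∀ v w, φ.vec v = φ.vec w := by
    intro v w
    ext i
    obtain ⟨c, hc⟩ := eq_C_of_isHomogeneous_zero (h0 ▸ φ.homog i)
    simp [vec, hc]
  refine φ.range_infinite ((Set.finite_singleton (φ.map (pt 0))).subset ?_)
  rintro _ ⟨t, rfl⟩
  simp only [Set.mem_singleton_iff, map_eq]
  simp only [hv t.rep (pt 0).rep]

/-- The homogeneous ideal of the image contains the components of every polynomial relation. -/
lemma restrict_eq_zero {w : Fin (d + 1) → ℂ}
    (hw : ∀ n F, VanishesOn (Set.range φ.map) n F → eval w F = 0)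
    {F : MvPolynomial (Fin (d + 1)) ℂ} (hF : bind₁ φ.form F = 0) : restrict w F = 0 := by
  -- Pulling back multiplies degrees by the positive number `φ.deg`, so different components of F
  -- land in different degrees and cannot cancel.
  have hc : ∀ m, bind₁ φ.form (homogeneousComponent m F) = 0 := by
    intro m
    by_cases hm : m ∈ Finset.range (F.totalDegree + 1)
    · rw [← sum_homogeneousComponent F, map_sum] at hF
      have := congrArg (homogeneousComponent (φ.deg * m)) hF
      rw [map_sum, Finset.sum_eq_single m, map_zero, homogeneousComponent_of_mem
        (φ.bind₁_isHomogeneous (homogeneousComponent_isHomogeneous m F)), if_pos rfl] at this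
      · exact this
      · intro b _ hb
        rw [homogeneousComponent_of_mem
          (φ.bind₁_isHomogeneous (homogeneousComponent_isHomogeneous b F)), if_neg]
        intro h
        exact hb (Nat.eq_of_mul_eq_mul_left φ.deg_pos h).symm
      · exact fun h => absurd hm h
    · rw [homogeneousComponent_eq_zero _ _ (by simpa using hm), map_zero]
  rw [← sum_homogeneousComponent F, map_sum]
  refine Finset.sum_eq_zero fun m _ => ?_
  have hm := homogeneousComponent_isHomogeneous m F
  rw [restrict_of_isHomogeneous hm, hw m _ (φ.vanishesOn_range_iff.2 ⟨hm, hc m⟩)]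
  simp

/-- The image of a parametrization is Zariski closed. -/
lemma zariskiClosure_range : zariskiClosure (Set.range φ.map) = Set.range φ.map := by
  refine Set.Subset.antisymm (fun p hp => ?_) fun p hp n F hF => hF.2 p hp
  by_contra hpn
  set w := p.rep with hwdef
  obtain ⟨i₀, hi₀⟩ : ∃ i, w i ≠ 0 := Function.ne_iff.1 p.rep_nonzero
  -- The `l j` pull back the linear forms `ℓ j` that cut out the point p. As p is not on the curve,
  -- they have no common zero, and every form is integral over them.
  set l : Fin (d + 1) → MvPolynomial (Fin 2) ℂ :=
    fun j => C (w i₀) * φ.form j - C (w j) * φ.form i₀ with hl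
  have hlh : ∀ j, (l j).IsHomogeneous φ.deg := fun j =>
    ((φ.homog j).C_mul _).sub ((φ.homog i₀).C_mul _)
  have h0 : ∀ v : Fin 2 → ℂ, v ≠ 0 → ∃ j, eval v (l j) ≠ 0 := by
    intro v hv
    by_contra! hall
    refine hpn ⟨Projectivization.mk ℂ v hv, ?_⟩
    rw [map_mk, ← p.mk_rep, Projectivization.mk_eq_mk_iff']
    refine ⟨eval v (φ.form i₀) / w i₀, ?_⟩
    ext j
    have := hall j
    simp only [hl, map_sub, map_mul, eval_C] at this
    simp only [Pi.smul_apply, smul_eq_mul, vec]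
    field_simp
    linear_combination -this
  obtain ⟨P, hP, hP0⟩ := (bind₁_finite φ.deg_pos hlh h0).to_isIntegral (φ.form i₀)
  set ℓ : Fin (d + 1) → MvPolynomial (Fin (d + 1)) ℂ :=
    fun j => C (w i₀) * X j - C (w j) * X i₀ with hℓ
  -- The integral equation of `φ.form i₀` lifts to a polynomial F vanishing on the curve. On the
  -- line of p all `ℓ j` vanish, so F restricts to a monic polynomial with constant coefficients,
  -- evaluated at a multiple of the variable; this cannot be zero.
  set F := P.eval₂ (bind₁ ℓ : MvPolynomial (Fin (d + 1)) ℂ →ₐ[ℂ] _).toRingHom (X i₀) with hF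
  have h1 : bind₁ φ.form F = 0 := by
    rw [← hP0, hF]
    have := Polynomial.hom_eval₂ P (bind₁ ℓ : MvPolynomial (Fin (d + 1)) ℂ →ₐ[ℂ] _).toRingHom
      (bind₁ φ.form).toRingHom (X i₀)
    have e : (bind₁ φ.form).toRingHom.comp
        (bind₁ ℓ : MvPolynomial (Fin (d + 1)) ℂ →ₐ[ℂ] _).toRingHom = (bind₁ l).toRingHom := by
      refine MvPolynomial.ringHom_ext (fun r => by simp) fun j => by simp [hℓ, hl]
    rw [e] at this
    simpa using this
  have h2 := φ.restrict_eq_zero (w := w) hp h1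
  have h3 : restrict w F = (P.map constantCoeff).eval₂ Polynomial.C
      (Polynomial.C (w i₀) * Polynomial.X) := by
    have := Polynomial.hom_eval₂ P (bind₁ ℓ : MvPolynomial (Fin (d + 1)) ℂ →ₐ[ℂ] _).toRingHom
      (restrict w).toRingHom (X i₀)
    have e : (restrict w).toRingHom.comp
        (bind₁ ℓ : MvPolynomial (Fin (d + 1)) ℂ →ₐ[ℂ] _).toRingHom
        = Polynomial.C.comp constantCoeff := by
      refine MvPolynomial.ringHom_ext (fun r => ?_) fun j => ?_
      · simp [restrict]
      · simp [hℓ, restrict]; ring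
    rw [e] at this
    rw [Polynomial.eval₂_map, hF]
    refine Eq.trans this ?_
    simp [restrict]
  have hq : P.map constantCoeff = 0 := by
    refine Polynomial.funext fun x => ?_
    have := congrArg (Polynomial.eval (x / w i₀)) (h3.symm.trans h2)
    rw [← Polynomial.comp, Polynomial.eval_comp] at this
    simpa [mul_div_cancel₀ _ hi₀] using this
  exact (hP.map constantCoeff).ne_zero hq

/-- A subset of the curve containing all but finitely many points is Zariski dense in it. -/
lemma zariskiClosure_eq_range {S : Set (CP d)} (hS : S ⊆ Set.range φ.map) {B : Set (CP 1)}
    (hB : B.Finite) (h : ∀ t ∉ B, φ.map t ∈ S) : zariskiClosure S = Set.range φ.map := by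
  rw [← zariskiClosure_range]
  refine Set.Subset.antisymm (fun p hp n F hF => hp n F ⟨hF.1, fun q hq => hF.2 q (hS hq)⟩) ?_
  intro p hp n F hF
  refine hp n F (φ.vanishesOn_range_iff.2 ⟨hF.1, ?_⟩)
  refine eq_zero_of_finite_nonzeros (φ.bind₁_isHomogeneous hF.1) hB fun t ht => ?_
  rw [← eval_rep_map φ hF.1]
  exact hF.2 _ (h t ht)

end BirationalParam

/-! ### General members of pencils and the degree of a rational curve -/

/-- The linear factors of F are prime and none divides g, so they can be stripped from h one by one.
-/
lemma dvd_of_dvd_mul_of_noCommonZero {n k : ℕ} {F g h : MvPolynomial (Fin 2) ℂ}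
    (hF : F.IsHomogeneous n) (hF0 : F ≠ 0) (hg : g.IsHomogeneous k) (hfg : NoCommonZero F g)
    (hd : F ∣ g * h) : F ∣ h := by
  suffices H : ∀ h, F ∣ g * h → F ∣ h from H h hd
  clear hd h
  revert hfg
  refine form_induction (p := fun _ F => NoCommonZero F g → ∀ h, F ∣ g * h → F ∣ h)
    ?_ ?_ n F hF hF0
  · intro c hc _ h _
    exact (isUnit_C_iff' hc).dvd
  · intro n v G hv hG0 hG ih hN h hd
    have h1 : lin v ∣ g * h := (dvd_mul_right _ _).trans hd
    rcases (lin_prime hv).dvd_or_dvd h1 with h2 | ⟨h', rfl⟩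
    · rw [lin_dvd_iff_eval hv hg] at h2
      exact absurd h2 (hN v hv (by rw [map_mul, eval_lin_self, zero_mul]))
    · refine mul_dvd_mul_left _ (ih (fun w hw hw0 => hN w hw (by simp [hw0])) _ ?_)
      rw [mul_left_comm] at hd
      exact (mul_dvd_mul_iff_left (lin_ne_zero hv)).1 hd

lemma euler {n : ℕ} {F : MvPolynomial (Fin 2) ℂ} (hF : F.IsHomogeneous n) :
    X 0 * pderiv 0 F + X 1 * pderiv 1 F = C (n : ℂ) * F := by
  have := hF.sum_X_mul_pderiv
  rw [Fin.sum_univ_two] at this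
  rw [this, nsmul_eq_mul, map_natCast]

/-- The Jacobian determinant of two binary forms. -/
noncomputable def jac (f g : MvPolynomial (Fin 2) ℂ) : MvPolynomial (Fin 2) ℂ :=
  pderiv 0 f * pderiv 1 g - pderiv 1 f * pderiv 0 g

lemma jac_isHomogeneous {m n : ℕ} {f g : MvPolynomial (Fin 2) ℂ} (hf : f.IsHomogeneous m)
    (hg : g.IsHomogeneous n) : (jac f g).IsHomogeneous (m - 1 + (n - 1)) :=
  (hf.pderiv.mul hg.pderiv).sub (hf.pderiv.mul hg.pderiv)

/-- If the Jacobian vanished, Euler's identity would give g ∂f = f ∂g. By coprimality f would divide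
its own partial derivatives, which have smaller degree; so these vanish, and Euler gives n f = 0. -/
lemma jac_ne_zero {n : ℕ} (hn : 0 < n) {f g : MvPolynomial (Fin 2) ℂ} (hf : f.IsHomogeneous n)
    (hg : g.IsHomogeneous n) (hfg : NoCommonZero f g) : jac f g ≠ 0 := by
  intro h
  have hnC : (C (n : ℂ) : MvPolynomial (Fin 2) ℂ) ≠ 0 := by simpa using hn.ne'
  have hf0 : f ≠ 0 := by
    rintro rfl
    obtain ⟨k, rfl⟩ : ∃ k, n = k + 1 := ⟨n - 1, by omega⟩
    obtain ⟨v, hv, hv0⟩ := exists_eval_eq_zero hg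
    exact hfg v hv (by simp) hv0
  have key : ∀ i : Fin 2, C (n : ℂ) * (g * pderiv i f) = C (n : ℂ) * (f * pderiv i g) := by
    intro i
    have e1 := euler hf
    have e2 := euler hg
    unfold jac at h
    fin_cases i
    · change C (n : ℂ) * (g * pderiv 0 f) = C (n : ℂ) * (f * pderiv 0 g)
      linear_combination (-pderiv 0 f) * e2 + pderiv 0 g * e1 + X 1 * h
    · change C (n : ℂ) * (g * pderiv 1 f) = C (n : ℂ) * (f * pderiv 1 g)
      linear_combination (-pderiv 1 f) * e2 + pderiv 1 g * e1 - X 0 * h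
  have hz : ∀ i : Fin 2, pderiv i f = 0 := by
    intro i
    by_contra hne
    have hd : f ∣ pderiv i f := dvd_of_dvd_mul_of_noCommonZero hf hf0 hg hfg
      ⟨pderiv i g, mul_left_cancel₀ hnC (key i)⟩
    obtain ⟨q, hq⟩ := hd
    have := (exists_isHomogeneous_of_mul hf (hf.pderiv (i := i)) hq hne).2
    omega
  have e := euler hf
  rw [hz, hz] at e
  simp only [mul_zero, add_zero] at e
  exact mul_ne_zero hnC hf0 e.symm

/-- The product of the finitely many nonzero linear forms in b is a nonzero polynomial, hence
nonzero somewhere. -/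
lemma exists_linear_ne_zero {m : ℕ} {ι : Type*} {Z : Set ι} (hZ : Z.Finite) {x : ι → Fin m → ℂ}
    (hx : ∀ t ∈ Z, x t ≠ 0) : ∃ b : Fin m → ℂ, ∀ t ∈ Z, ∑ i, b i * x t i ≠ 0 := by
  have h : (∏ t ∈ hZ.toFinset, ∑ i, X i * C (x t i) : MvPolynomial (Fin m) ℂ) ≠ 0 := by
    rw [Finset.prod_ne_zero_iff]
    intro t ht h0
    obtain ⟨i, hi⟩ := Function.ne_iff.1 (hx t (by simpa using ht))
    have := congrArg (eval (Pi.single i 1)) h0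
    simp [Pi.single_apply] at this
    exact hi this
  obtain ⟨b, hb⟩ : ∃ b, eval b (∏ t ∈ hZ.toFinset, ∑ i, X i * C (x t i)) ≠ 0 := by
    by_contra! hall
    exact h (MvPolynomial.funext fun b => by rw [hall b, map_zero])
  refine ⟨b, fun t ht => ?_⟩
  rw [map_prod, Finset.prod_ne_zero_iff] at hb
  have := hb t (by simpa using ht)
  simpa using this

/-- A general member of a pencil without base points has only simple zeros, which avoid a given
finite set. -/
lemma exists_pencil {n : ℕ} (hn : 0 < n) {f g : MvPolynomial (Fin 2) ℂ} (hf : f.IsHomogeneous n)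
    (hg : g.IsHomogeneous n) (hfg : NoCommonZero f g) {B : Set (CP 1)} (hB : B.Finite) :
    ∃ c : ℂ, f + C c * g ≠ 0 ∧ (∀ t ∈ B, eval t.rep (f + C c * g) ≠ 0) ∧
      {t : CP 1 | eval t.rep (f + C c * g) = 0}.ncard = n := by
  have hJ := jac_ne_zero hn hf hg hfg
  -- Multiple zeros of f + c g are zeros of the Jacobian. So c only has to avoid the values of -f/g
  -- at finitely many points; a value with g = 0 is a harmless default, since f does not vanish
  -- there.
  have hfin := (zeros_finite (jac_isHomogeneous hf hg) hJ).1.union hB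
  obtain ⟨c, hc⟩ := (hfin.image fun t => -(eval t.rep f / eval t.rep g)).exists_notMem
  have hgood : ∀ t : CP 1, (eval t.rep (jac f g) = 0 ∨ t ∈ B) →
      eval t.rep (f + C c * g) ≠ 0 := by
    intro t ht h0
    simp only [map_add, map_mul, eval_C] at h0
    by_cases hg0 : eval t.rep g = 0
    · rw [hg0, mul_zero, add_zero] at h0
      exact hfg _ t.rep_nonzero h0 hg0
    · refine hc ⟨t, ht, ?_⟩
      field_simp
      linear_combination -h0
  have hh : (f + C c * g).IsHomogeneous n := hf.add (hg.C_mul c)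
  have h0 : f + C c * g ≠ 0 := by
    intro h0
    refine hJ ?_
    rw [eq_neg_of_add_eq_zero_left h0]
    simp only [jac, map_neg, pderiv_C_mul]
    ring
  refine ⟨c, h0, fun t ht => hgood t (Or.inr ht), ?_⟩
  have hZ := (zeros_finite hh h0).1
  have hord : ∀ t : CP 1, eval t.rep (f + C c * g) = 0 → ordAt (f + C c * g) t = 1 := by
    intro t ht
    refine emultiplicity_eq_of_dvd_of_not_dvd (k := 1) ?_ ?_
    · rw [pow_one]; exact (lin_dvd_iff_eval t.rep_nonzero hh).2 ht
    · rintro ⟨q, hq⟩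
      refine hgood t (Or.inl ?_) ht
      -- At a double zero both partial derivatives of f + c g vanish, which makes the gradients of f
      -- and g proportional.
      have hp : ∀ i, eval t.rep (pderiv i f) = - c * eval t.rep (pderiv i g) := by
        intro i
        have h1 := congrArg (fun p => eval t.rep (pderiv i p)) hq
        have h2 := eval_lin_self t.rep
        unfold lin at h2
        simp only [map_add, Derivation.leibniz, Derivation.leibniz_pow, smul_eq_mul,
          map_mul, eval_C, map_pow, nsmul_eq_mul] at h1
        rw [h2] at h1
        simp at h1
        linear_combination h1
      simp only [jac, map_sub, map_mul, hp]
      ring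
  have hs := finsum_ordAt hh h0
  rw [finsum_eq_sum_of_support_subset (s := hZ.toFinset)] at hs
  · rw [Finset.sum_congr rfl (g := fun _ => (1 : ℕ∞)) (fun t ht => hord t (by simpa using ht))] at hs
    rw [Set.ncard_eq_toFinset_card _ hZ]
    simpa using hs
  · intro t ht
    by_contra hne
    exact ht ((ordAt_eq_zero_iff hh t).2 fun h => hne (by simpa using h))

namespace BirationalParam

variable {d : ℕ} (φ : BirationalParam d)

/-- The pullback of a linear form. -/
noncomputable def comb (a : Fin (d + 1) → ℂ) : MvPolynomial (Fin 2) ℂ := ∑ i, C (a i) * φ.form i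

lemma comb_isHomogeneous (a : Fin (d + 1) → ℂ) : (φ.comb a).IsHomogeneous φ.deg :=
  IsHomogeneous.sum _ _ _ fun i _ => (φ.homog i).C_mul _

lemma eval_comb (a : Fin (d + 1) → ℂ) (v : Fin 2 → ℂ) :
    eval v (φ.comb a) = ∑ i, a i * φ.vec v i := by
  simp [comb, vec]

lemma map_mem_hyperplane (a : Fin (d + 1) → ℂ) (t : CP 1) :
    φ.map t ∈ hyperplane a ↔ eval t.rep (φ.comb a) = 0 := by
  have h1 : (∑ i, C (a i) * X i : MvPolynomial (Fin (d + 1)) ℂ).IsHomogeneous 1 :=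
    IsHomogeneous.sum _ _ _ fun i _ => isHomogeneous_C_mul_X _ _
  have := φ.eval_rep_map h1 t
  simp only [map_sum, map_mul, eval_C, eval_X, bind₁_X_right, bind₁_C_right] at this
  simpa [hyperplane, eval_comb, vec] using this

lemma range_inter_hyperplane (a : Fin (d + 1) → ℂ) :
    Set.range φ.map ∩ hyperplane a = φ.map '' {t | eval t.rep (φ.comb a) = 0} := by
  ext p
  constructor
  · rintro ⟨⟨t, rfl⟩, h⟩
    exact ⟨t, (φ.map_mem_hyperplane a t).1 h, rfl⟩
  · rintro ⟨t, h, rfl⟩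
    exact ⟨⟨t, rfl⟩, (φ.map_mem_hyperplane a t).2 h⟩

lemma range_subset_hyperplane (a : Fin (d + 1) → ℂ) :
    Set.range φ.map ⊆ hyperplane a ↔ φ.comb a = 0 := by
  constructor
  · intro h
    refine eq_zero_of_finite_nonzeros (φ.comb_isHomogeneous a) Set.finite_empty fun t _ => ?_
    rw [← map_mem_hyperplane]
    exact h ⟨t, rfl⟩
  · rintro h _ ⟨t, rfl⟩
    rw [map_mem_hyperplane, h, map_zero]

lemma nonDegenerate_iff : NonDegenerate (Set.range φ.map) ↔ LinearIndependent ℂ φ.form := by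
  rw [Fintype.linearIndependent_iff]
  simp only [NonDegenerate, range_subset_hyperplane, comb, smul_eq_C_mul]
  constructor
  · intro h a ha
    by_contra hne
    exact h a (fun h0 => hne fun i => congrFun h0 i) ha
  · intro h a ha h0
    exact ha (funext (h a h0))

/-- The degree of a rational curve is the degree of its birational parametrizations. -/
lemma hasDegree : HasDegree (Set.range φ.map) φ.deg := by
  constructor
  · obtain ⟨i, hi⟩ : ∃ i, φ.form i ≠ 0 := by
      by_contra! h
      exact φ.vec_ne_zero (pt 0).rep_nonzero (funext fun i => by simp [vec, h])
    have hZ := (zeros_finite (φ.homog i) hi).1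
    -- A second hyperplane section, disjoint from the first, gives a pencil without base points. Its
    -- general member has `φ.deg` simple zeros outside `nonInj`, hence as many distinct image
    -- points.
    obtain ⟨b, hb⟩ := exists_linear_ne_zero (x := fun t : CP 1 => φ.vec t.rep) hZ
      fun t _ => φ.vec_ne_zero t.rep_nonzero
    have hN : NoCommonZero (φ.form i) (φ.comb b) := by
      intro v hv h0 h1
      refine hb (Projectivization.mk ℂ v hv) ((eval_rep_mk (φ.homog i) hv).2 h0) ?_
      rw [← eval_comb, eval_rep_mk (φ.comb_isHomogeneous b) hv]
      exact h1
    obtain ⟨c, hc0, hcB, hcn⟩ := exists_pencil φ.deg_pos (φ.homog i) (φ.comb_isHomogeneous b) hN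
      φ.nonInj_finite
    have he : φ.form i + C c * φ.comb b = φ.comb (Pi.single i 1 + c • b) := by
      simp only [comb, Pi.add_apply, map_add, add_mul, Finset.sum_add_distrib, Pi.smul_apply,
        smul_eq_mul, map_mul, Finset.mul_sum, mul_assoc]
      congr 1
      rw [Finset.sum_eq_single i] <;> simp +contextual
    rw [he] at hc0 hcB hcn
    refine ⟨Pi.single i 1 + c • b, ?_, ?_⟩
    · intro h0
      rw [h0] at hc0
      simp [comb] at hc0
    · rw [range_inter_hyperplane]
      refine ⟨(zeros_finite (φ.comb_isHomogeneous _) hc0).1.image _, ?_⟩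
      rw [Set.InjOn.ncard_image, hcn]
      exact φ.injOn_compl.mono fun t ht hB => hcB t hB ht
  · rintro n ⟨a, ha, hfin, rfl⟩
    have h0 : φ.comb a ≠ 0 := by
      intro h0
      rw [Set.inter_eq_left.2 ((φ.range_subset_hyperplane a).2 h0)] at hfin
      exact φ.range_infinite hfin
    obtain ⟨h1, h2⟩ := zeros_finite (φ.comb_isHomogeneous a) h0
    rw [range_inter_hyperplane]
    exact (Set.ncard_image_le h1).trans h2

end BirationalParam

end SphCurve

namespace SphCurve

open Polynomial

/-! ### A unique solution depending on a parameter is a rational function of it -/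

section RationalRoot

lemma exists_clear {ι : Type*} [Fintype ι] (f : ι → (RatFunc ℂ)[X]) :
    ∃ D : ℂ[X], D ≠ 0 ∧ ∃ g : ι → ℂ[X][X],
      ∀ i, (g i).map (algebraMap ℂ[X] (RatFunc ℂ)) = C (algebraMap ℂ[X] (RatFunc ℂ) D) * f i := by
  classical
  have h1 : ∀ p : (RatFunc ℂ)[X], ∃ D : ℂ[X], D ≠ 0 ∧ ∃ g : ℂ[X][X],
      g.map (algebraMap ℂ[X] (RatFunc ℂ)) = C (algebraMap ℂ[X] (RatFunc ℂ) D) * p := by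
    intro p
    obtain ⟨b, hb0, hb⟩ := IsLocalization.integerNormalization_spec (nonZeroDivisors ℂ[X]) p
    refine ⟨b, nonZeroDivisors.ne_zero hb0, _, hb.trans ?_⟩
    rw [← Polynomial.smul_eq_C_mul]
    ext n
    simp [Algebra.smul_def]
  choose D hD g hg using fun i => h1 (f i)
  refine ⟨∏ i, D i, Finset.prod_ne_zero_iff.2 fun i _ => hD i,
    fun i => C (∏ j ∈ Finset.univ.erase i, D j) * g i, fun i => ?_⟩
  rw [Polynomial.map_mul, map_C, hg, ← mul_assoc, ← C_mul, ← map_mul,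
    Finset.prod_erase_mul _ _ (Finset.mem_univ i)]

lemma map_eval_injective : Function.Injective (Polynomial.map (algebraMap ℂ[X] (RatFunc ℂ))) :=
  Polynomial.map_injective _ (IsFractionRing.injective _ _)

lemma exists_good {B : Set ℂ} (hB : B.Finite) {D : ℂ[X]} (hD : D ≠ 0) :
    ∃ s, s ∉ B ∧ D.eval s ≠ 0 := by
  obtain ⟨s, hs⟩ := (hB.union (D.rootSet_finite ℂ)).exists_notMem
  refine ⟨s, fun h => hs (Or.inl h), fun h => hs (Or.inr ?_)⟩
  rw [Polynomial.mem_rootSet]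
  exact ⟨hD, by simpa using h⟩

/-- If a system of polynomial equations in `t`, depending polynomially on `s`, has exactly one
solution for almost every `s`, then this solution is a rational function of `s`. -/
lemma exists_rational_root {ι : Type*} [Fintype ι] (P : ι → ℂ[X][X]) {B : Set ℂ} (hB : B.Finite)
    (h : ∀ s ∉ B, ∃! t : ℂ, ∀ i, ((P i).map (evalRingHom s)).eval t = 0) :
    ∃ α β : ℂ[X], IsCoprime α β ∧ ∃ B' : Set ℂ, B'.Finite ∧
      ∀ s ∉ B', α.eval s ≠ 0 ∧ ∀ i, ((P i).map (evalRingHom s)).eval (β.eval s / α.eval s) = 0 := by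
  classical
  set ρ := algebraMap ℂ[X] (RatFunc ℂ)
  -- The generic greatest common divisor G of the system. If it were a unit, a Bézout identity with
  -- denominators cleared would rule out solutions for general s; if it were 0, every t would be a
  -- solution.
  set I : Ideal (RatFunc ℂ)[X] := Ideal.span (Set.range fun i => (P i).map ρ) with hI
  have hmem : ∀ i, (P i).map ρ ∈ I := fun i => Ideal.subset_span ⟨i, rfl⟩
  set G := Submodule.IsPrincipal.generator I with hG
  have hGI : Ideal.span {G} = I := Ideal.span_singleton_generator I
  have hG1 : ¬ IsUnit G := by
    intro hu
    have h1 : (1 : (RatFunc ℂ)[X]) ∈ I := by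
      rw [← hGI, Ideal.span_singleton_eq_top.2 hu]; trivial
    obtain ⟨A, hA⟩ := Ideal.mem_span_range_iff_exists_fun.1 h1
    obtain ⟨D, hD, a, ha⟩ := exists_clear A
    have e : ∑ i, a i * P i = C D := by
      apply map_eval_injective
      rw [Polynomial.map_sum, map_C]
      simp only [Polynomial.map_mul, ha, mul_assoc]
      rw [← Finset.mul_sum, hA, mul_one]
    obtain ⟨s, hsB, hsD⟩ := exists_good hB hD
    obtain ⟨t, ht, -⟩ := h s hsB
    have := congrArg (fun p : ℂ[X][X] => (p.map (evalRingHom s)).eval t) e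
    simp only [Polynomial.map_sum, Polynomial.map_mul, map_C, eval_C, eval_finsetSum, eval_mul, ht,
      mul_zero, Finset.sum_const_zero] at this
    exact hsD this.symm
  have hG0 : G ≠ 0 := by
    intro h0
    have hP : ∀ i, P i = 0 := by
      intro i
      apply map_eval_injective
      have := hmem i
      rw [← hGI, h0] at this
      simpa using this
    obtain ⟨s, hs⟩ := hB.exists_notMem
    obtain ⟨t, -, ht⟩ := h s hs
    have := (ht 0 (by simp [hP])).trans (ht 1 (by simp [hP])).symm
    exact zero_ne_one this
  obtain ⟨H, hH, hHG⟩ := WfDvdMonoid.exists_irreducible_factor hG1 hG0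
  obtain ⟨D₀, hD₀, h₀, hh₀⟩ := exists_clear (fun _ : Unit => H)
  set p := h₀ ()
  have hp : p.map ρ = C (ρ D₀) * H := hh₀ ()
  have hρ : ∀ {x : ℂ[X]}, x ≠ 0 → ρ x ≠ 0 := fun hx =>
    (map_ne_zero_iff ρ (IsFractionRing.injective _ _)).2 hx
  have hunit : IsUnit (C (ρ D₀) : (RatFunc ℂ)[X]) := isUnit_C.2 (IsUnit.mk0 _ (hρ hD₀))
  have hpirr : Irreducible (p.map ρ) := by
    rw [hp]
    exact (irreducible_isUnit_mul hunit).2 hH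
  have hpdvd : ∀ i, p.map ρ ∣ (P i).map ρ := by
    intro i
    rw [hp]
    refine (hunit.mul_left_dvd).2 (hHG.trans ?_)
    rw [← Ideal.mem_span_singleton, hGI]
    exact hmem i
  choose Q hQ using hpdvd
  obtain ⟨D₁, hD₁, q, hq⟩ := exists_clear Q
  have e₁ : ∀ i, C D₁ * P i = p * q i := by
    intro i
    apply map_eval_injective
    rw [Polynomial.map_mul, Polynomial.map_mul, hq, hQ, map_C]
    ring
  obtain ⟨U, V, hUV⟩ := hpirr.separable
  obtain ⟨D₂, hD₂, u, hu⟩ := exists_clear ![U, V]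
  have e₂ : u 0 * p + u 1 * derivative p = C D₂ := by
    apply map_eval_injective
    have h0 := hu 0
    have h1 := hu 1
    simp only [Matrix.cons_val_zero, Matrix.cons_val_one] at h0 h1
    rw [Polynomial.map_add, Polynomial.map_mul, Polynomial.map_mul, h0, h1, map_C,
      ← derivative_map, mul_assoc, mul_assoc, ← mul_add, hUV, mul_one]
  have hp0 : p ≠ 0 := by
    intro h0
    rw [h0, Polynomial.map_zero] at hpirr
    exact hpirr.ne_zero rfl
  have hlc : p.leadingCoeff ≠ 0 := leadingCoeff_ne_zero.2 hp0
  have hnat : (p.map ρ).natDegree = p.natDegree :=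
    natDegree_map_eq_of_injective (IsFractionRing.injective _ _) p
  have hpos : 0 < p.natDegree := by
    rw [← hnat]; exact hpirr.natDegree_pos
  have hroot : ∀ s t, D₁.eval s ≠ 0 → (p.map (evalRingHom s)).eval t = 0 →
      ∀ i, ((P i).map (evalRingHom s)).eval t = 0 := by
    intro s t hs ht i
    have := congrArg (fun p : ℂ[X][X] => (p.map (evalRingHom s)).eval t) (e₁ i)
    simp only [Polynomial.map_mul, map_C, eval_mul, eval_C, ht, zero_mul, coe_evalRingHom] at this
    exact (mul_eq_zero.1 this).resolve_left hs
  have hdeg : p.natDegree = 1 := by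
    by_contra hne
    obtain ⟨s, hsB, hsD⟩ := exists_good hB (mul_ne_zero (mul_ne_zero hD₁ hD₂) hlc)
    simp only [eval_mul, mul_ne_zero_iff] at hsD
    obtain ⟨⟨hs1, hs2⟩, hs3⟩ := hsD
    have hnd : (p.map (evalRingHom s)).natDegree = p.natDegree :=
      natDegree_map_of_leadingCoeff_ne_zero _ hs3
    have hsep : (p.map (evalRingHom s)).Separable := by
      have := congrArg (Polynomial.map (evalRingHom s)) e₂
      rw [Polynomial.map_add, Polynomial.map_mul, Polynomial.map_mul, map_C,
        ← derivative_map] at this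
      refine ⟨C (D₂.eval s)⁻¹ * (u 0).map (evalRingHom s),
        C (D₂.eval s)⁻¹ * (u 1).map (evalRingHom s), ?_⟩
      rw [mul_assoc, mul_assoc, ← mul_add, this, ← C_mul, coe_evalRingHom, inv_mul_cancel₀ hs2, C_1]
    have hcard : (p.map (evalRingHom s)).roots.toFinset.card = p.natDegree := by
      rw [Multiset.toFinset_card_of_nodup (nodup_roots hsep),
        ← (IsAlgClosed.splits (p.map (evalRingHom s))).natDegree_eq_card_roots, hnd]
    obtain ⟨x, hx, y, hy, hxy⟩ := Finset.one_lt_card.1 (by rw [hcard]; omega)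
    simp only [Multiset.mem_toFinset] at hx hy
    obtain ⟨t, -, ht⟩ := h s hsB
    exact hxy ((ht x (hroot s x hs1 (isRoot_of_mem_roots hx))).trans
      (ht y (hroot s y hs1 (isRoot_of_mem_roots hy))).symm)
  have hpe : p = C (p.coeff 1) * X + C (p.coeff 0) := eq_X_add_C_of_natDegree_le_one hdeg.le
  have hc1 : p.coeff 1 ≠ 0 := by
    rw [leadingCoeff, hdeg] at hlc; exact hlc
  set g := EuclideanDomain.gcd (p.coeff 1) (-p.coeff 0) with hg
  obtain ⟨α, hα⟩ := EuclideanDomain.gcd_dvd_left (p.coeff 1) (-p.coeff 0)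
  obtain ⟨β, hβ⟩ := EuclideanDomain.gcd_dvd_right (p.coeff 1) (-p.coeff 0)
  rw [← hg] at hα hβ
  have hg0 : g ≠ 0 := by
    intro h0
    rw [h0, zero_mul] at hα
    exact hc1 hα
  refine ⟨α, β, ?_, {s | (p.coeff 1 * D₁).eval s = 0}, ?_, ?_⟩
  · obtain ⟨x, y, hxy⟩ : ∃ x y, p.coeff 1 * x + -p.coeff 0 * y = g :=
      ⟨_, _, (EuclideanDomain.gcd_eq_gcd_ab _ _).symm⟩
    refine ⟨x, y, mul_left_cancel₀ hg0 ?_⟩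
    rw [hα, hβ] at hxy
    linear_combination hxy
  · have := (p.coeff 1 * D₁).rootSet_finite ℂ
    refine this.subset fun s hs => ?_
    rw [Polynomial.mem_rootSet]
    exact ⟨mul_ne_zero hc1 hD₁, by simpa using hs⟩
  · intro s hs
    simp only [Set.mem_ofPred_eq, eval_mul, mul_eq_zero, not_or] at hs
    have hαs := congrArg (eval s) hα
    have hβs := congrArg (eval s) hβ
    rw [eval_mul] at hαs hβs
    have hα0 : α.eval s ≠ 0 := by
      intro h0
      rw [h0, mul_zero] at hαs
      exact hs.1 hαs
    refine ⟨hα0, hroot s _ hs.2 ?_⟩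
    rw [hpe]
    simp only [Polynomial.map_add, Polynomial.map_mul, map_C, map_X, coe_evalRingHom, eval_add,
      eval_mul, eval_C, eval_X, hαs]
    rw [eval_neg] at hβs
    field_simp
    linear_combination -hβs

end RationalRoot

end SphCurve

namespace SphCurve

open MvPolynomial

/-! ### Two parametrizations of a curve differ by a linear substitution -/

lemma mk_eq_mk_iff_cross {d : ℕ} {x y : Fin d → ℂ} (hx : x ≠ 0) (hy : y ≠ 0) :
    Projectivization.mk ℂ x hx = Projectivization.mk ℂ y hy ↔ ∀ i j, x i * y j = x j * y i := by
  rw [Projectivization.mk_eq_mk_iff']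
  constructor
  · rintro ⟨c, rfl⟩ i j
    simp only [Pi.smul_apply, smul_eq_mul]; ring
  · intro h
    obtain ⟨j, hj⟩ := Function.ne_iff.1 hy
    refine ⟨x j / y j, funext fun i => ?_⟩
    simp only [Pi.zero_apply, ne_eq] at hj
    simp only [Pi.smul_apply, smul_eq_mul]
    field_simp
    linear_combination -h i j

lemma degree_eq_zero_of_eval_ne_zero {n : ℕ} {F : MvPolynomial (Fin 2) ℂ} (hF : F.IsHomogeneous n)
    (h : ∀ v : Fin 2 → ℂ, v ≠ 0 → eval v F ≠ 0) : n = 0 := by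
  by_contra hn
  obtain ⟨k, rfl⟩ : ∃ k, n = k + 1 := ⟨n - 1, by omega⟩
  obtain ⟨v, hv, hv0⟩ := exists_eval_eq_zero hF
  exact h v hv hv0

/-- Proportional tuples of binary forms without common zeros differ by a constant. -/
lemma eq_C_mul_of_cross {ι : Type*} {p q : ℕ} {F G : ι → MvPolynomial (Fin 2) ℂ}
    (hF : ∀ i, (F i).IsHomogeneous p) (hG : ∀ i, (G i).IsHomogeneous q)
    (hF0 : ∀ v : Fin 2 → ℂ, v ≠ 0 → ∃ i, eval v (F i) ≠ 0)
    (hG0 : ∀ v : Fin 2 → ℂ, v ≠ 0 → ∃ i, eval v (G i) ≠ 0)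
    (h : ∀ i j, F i * G j = F j * G i) : p = q ∧ ∃ c : ℂ, c ≠ 0 ∧ ∀ i, F i = C c * G i := by
  have hne : (![1, 0] : Fin 2 → ℂ) ≠ 0 := eval_ne_zero_ext (by simp)
  obtain ⟨j, hj⟩ := hG0 _ hne
  obtain ⟨i, hi⟩ := hF0 _ hne
  have hGj : G j ≠ 0 := by rintro h0; simp [h0] at hj
  have hFi : F i ≠ 0 := by rintro h0; simp [h0] at hi
  have hFj : F j ≠ 0 := by
    intro h0
    have := h i j
    rw [h0, zero_mul] at this
    exact mul_ne_zero hFi hGj this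
  obtain ⟨k, m, n, g, F', G', hg, hF', hG', hm, hn, e1, e2, hN, -⟩ :=
    exists_gcd (hF j) (hG j) hFj hGj
  have hg0 : g ≠ 0 := by rintro rfl; simp at e1; exact hFj e1
  have hrel : ∀ i, F i * G' = F' * G i := by
    intro i
    have := h i j
    rw [e1, e2] at this
    exact mul_left_cancel₀ hg0 (by linear_combination this)
  -- At a zero of F' the form G' is nonzero, so `hrel` would make it a common zero of all the `F i`.
  have hm0 : m = 0 := by
    refine degree_eq_zero_of_eval_ne_zero hF' fun v hv h0 => ?_
    obtain ⟨i, hi⟩ := hF0 v hv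
    have := congrArg (eval v) (hrel i)
    rw [map_mul, map_mul, h0, zero_mul] at this
    exact mul_ne_zero hi (hN v hv h0) this
  have hn0 : n = 0 := by
    refine degree_eq_zero_of_eval_ne_zero hG' fun v hv h0 => ?_
    obtain ⟨i, hi⟩ := hG0 v hv
    have := congrArg (eval v) (hrel i)
    rw [map_mul, map_mul, h0, mul_zero] at this
    exact mul_ne_zero (fun h1 => hN v hv h1 h0) hi this.symm
  subst hm0 hn0
  obtain ⟨a, rfl⟩ := eq_C_of_isHomogeneous_zero hF'
  obtain ⟨b, rfl⟩ := eq_C_of_isHomogeneous_zero hG'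
  have ha : a ≠ 0 := by rintro rfl; simp at e1; exact hFj e1
  have hb : b ≠ 0 := by rintro rfl; simp at e2; exact hGj e2
  refine ⟨by omega, a / b, div_ne_zero ha hb, fun i => ?_⟩
  have hCb : (C b : MvPolynomial (Fin 2) ℂ) ≠ 0 := by simpa using hb
  refine mul_right_cancel₀ hCb ?_
  rw [hrel i, mul_right_comm, ← C_mul, div_mul_cancel₀ _ hb]

/-- Homogenization in degree `e`. -/
noncomputable def homogenize (e : ℕ) (p : Polynomial ℂ) : MvPolynomial (Fin 2) ℂ :=
  ∑ i ∈ Finset.range (e + 1), C (p.coeff i) * (X 0 ^ i * X 1 ^ (e - i))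

lemma homogenize_isHomogeneous (e : ℕ) (p : Polynomial ℂ) : (homogenize e p).IsHomogeneous e := by
  refine IsHomogeneous.sum _ _ _ fun i hi => IsHomogeneous.C_mul ?_ _
  have h := (isHomogeneous_X_pow (R := ℂ) (0 : Fin 2) i).mul
    (isHomogeneous_X_pow (1 : Fin 2) (e - i))
  rwa [Nat.add_sub_cancel' (by simpa [Nat.lt_succ_iff] using hi)] at h

lemma eval_homogenize {e : ℕ} {p : Polynomial ℂ} (hp : p.natDegree ≤ e) (x : ℂ) :
    eval ![x, 1] (homogenize e p) = p.eval x := by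
  rw [Polynomial.eval_eq_sum_range' (Nat.lt_succ_of_le hp)]
  simp [homogenize]

lemma eval_homogenize_infty {e : ℕ} (p : Polynomial ℂ) :
    eval ![1, 0] (homogenize e p) = p.coeff e := by
  simp only [homogenize, map_sum, map_mul, eval_C, map_pow, eval_X]
  rw [Finset.sum_eq_single e]
  · simp
  · intro i hi hne
    have : i < e + 1 := by simpa using hi
    simp [show e - i ≠ 0 by omega]
  · simp

lemma eq_pt_or_infty (t : CP 1) :
    (∃ x, t = pt x) ∨ t = Projectivization.mk ℂ ![1, 0] (eval_ne_zero_ext (by simp)) := by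
  induction t using Projectivization.ind with
  | h v hv =>
    by_cases h : v 1 = 0
    · right
      rw [mk_eq_mk_iff_lin]
      simp [h]
    · left
      refine ⟨v 0 / v 1, ?_⟩
      unfold pt
      rw [mk_eq_mk_iff_lin]
      simp
      field_simp
      ring

namespace BirationalParam

variable {d : ℕ}

lemma exists_eval_form_ne_zero (φ : BirationalParam d) (v : Fin 2 → ℂ) (hv : v ≠ 0) :
    ∃ i, eval v (φ.form i) ≠ 0 := Function.ne_iff.1 (φ.vec_ne_zero hv)

lemma deg_eq_of_range_eq {φ ψ : BirationalParam d} (h : Set.range φ.map = Set.range ψ.map) :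
    φ.deg = ψ.deg := by
  have h1 := φ.hasDegree
  rw [h] at h1
  exact h1.unique ψ.hasDegree

/-- A parametrization factors through any other parametrization of the same curve. -/
lemma exists_factor {φ ψ : BirationalParam d} (h : Set.range φ.map = Set.range ψ.map) :
    ∃ A : Fin 2 → MvPolynomial (Fin 2) ℂ, (∀ j, (A j).IsHomogeneous 1) ∧
      (∀ v : Fin 2 → ℂ, v ≠ 0 → ∃ j, eval v (A j) ≠ 0) ∧
      ∃ c : ℂ, c ≠ 0 ∧ ∀ i, φ.form i = C c * bind₁ A (ψ.form i) := by
  -- The 2×2 minors expressing φ(s) = ψ(t). For all but finitely many s there is exactly one t;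
  -- excluded are the s over a non-injective parameter or the infinite parameter of ψ.
  set P : Fin (d + 1) × Fin (d + 1) → Polynomial (Polynomial ℂ) := fun ij =>
    Polynomial.C (dehom (φ.form ij.1)) * (dehom (ψ.form ij.2)).map Polynomial.C -
      Polynomial.C (dehom (φ.form ij.2)) * (dehom (ψ.form ij.1)).map Polynomial.C with hP
  have hPe : ∀ ij s t, ((P ij).map (Polynomial.evalRingHom s)).eval t =
      eval ![s, 1] (φ.form ij.1) * eval ![t, 1] (ψ.form ij.2) -
        eval ![s, 1] (φ.form ij.2) * eval ![t, 1] (ψ.form ij.1) := by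
    intro ij s t
    have hid : (Polynomial.evalRingHom s).comp Polynomial.C = RingHom.id ℂ := by ext; simp
    simp only [hP, Polynomial.map_sub, Polynomial.map_mul, Polynomial.map_C, Polynomial.eval_sub,
      Polynomial.eval_mul, Polynomial.eval_C, Polynomial.coe_evalRingHom, eval_dehom,
      Polynomial.map_map, hid, Polynomial.map_id]
  have hPt : ∀ s t, φ.map (pt s) = ψ.map (pt t) ↔
      ∀ ij, ((P ij).map (Polynomial.evalRingHom s)).eval t = 0 := by
    intro s t
    unfold pt
    rw [map_mk, map_mk, mk_eq_mk_iff_cross]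
    simp only [hPe, Prod.forall, sub_eq_zero]
    rfl
  set inf : CP 1 := Projectivization.mk ℂ ![1, 0] (eval_ne_zero_ext (by simp))
  have hBfin : (pt ⁻¹' (φ.map ⁻¹' (ψ.map '' (ψ.nonInj ∪ {inf})))).Finite :=
    (φ.preimage_finite ((ψ.nonInj_finite.union (Set.finite_singleton _)).image _)).preimage
      pt_injective.injOn
  obtain ⟨α, β, hcop, B', hB', hαβ⟩ := exists_rational_root P hBfin (by
    intro s hs
    obtain ⟨u, hu⟩ : φ.map (pt s) ∈ Set.range ψ.map := h ▸ ⟨pt s, rfl⟩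
    have hu1 : u ∉ ψ.nonInj ∪ {inf} := fun hu1 => hs ⟨u, hu1, hu⟩
    rcases eq_pt_or_infty u with ⟨t, rfl⟩ | rfl
    · refine ⟨t, (hPt s t).1 hu.symm, fun t' ht' => ?_⟩
      have := (hPt s t').2 ht'
      exact (pt_injective (ψ.eq_of_map_eq (fun h => hu1 (Or.inl h)) (hu.trans this))).symm
    · exact absurd (Or.inr rfl) hu1)
  -- The maximum of the two degrees is the one for which the homogenized pair has no common zero at
  -- infinity either. Comparing the degrees of the curve then gives e = 1.
  set e := max α.natDegree β.natDegree with he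
  have hαe : α.natDegree ≤ e := le_max_left _ _
  have hβe : β.natDegree ≤ e := le_max_right _ _
  set A : Fin 2 → MvPolynomial (Fin 2) ℂ := ![homogenize e β, homogenize e α] with hA
  have hAh : ∀ j, (A j).IsHomogeneous e := by
    intro j
    fin_cases j
    · exact homogenize_isHomogeneous e β
    · exact homogenize_isHomogeneous e α
  have hA0 : ∀ v : Fin 2 → ℂ, v ≠ 0 → ∃ j, eval v (A j) ≠ 0 := by
    intro v hv
    by_contra! hall
    have h0 : eval v (homogenize e β) = 0 := hall 0
    have h1 : eval v (homogenize e α) = 0 := hall 1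
    by_cases hv1 : v 1 = 0
    · have hv0 : v 0 ≠ 0 := fun hv0 => hv (by rw [vec_eq_smul' hv1, hv0, zero_smul])
      rw [vec_eq_smul' hv1, eval_smul (homogenize_isHomogeneous _ _), eval_homogenize_infty,
        mul_eq_zero] at h0 h1
      replace h0 := h0.resolve_left (pow_ne_zero _ hv0)
      replace h1 := h1.resolve_left (pow_ne_zero _ hv0)
      have key : ∀ p q : Polynomial ℂ, p.natDegree = e → q.natDegree ≤ e → p.coeff e = 0 →
          q.coeff e = 0 → p = 0 ∧ q = 0 := by
        intro p q hp hq hp0 hq0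
        have hpz : p = 0 := by rw [← Polynomial.leadingCoeff_eq_zero, Polynomial.leadingCoeff, hp, hp0]
        have he0 : e = 0 := by rw [← hp, hpz, Polynomial.natDegree_zero]
        refine ⟨hpz, ?_⟩
        rw [he0] at hq hq0
        rw [Polynomial.eq_C_of_natDegree_le_zero hq, hq0, Polynomial.C_0]
      have hzero : α = 0 ∧ β = 0 := by
        rcases max_choice α.natDegree β.natDegree with hm | hm
        · exact key α β (by rw [he, hm]) hβe h1 h0
        · exact (key β α (by rw [he, hm]) hαe h0 h1).symm
      obtain ⟨x, y, hxy⟩ := hcop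
      rw [hzero.1, hzero.2] at hxy
      simp at hxy
    · rw [vec_eq_smul hv1, eval_smul (homogenize_isHomogeneous _ _), mul_eq_zero] at h0 h1
      replace h0 := h0.resolve_left (pow_ne_zero _ hv1)
      replace h1 := h1.resolve_left (pow_ne_zero _ hv1)
      rw [eval_homogenize hβe] at h0
      rw [eval_homogenize hαe] at h1
      obtain ⟨x, y, hxy⟩ := hcop
      have := congrArg (Polynomial.eval (v 0 / v 1)) hxy
      simp [h0, h1] at this
  have hGh : ∀ i, (bind₁ A (ψ.form i)).IsHomogeneous (e * ψ.deg) := fun i =>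
    (ψ.homog i).aeval _ hAh
  have hG0 : ∀ v : Fin 2 → ℂ, v ≠ 0 → ∃ i, eval v (bind₁ A (ψ.form i)) ≠ 0 := by
    intro v hv
    obtain ⟨j, hj⟩ := hA0 v hv
    obtain ⟨i, hi⟩ := ψ.exists_eval_form_ne_zero (fun j => eval v (A j))
      (fun h0 => hj (congrFun h0 j))
    exact ⟨i, by rwa [eval_bind₁_eq]⟩
  have hcross : ∀ i j, φ.form i * bind₁ A (ψ.form j) = φ.form j * bind₁ A (ψ.form i) := by
    intro i j
    rw [← sub_eq_zero]
    have hh := ((φ.homog i).mul (hGh j)).sub ((φ.homog j).mul (hGh i))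
    refine eq_zero_of_infinite_zeros hh ((hB'.infinite_compl.image pt_injective.injOn).mono ?_)
    rintro _ ⟨s, hs, rfl⟩
    simp only [Set.mem_ofPred_eq, pt]
    rw [eval_rep_mk hh]
    obtain ⟨hs1, hs2⟩ := hαβ s hs
    have hAs : (fun j => eval ![s, 1] (A j)) = α.eval s • ![β.eval s / α.eval s, 1] := by
      ext j
      fin_cases j
      · simp [hA, eval_homogenize hβe]; field_simp
      · simp [hA, eval_homogenize hαe]
    have := hs2 (i, j)
    rw [hPe] at this
    simp only [map_sub, map_mul, eval_bind₁_eq, hAs, eval_smul (ψ.homog _)]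
    linear_combination (Polynomial.eval s α) ^ ψ.deg * this
  obtain ⟨hdeg, c, hc, hcF⟩ := eq_C_mul_of_cross φ.homog hGh φ.exists_eval_form_ne_zero hG0 hcross
  have he1 : e = 1 := by
    rw [deg_eq_of_range_eq h] at hdeg
    have := ψ.deg_pos
    nlinarith
  exact ⟨A, fun j => he1 ▸ hAh j, hA0, c, hc, hcF⟩

end BirationalParam

/-! ### Reparametrization and invariance of the spherical multiplicity -/

/-- The linear substitution given by a linear automorphism of `ℂ²`. -/
noncomputable def linSub (Λ : (Fin 2 → ℂ) ≃ₗ[ℂ] (Fin 2 → ℂ)) (j : Fin 2) : MvPolynomial (Fin 2) ℂ :=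
  ∑ k, C (Λ (Pi.single k 1) j) * X k

lemma eval_linSub (Λ : (Fin 2 → ℂ) ≃ₗ[ℂ] (Fin 2 → ℂ)) (v : Fin 2 → ℂ) :
    (fun j => eval v (linSub Λ j)) = Λ v := by
  have hv : v = ∑ k, v k • (Pi.single k 1 : Fin 2 → ℂ) := by
    ext j; fin_cases j <;> simp [Fin.sum_univ_two]
  conv_rhs => rw [hv, map_sum]
  ext j
  simp [linSub, mul_comm]

lemma linSub_isHomogeneous (Λ : (Fin 2 → ℂ) ≃ₗ[ℂ] (Fin 2 → ℂ)) (j : Fin 2) :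
    (linSub Λ j).IsHomogeneous 1 :=
  IsHomogeneous.sum _ _ _ fun _ _ => isHomogeneous_C_mul_X _ _

lemma eval_bind₁_linSub (Λ : (Fin 2 → ℂ) ≃ₗ[ℂ] (Fin 2 → ℂ)) (F : MvPolynomial (Fin 2) ℂ)
    (v : Fin 2 → ℂ) : eval v (bind₁ (linSub Λ) F) = eval (Λ v) F := by
  rw [eval_bind₁_eq, eval_linSub]

lemma bind₁_linSub_symm (Λ : (Fin 2 → ℂ) ≃ₗ[ℂ] (Fin 2 → ℂ)) (F : MvPolynomial (Fin 2) ℂ) :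
    bind₁ (linSub Λ) (bind₁ (linSub Λ.symm) F) = F := by
  refine MvPolynomial.funext fun v => ?_
  rw [eval_bind₁_linSub, eval_bind₁_linSub, Λ.symm_apply_apply]

/-- A linear substitution as an automorphism of the ring of binary forms. -/
noncomputable def subEquiv (Λ : (Fin 2 → ℂ) ≃ₗ[ℂ] (Fin 2 → ℂ)) :
    MvPolynomial (Fin 2) ℂ ≃* MvPolynomial (Fin 2) ℂ where
  toFun := bind₁ (linSub Λ)
  invFun := bind₁ (linSub Λ.symm)
  left_inv F := by simpa using bind₁_linSub_symm Λ.symm F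
  right_inv F := bind₁_linSub_symm Λ F
  map_mul' := map_mul _

lemma subEquiv_apply (Λ : (Fin 2 → ℂ) ≃ₗ[ℂ] (Fin 2 → ℂ)) (F : MvPolynomial (Fin 2) ℂ) :
    subEquiv Λ F = bind₁ (linSub Λ) F := rfl

lemma ordAt_def (F : MvPolynomial (Fin 2) ℂ) (t : CP 1) :
    ordAt F t = emultiplicity (lin t.rep) F := rfl

/-- The action of a linear automorphism on the projective line. -/
noncomputable def act (Λ : (Fin 2 → ℂ) ≃ₗ[ℂ] (Fin 2 → ℂ)) : CP 1 ≃ CP 1 where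
  toFun := Projectivization.map Λ.toLinearMap Λ.injective
  invFun := Projectivization.map Λ.symm.toLinearMap Λ.symm.injective
  left_inv t := by
    induction t using Projectivization.ind with
    | h v hv => simp [Projectivization.map_mk]
  right_inv t := by
    induction t using Projectivization.ind with
    | h v hv => simp [Projectivization.map_mk]

lemma act_eq (Λ : (Fin 2 → ℂ) ≃ₗ[ℂ] (Fin 2 → ℂ)) (t : CP 1) :
    act Λ t = Projectivization.mk ℂ (Λ t.rep) ((map_ne_zero_iff Λ Λ.injective).2 t.rep_nonzero) := by
  conv_lhs => rw [← t.mk_rep]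
  rfl

lemma ordAt_sub (Λ : (Fin 2 → ℂ) ≃ₗ[ℂ] (Fin 2 → ℂ)) (F : MvPolynomial (Fin 2) ℂ) (t : CP 1) :
    ordAt (bind₁ (linSub Λ) F) t = ordAt F (act Λ t) := by
  have h1 : (bind₁ (linSub Λ) (lin (act Λ t).rep)).IsHomogeneous (1 * 1) :=
    (lin_isHomogeneous _).aeval _ (linSub_isHomogeneous Λ)
  have h0 : bind₁ (linSub Λ) (lin (act Λ t).rep) ≠ 0 := by
    intro h0
    refine lin_ne_zero (act Λ t).rep_nonzero ((subEquiv Λ).injective ?_)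
    rw [subEquiv_apply, subEquiv_apply, h0, map_zero]
  have he : eval t.rep (bind₁ (linSub Λ) (lin (act Λ t).rep)) = 0 := by
    rw [eval_bind₁_linSub, ← mk_eq_mk_iff_lin (act Λ t).rep_nonzero
      ((map_ne_zero_iff Λ Λ.injective).2 t.rep_nonzero), Projectivization.mk_rep, act_eq]
  obtain ⟨G, hG, hGe⟩ := exists_eq_lin_mul (n := 0) t.rep_nonzero h1 he
  obtain ⟨c, rfl⟩ := eq_C_of_isHomogeneous_zero hG
  have hc : c ≠ 0 := by rintro rfl; simp at hGe; exact h0 hGe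
  have hass : Associated (lin t.rep) (subEquiv Λ (lin (act Λ t).rep)) := by
    rw [subEquiv_apply, hGe]
    exact ⟨(isUnit_C_iff' hc).unit, rfl⟩
  rw [ordAt_def, ordAt_def, ← emultiplicity_eq_of_associated_left hass, ← subEquiv_apply,
    emultiplicity_map_eq]

lemma exists_linearEquiv {A : Fin 2 → MvPolynomial (Fin 2) ℂ} (hA : ∀ j, (A j).IsHomogeneous 1)
    (hA0 : ∀ v : Fin 2 → ℂ, v ≠ 0 → ∃ j, eval v (A j) ≠ 0) :
    ∃ Λ : (Fin 2 → ℂ) ≃ₗ[ℂ] (Fin 2 → ℂ), ∀ v j, eval v (A j) = Λ v j := by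
  have h1 : ∀ j, ∃ c : Fin 2 → ℂ, ∀ v, eval v (A j) = c 0 * v 1 + c 1 * v 0 := by
    intro j
    obtain ⟨c, hc⟩ := (Submodule.mem_span_range_iff_exists_fun ℂ).1 (form_mem_span (hA j))
    refine ⟨c, fun v => ?_⟩
    rw [← hc]
    simp [Fin.sum_univ_two, smul_eq_C_mul]
  choose c hc using h1
  let T : (Fin 2 → ℂ) →ₗ[ℂ] (Fin 2 → ℂ) :=
    { toFun := fun v j => eval v (A j)
      map_add' := fun v w => by ext j; simp [hc]; ring
      map_smul' := fun a v => by ext j; simp [hc]; ring }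
  have hT : Function.Injective T := by
    rw [injective_iff_map_eq_zero]
    intro v hv
    by_contra hne
    obtain ⟨j, hj⟩ := hA0 v hne
    exact hj (congrFun hv j)
  exact ⟨LinearEquiv.ofInjectiveEndo T hT, fun v j => rfl⟩

namespace BirationalParam

variable {d : ℕ}

/-- Reparametrization by a linear automorphism. -/
noncomputable def comp (φ : BirationalParam d) (Λ : (Fin 2 → ℂ) ≃ₗ[ℂ] (Fin 2 → ℂ)) :
    BirationalParam d where
  deg := φ.deg
  form i := bind₁ (linSub Λ) (φ.form i)
  homog i := by
    have h := (φ.homog i).aeval _ (linSub_isHomogeneous Λ)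
    rwa [one_mul] at h
  no_common_zero v hv := by
    have e : (fun i => eval v (bind₁ (linSub Λ) (φ.form i))) = φ.vec (Λ v) :=
      funext fun i => by rw [eval_bind₁_linSub, vec_apply]
    rw [e]
    exact φ.vec_ne_zero ((map_ne_zero_iff Λ Λ.injective).2 hv)
  finite_noninj := by
    refine (φ.nonInj_finite.preimage (act Λ).injective.injOn).subset ?_
    rintro t ⟨u, hut, h⟩
    refine ⟨act Λ u, fun h' => hut ((act Λ).injective h'), ?_⟩
    have e : ∀ v, (fun i => eval v (bind₁ (linSub Λ) (φ.form i))) = φ.vec (Λ v) :=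
      fun v => funext fun i => by rw [eval_bind₁_linSub, vec_apply]
    rw [act_eq, act_eq, map_mk, map_mk]
    simp only [e] at h
    exact h

lemma comp_vec (φ : BirationalParam d) (Λ : (Fin 2 → ℂ) ≃ₗ[ℂ] (Fin 2 → ℂ)) (v : Fin 2 → ℂ) :
    (φ.comp Λ).vec v = φ.vec (Λ v) := by
  ext i
  change eval v (bind₁ (linSub Λ) (φ.form i)) = _
  rw [eval_bind₁_linSub, vec_apply]

lemma comp_map (φ : BirationalParam d) (Λ : (Fin 2 → ℂ) ≃ₗ[ℂ] (Fin 2 → ℂ)) (t : CP 1) :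
    (φ.comp Λ).map t = φ.map (act Λ t) := by
  rw [act_eq, map_mk, map_eq]
  simp only [comp_vec]

lemma comp_range (φ : BirationalParam d) (Λ : (Fin 2 → ℂ) ≃ₗ[ℂ] (Fin 2 → ℂ)) :
    Set.range (φ.comp Λ).map = Set.range φ.map := by
  rw [show (φ.comp Λ).map = φ.map ∘ act Λ from funext (φ.comp_map Λ), (act Λ).surjective.range_comp]

lemma comp_multSigma (φ : BirationalParam d) (Λ : (Fin 2 → ℂ) ≃ₗ[ℂ] (Fin 2 → ℂ)) (t : CP 1) :
    (φ.comp Λ).multSigma t = φ.multSigma (act Λ t) := by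
  unfold multSigma
  rw [← ordAt_sub, ← ordAt_sub, map_sum]
  simp only [map_pow]
  rfl

/-- Any two parametrizations of a curve differ by a linear substitution. -/
lemma exists_comp_eq {φ ψ : BirationalParam d} (h : Set.range φ.map = Set.range ψ.map) :
    ∃ Λ, φ = ψ.comp Λ := by
  obtain ⟨A, hA, hA0, c, hc, hφ⟩ := exists_factor h
  -- A root of c of order `ψ.deg` moves the scalar factor into the substitution.
  obtain ⟨γ, hγ⟩ := IsAlgClosed.exists_pow_nat_eq c ψ.deg_pos
  have hγ0 : γ ≠ 0 := by
    rintro rfl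
    rw [zero_pow ψ.deg_pos.ne'] at hγ
    exact hc hγ.symm
  have hdeg := deg_eq_of_range_eq h
  obtain ⟨Λ, hΛ⟩ := exists_linearEquiv hA hA0
  refine ⟨Λ.trans (LinearEquiv.smulOfNeZero ℂ _ γ hγ0), ?_⟩
  have hform : φ.form = (ψ.comp (Λ.trans (LinearEquiv.smulOfNeZero ℂ _ γ hγ0))).form := by
    funext i
    refine MvPolynomial.funext fun v => ?_
    change _ = eval v (bind₁ _ (ψ.form i))
    rw [eval_bind₁_linSub, hφ, map_mul, eval_C, eval_bind₁_eq]
    have : (fun j => eval v (A j)) = Λ v := funext (hΛ v)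
    rw [this, ← hγ, ← eval_smul (ψ.homog i)]
    rfl
  cases φ
  simp only [comp] at hform hdeg ⊢
  subst hform hdeg
  rfl

lemma finsum_multSigma_eq {φ ψ : BirationalParam d} (h : Set.range φ.map = Set.range ψ.map) :
    ∑ᶠ t, φ.multSigma t = ∑ᶠ t, ψ.multSigma t := by
  obtain ⟨Λ, rfl⟩ := exists_comp_eq h
  simp only [comp_multSigma]
  exact finsum_comp_equiv (act Λ)

/-- The definition asks for some parametrization; by invariance of the multiplicity sum any one can
be used. -/
lemma isSpherical_iff (φ : BirationalParam d) (ℓ : ℕ) :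
    IsSpherical ℓ (Set.range φ.map) ↔ IsReal (Set.range φ.map) ∧
      ∑ᶠ t, φ.multSigma t = ((2 * ℓ : ℕ) : ℕ∞) := by
  refine and_congr_right fun _ => ⟨?_, fun h => ⟨φ, rfl, h⟩⟩
  rintro ⟨ψ, hψ, h⟩
  rw [← h]
  exact finsum_multSigma_eq (Eq.symm hψ)

end BirationalParam

/-! ### Complex conjugation and real parametrizations -/

/-- Complex conjugation on `ℂ^n`. -/
noncomputable def conjLin (n : ℕ) : (Fin n → ℂ) →ₛₗ[starRingEnd ℂ] (Fin n → ℂ) where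
  toFun v := star v
  map_add' v w := star_add v w
  map_smul' c v := by ext i; simp

lemma conjLin_injective (n : ℕ) : Function.Injective (conjLin n) := star_injective

/-- Complex conjugation on projective space. -/
noncomputable def conjPt {d : ℕ} : CP d → CP d :=
  Projectivization.map (conjLin (d + 1)) (conjLin_injective _)

lemma conjPt_mk {d : ℕ} {v : Fin (d + 1) → ℂ} (hv : v ≠ 0) :
    conjPt (Projectivization.mk ℂ v hv) = Projectivization.mk ℂ (star v) (star_ne_zero.2 hv) := rfl

lemma conjPt_conjPt {d : ℕ} (p : CP d) : conjPt (conjPt p) = p := by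
  induction p using Projectivization.ind with
  | h v hv => simp [conjPt_mk]

lemma conjPt_injective {d : ℕ} : Function.Injective (conjPt (d := d)) :=
  Function.LeftInverse.injective conjPt_conjPt

lemma isRealPoint_mk {d : ℕ} {v : Fin (d + 1) → ℂ} (hv : v ≠ 0) (h : star v = v) :
    IsRealPoint (Projectivization.mk ℂ v hv) := by
  have hre : (fun i => ((v i).re : ℂ)) = v := funext fun i => Complex.conj_eq_iff_re.1 (congrFun h i)
  refine ⟨fun i => (v i).re, ?_, ?_⟩
  · rw [hre, Projectivization.submodule_mk]
    exact Submodule.mem_span_singleton_self v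
  · intro h0
    refine hv ?_
    rw [← hre]
    ext i
    simpa using congrFun h0 i

/-- A point is real if and only if it is fixed by conjugation, and it then has a real
representative. -/
lemma exists_real_rep {d : ℕ} {p : CP d} (h : conjPt p = p) :
    ∃ (v : Fin (d + 1) → ℂ) (hv : v ≠ 0), star v = v ∧ p = Projectivization.mk ℂ v hv := by
  induction p using Projectivization.ind with
  | h w hw =>
    rw [conjPt_mk, Projectivization.mk_eq_mk_iff'] at h
    obtain ⟨μ, hμ⟩ := h
    obtain ⟨i, hi⟩ := Function.ne_iff.1 hw
    simp only [Pi.zero_apply, ne_eq] at hi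
    have hc : ∀ j, star (w j) = μ * w j := fun j => (congrFun hμ j).symm
    have hμ0 : μ ≠ 0 := by
      rintro rfl
      have := hc i
      rw [zero_mul, star_eq_zero] at this
      exact hi this
    refine ⟨(w i)⁻¹ • w, smul_ne_zero (inv_ne_zero hi) hw, ?_, ?_⟩
    · ext j
      simp only [Pi.star_apply, Pi.smul_apply, smul_eq_mul, star_mul', star_inv₀, hc]
      field_simp
    · rw [Projectivization.mk_eq_mk_iff']
      exact ⟨w i, by rw [smul_smul, mul_inv_cancel₀ hi, one_smul]⟩

lemma isRealPoint_iff {d : ℕ} {p : CP d} : IsRealPoint p ↔ conjPt p = p := by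
  constructor
  · rintro ⟨v, hv, hv0⟩
    have hne : (fun i => (v i : ℂ)) ≠ 0 := by
      intro h0
      exact hv0 (funext fun i => by simpa using congrFun h0 i)
    rw [Projectivization.submodule_eq, Submodule.mem_span_singleton] at hv
    obtain ⟨c, hc⟩ := hv
    have hp : p = Projectivization.mk ℂ (fun i => (v i : ℂ)) hne := by
      rw [← p.mk_rep, eq_comm, Projectivization.mk_eq_mk_iff']
      exact ⟨c, hc⟩
    rw [hp, conjPt_mk]
    congr 1
    ext i
    simp
  · intro h
    obtain ⟨v, hv, hs, rfl⟩ := exists_real_rep h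
    exact isRealPoint_mk hv hs

/-- Conjugation of the coefficients. -/
noncomputable abbrev conjP {σ : Type*} (F : MvPolynomial σ ℂ) : MvPolynomial σ ℂ :=
  MvPolynomial.map (starRingEnd ℂ) F

lemma eval_conjP {σ : Type*} (F : MvPolynomial σ ℂ) (v : σ → ℂ) :
    eval v (conjP F) = star (eval (star v) F) := by
  induction F using MvPolynomial.induction_on with
  | C a => simp
  | add p q hp hq => simp only [conjP, map_add, star_add] at *; rw [hp, hq]
  | mul_X p i hp => simp only [conjP, map_mul, map_X, eval_X, star_mul', Pi.star_apply, star_star] at *; rw [hp]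

namespace BirationalParam

variable {d : ℕ}

/-- The complex conjugate parametrization. -/
noncomputable def conj (φ : BirationalParam d) : BirationalParam d where
  deg := φ.deg
  form i := conjP (φ.form i)
  homog i := (φ.homog i).map _
  no_common_zero v hv := by
    have h := φ.no_common_zero _ (star_ne_zero.2 hv)
    simp only [eval_conjP]
    exact star_ne_zero.2 h
  finite_noninj := by
    refine (φ.nonInj_finite.preimage (conjPt_injective (d := 1)).injOn).subset ?_
    have key : ∀ (t : CP 1) h, Projectivization.mk ℂ (fun i => eval t.rep (conjP (φ.form i))) h =
        conjPt (φ.map (conjPt t)) := by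
      intro t h
      conv_rhs => rw [← t.mk_rep, conjPt_mk, map_mk, conjPt_mk]
      congr 1
      ext i
      rw [eval_conjP, Pi.star_apply, vec_apply]
    rintro t ⟨u, hut, h⟩
    rw [key, key] at h
    exact ⟨conjPt u, fun h' => hut (conjPt_injective h'), conjPt_injective h⟩

lemma conj_vec (φ : BirationalParam d) (v : Fin 2 → ℂ) : φ.conj.vec v = star (φ.vec (star v)) := by
  ext i
  change eval v (conjP (φ.form i)) = _
  rw [eval_conjP, Pi.star_apply, vec_apply]

lemma conj_map (φ : BirationalParam d) (t : CP 1) : φ.conj.map t = conjPt (φ.map (conjPt t)) := by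
  induction t using Projectivization.ind with
  | h v hv =>
    simp only [conjPt_mk, map_mk, conj_vec]

/-- The curve given by a parametrization with infinitely many real points is invariant under
conjugation. -/
lemma range_conj {φ : BirationalParam d} (h : IsReal (Set.range φ.map)) :
    Set.range φ.conj.map = Set.range φ.map := by
  have hinf : {t | IsRealPoint (φ.map t)}.Infinite := by
    intro hf
    refine h ((hf.image φ.map).subset ?_)
    rintro _ ⟨⟨t, rfl⟩, ht⟩
    exact ⟨t, ht, rfl⟩
  have hsub : Set.range φ.conj.map ⊆ Set.range φ.map := by
    rintro _ ⟨t, rfl⟩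
    rw [← zariskiClosure_range φ]
    intro n F hF
    -- At the conjugate of a parameter of a real point, `φ.conj` takes the same real point as value.
    -- This happens infinitely often.
    have h0 : bind₁ φ.conj.form F = 0 := by
      refine eq_zero_of_infinite_zeros (φ.conj.bind₁_isHomogeneous hF.1)
        ((hinf.image conjPt_injective.injOn).mono ?_)
      rintro _ ⟨s, hs, rfl⟩
      rw [Set.mem_ofPred_eq, ← eval_rep_map φ.conj hF.1, conj_map, conjPt_conjPt,
        isRealPoint_iff.1 hs]
      exact hF.2 _ ⟨s, rfl⟩
    rw [eval_rep_map φ.conj hF.1, h0, map_zero]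
  refine hsub.antisymm ?_
  rintro _ ⟨t, rfl⟩
  obtain ⟨s, hs⟩ := hsub ⟨conjPt t, rfl⟩
  refine ⟨conjPt s, ?_⟩
  rw [conj_map, conjPt_conjPt, hs, conj_map, conjPt_conjPt, conjPt_conjPt]

/-- A parametrization is real if it is equivariant under conjugation. -/
def IsRealParam (φ : BirationalParam d) : Prop := ∀ v, star (φ.vec v) = φ.vec (star v)

/-- A real rational curve has a real parametrization. -/
lemma exists_isRealParam {φ : BirationalParam d} (h : IsReal (Set.range φ.map)) :
    ∃ Λ, (φ.comp Λ).IsRealParam := by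
  obtain ⟨Λ, hΛ⟩ := exists_comp_eq (range_conj h)
  have hv : ∀ v, star (φ.vec v) = φ.vec (Λ (star v)) := by
    intro v
    rw [← comp_vec, ← hΛ, conj_vec, star_star]
  -- The antilinear map w ↦ Λ (star w) corresponds to conjugation on the curve. It fixes t
  -- projectively up to a scalar μ, which has modulus 1; rescaling by a square root of μ yields a
  -- fixed vector.
  have hfix : ∀ t : CP 1, IsRealPoint (φ.map t) → t ∉ φ.nonInj →
      ∃ (w : Fin 2 → ℂ) (hw : w ≠ 0), t = Projectivization.mk ℂ w hw ∧ Λ (star w) = w := by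
    intro t ht hn
    have hne : Λ (star t.rep) ≠ 0 :=
      (map_ne_zero_iff Λ Λ.injective).2 (star_ne_zero.2 t.rep_nonzero)
    have h1 : φ.map t = φ.map (Projectivization.mk ℂ (Λ (star t.rep)) hne) := by
      rw [map_mk]
      simp only [← hv]
      rw [← conjPt_mk (φ.vec_ne_zero t.rep_nonzero), ← map_eq, isRealPoint_iff.1 ht]
    have h2 := φ.eq_of_map_eq hn h1
    obtain ⟨μ, hμ⟩ : ∃ μ : ℂ, μ • t.rep = Λ (star t.rep) := by
      rw [eq_comm] at h2
      conv_rhs at h2 => rw [← t.mk_rep]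
      rwa [Projectivization.mk_eq_mk_iff'] at h2
    obtain ⟨i, hi⟩ := φ.exists_eval_form_ne_zero t.rep t.rep_nonzero
    have hnorm : ‖μ‖ = 1 := by
      have h3 := congrFun (hv t.rep) i
      rw [← hμ, vec_smul] at h3
      have h4 := congrArg norm h3
      simp only [Pi.star_apply, norm_star, Pi.smul_apply, smul_eq_mul, norm_mul, norm_pow] at h4
      have h5 : ‖μ‖ ^ φ.deg = 1 := by
        have : ‖φ.vec t.rep i‖ ≠ 0 := norm_ne_zero_iff.2 hi
        exact mul_right_cancel₀ this (by rw [one_mul]; exact h4.symm)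
      exact (pow_eq_one_iff_of_nonneg (norm_nonneg _) φ.deg_pos.ne').1 h5
    obtain ⟨ν, hν⟩ := IsAlgClosed.exists_pow_nat_eq μ (n := 2) (by norm_num)
    have hνn : ‖ν‖ = 1 := by
      rw [← hν, norm_pow] at hnorm
      exact (pow_eq_one_iff_of_nonneg (norm_nonneg _) (by norm_num)).1 hnorm
    have hν0 : ν ≠ 0 := by rintro rfl; simp at hνn
    refine ⟨ν • t.rep, smul_ne_zero hν0 t.rep_nonzero, ?_, ?_⟩
    · conv_lhs => rw [← t.mk_rep]
      rw [eq_comm, Projectivization.mk_eq_mk_iff']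
      exact ⟨ν, rfl⟩
    · rw [star_smul, map_smul, ← hμ, smul_smul, ← hν]
      congr 1
      have : star ν * ν = 1 := by
        have := Complex.conj_mul' ν
        rw [hνn] at this
        simpa using this
      linear_combination ν * this
  have hinf : ({t | IsRealPoint (φ.map t)} \ φ.nonInj).Infinite := by
    refine Set.Infinite.sdiff ?_ φ.nonInj_finite
    intro hf
    refine h ((hf.image φ.map).subset ?_)
    rintro _ ⟨⟨t, rfl⟩, ht⟩
    exact ⟨t, ht, rfl⟩
  obtain ⟨t₁, h₁⟩ := hinf.nonempty
  obtain ⟨t₂, h₂, h12⟩ := (hinf.sdiff (Set.finite_singleton t₁)).nonempty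
  obtain ⟨w₁, hw₁, e₁, f₁⟩ := hfix t₁ h₁.1 h₁.2
  obtain ⟨w₂, hw₂, e₂, f₂⟩ := hfix t₂ h₂.1 h₂.2
  -- Two independent fixed vectors form a basis in which the antilinear map is coordinatewise
  -- conjugation.
  let T : (Fin 2 → ℂ) →ₗ[ℂ] (Fin 2 → ℂ) :=
    { toFun := fun x => x 0 • w₁ + x 1 • w₂
      map_add' := fun v w => by ext j; simp; ring
      map_smul' := fun a v => by ext j; simp; ring }
  have hT : Function.Injective T := by
    rw [injective_iff_map_eq_zero]
    intro x hx
    have hx' : x 0 • w₁ + x 1 • w₂ = 0 := hx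
    have hx1 : x 1 = 0 := by
      by_contra hne
      refine h12 ?_
      rw [Set.mem_singleton_iff, e₁, e₂, Projectivization.mk_eq_mk_iff']
      refine ⟨-(x 0 / x 1), ?_⟩
      ext j
      have := congrFun hx' j
      simp only [Pi.add_apply, Pi.smul_apply, smul_eq_mul, Pi.zero_apply] at this ⊢
      field_simp
      linear_combination -this
    rw [hx1, zero_smul, add_zero, smul_eq_zero] at hx'
    ext j; fin_cases j
    · exact hx'.resolve_right hw₁
    · exact hx1
  refine ⟨LinearEquiv.ofInjectiveEndo T hT, fun v => ?_⟩
  rw [comp_vec, comp_vec, hv]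
  congr 1
  change Λ (star (v 0 • w₁ + v 1 • w₂)) = star (v 0) • w₁ + star (v 1) • w₂
  rw [star_add, star_smul, star_smul, map_add, map_smul, map_smul, f₁, f₂]

end BirationalParam

/-! ### Cones over rational normal curves -/

lemma exists_lin_ne_zero {v : Fin 2 → ℂ} (hv : v ≠ 0) :
    ∃ u : Fin 2 → ℂ, u ≠ 0 ∧ eval v (lin u) ≠ 0 := by
  by_cases h0 : v 0 = 0
  · refine ⟨![1, 0], eval_ne_zero_ext (by simp), ?_⟩
    have h1 : v 1 ≠ 0 := fun h1 => hv (by ext i; fin_cases i <;> simp [h0, h1])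
    simpa using h1
  · exact ⟨![0, 1], eval_ne_zero_ext (by simp), by simpa using h0⟩

lemma lin_pow_isHomogeneous (v : Fin 2 → ℂ) (e : ℕ) : (lin v ^ e).IsHomogeneous e := by
  have := (lin_isHomogeneous v).pow e
  rwa [one_mul] at this

/-- A basis of the binary forms of degree `e`. -/
structure IsFormBasis {d : ℕ} (e : ℕ) (z : Fin d → MvPolynomial (Fin 2) ℂ) : Prop where
  pos : 1 ≤ e
  card : d = e + 1
  homog : ∀ i, (z i).IsHomogeneous e
  linInd : LinearIndependent ℂ z

namespace IsFormBasis

variable {d e : ℕ} {z : Fin d → MvPolynomial (Fin 2) ℂ}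

lemma exists_sum (hz : IsFormBasis e z) {F : MvPolynomial (Fin 2) ℂ} (hF : F.IsHomogeneous e) :
    ∃ c : Fin d → ℂ, F = ∑ i, C (c i) * z i :=
  exists_sum_eq_of_linearIndependent hz.card hz.homog hz.linInd hF

lemma exists_eval_ne_zero (hz : IsFormBasis e z) {v : Fin 2 → ℂ} (hv : v ≠ 0) :
    ∃ i, eval v (z i) ≠ 0 := by
  obtain ⟨u, -, hu⟩ := exists_lin_ne_zero hv
  obtain ⟨c, hc⟩ := hz.exists_sum (lin_pow_isHomogeneous u e)
  by_contra! h
  have := congrArg (eval v) hc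
  rw [map_pow] at this
  simp only [map_sum, map_mul, h, mul_zero, Finset.sum_const_zero] at this
  exact pow_ne_zero _ hu this

/-- Injectivity of the rational normal curve: `lin t ^ e` is a combination of the basis and vanishes
at t, hence at s. -/
lemma eval_lin_eq_zero (hz : IsFormBasis e z) {s t : Fin 2 → ℂ} {l : ℂ}
    (h : ∀ i, eval s (z i) = l * eval t (z i)) : eval s (lin t) = 0 := by
  obtain ⟨c, hc⟩ := hz.exists_sum (lin_pow_isHomogeneous t e)
  have h1 := congrArg (eval s) hc
  have h2 := congrArg (eval t) hc
  rw [map_pow] at h1 h2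
  rw [eval_lin_self, zero_pow (by have := hz.pos; omega)] at h2
  simp only [map_sum, map_mul, eval_C] at h1 h2
  have h3 : eval s (lin t) ^ e = l * 0 := by
    rw [h1, h2, Finset.mul_sum]
    exact Finset.sum_congr rfl fun i _ => by rw [h]; ring
  rw [mul_zero] at h3
  exact pow_eq_zero_iff (by have := hz.pos; omega) |>.1 h3

end IsFormBasis

lemma affinePt_eq_mk_iff {d : ℕ} {x : Fin d → ℂ} {w : Fin (d + 1) → ℂ} (hw : w ≠ 0) :
    Projectivization.mk ℂ w hw = affinePt x ↔ w 0 ≠ 0 ∧ ∀ i : Fin d, w i.succ = x i * w 0 := by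
  unfold affinePt
  rw [Projectivization.mk_eq_mk_iff']
  constructor
  · rintro ⟨c, rfl⟩
    have hc : c ≠ 0 := by rintro rfl; simp at hw
    simp [hc, mul_comm]
  · rintro ⟨h0, h⟩
    refine ⟨w 0, ?_⟩
    ext i
    refine Fin.cases ?_ (fun i => ?_) i
    · simp
    · simp [h, mul_comm]

lemma isRealPoint_affinePt {d : ℕ} {x : Fin d → ℂ} : IsRealPoint (affinePt x) ↔ star x = x := by
  rw [isRealPoint_iff]
  have : conjPt (affinePt x) = affinePt (star x) := by
    unfold affinePt
    rw [conjPt_mk]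
    congr 1
    ext i
    refine Fin.cases ?_ (fun i => ?_) i <;> simp
  rw [this]
  constructor
  · intro h
    have h1 := (affinePt_eq_mk_iff _).1 h
    ext i
    simpa using h1.2 i
  · intro h
    rw [h]

lemma star_toComplex {d : ℕ} (r : EuclideanSpace ℝ (Fin d)) : star (toComplex r) = toComplex r := by
  ext i; simp [toComplex]

lemma star_inversion {d : ℕ} (r : EuclideanSpace ℝ (Fin d)) {x : Fin d → ℂ} (hx : star x = x) :
    star (inversion (toComplex r) x) = inversion (toComplex r) x := by
  have hq : star (quad (x - toComplex r)) = quad (x - toComplex r) := by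
    unfold quad
    rw [star_sum]
    refine Finset.sum_congr rfl fun i _ => ?_
    rw [star_pow]
    congr 1
    have := congrFun (show star (x - toComplex r) = x - toComplex r by
      rw [star_sub, hx, star_toComplex]) i
    exact this
  unfold inversion
  rw [star_add, star_smul, star_sub, hx, star_toComplex, star_inv₀, hq]

/-- The parametrized curve lies on the cone with vertex `[1, r]` over the curve with
parametrization `z`. -/
structure IsCone {d : ℕ} (φ : BirationalParam d) (r : EuclideanSpace ℝ (Fin d))
    (x a : MvPolynomial (Fin 2) ℂ) (z : Fin d → MvPolynomial (Fin 2) ℂ) : Prop where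
  form_zero : φ.form 0 = x
  form_succ : ∀ i : Fin d, φ.form i.succ = C (toComplex r i) * x + a * z i

/-- Construction of a parametrization of a curve on the cone. -/
lemma exists_isCone {d e n : ℕ} {z : Fin d → MvPolynomial (Fin 2) ℂ} (hz : IsFormBasis e z)
    (r : EuclideanSpace ℝ (Fin d)) {x a : MvPolynomial (Fin 2) ℂ} (ha : a.IsHomogeneous n)
    (hx : x.IsHomogeneous (n + e)) (ha0 : a ≠ 0) (hxa : NoCommonZero x a) :
    ∃ ψ : BirationalParam d, ψ.deg = n + e ∧ IsCone ψ r x a z := by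
  set F : Fin (d + 1) → MvPolynomial (Fin 2) ℂ :=
    Fin.cons x fun i => C (toComplex r i) * x + a * z i with hF
  have hsucc : ∀ v i, eval v (F i.succ) = toComplex r i * eval v (F 0) + eval v a * eval v (z i) := by
    intro v i
    simp [hF]
  have h0 : ∀ v : Fin 2 → ℂ, v ≠ 0 → (fun i => eval v (F i)) ≠ 0 := by
    intro v hv h
    have hx0 : eval v x = 0 := congrFun h 0
    obtain ⟨i, hi⟩ := hz.exists_eval_ne_zero hv
    have h1 : eval v (F i.succ) = 0 := congrFun h i.succ
    have h2 : eval v (F 0) = 0 := congrFun h 0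
    rw [hsucc, h2, mul_zero, zero_add] at h1
    exact mul_ne_zero (hxa v hv hx0) hi h1
  refine ⟨⟨n + e, F, ?_, h0, ?_⟩, rfl, rfl, fun i => rfl⟩
  · intro i
    refine Fin.cases hx (fun i => ?_) i
    exact (hx.C_mul _).add (ha.mul (hz.homog i))
  -- Off the vertex, that is where a ≠ 0, a point determines the values of z up to a scalar, and
  -- these determine the parameter.
  · refine (zeros_finite ha ha0).1.subset ?_
    rintro t ⟨u, hut, h⟩
    by_contra hat
    refine hut ?_
    rw [Projectivization.mk_eq_mk_iff'] at h
    obtain ⟨l, hl⟩ := h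
    have hl' : ∀ i, eval u.rep (F i) = l * eval t.rep (F i) := fun i => (congrFun hl i).symm
    have h2 : ∀ i, eval u.rep a * eval u.rep (z i) = l * (eval t.rep a * eval t.rep (z i)) := by
      intro i
      have h3 := hl' i.succ
      rw [hsucc, hsucc, hl' 0] at h3
      linear_combination h3
    have hat' : eval t.rep a ≠ 0 := hat
    have hl0 : l ≠ 0 := by
      rintro rfl
      refine h0 u.rep u.rep_nonzero (funext fun i => ?_)
      rw [hl', zero_mul]
      rfl
    rw [eq_comm, ← eval_rep_lin_rep]
    refine hz.eval_lin_eq_zero (l := eval u.rep a / (l * eval t.rep a)) fun i => ?_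
    field_simp
    linear_combination -h2 i

namespace IsCone

variable {d e : ℕ} {φ : BirationalParam d} {r : EuclideanSpace ℝ (Fin d)}
  {x a : MvPolynomial (Fin 2) ℂ} {z : Fin d → MvPolynomial (Fin 2) ℂ}

lemma vec_zero (h : IsCone φ r x a z) (v : Fin 2 → ℂ) : φ.vec v 0 = eval v x := by
  rw [BirationalParam.vec_apply, h.form_zero]

lemma vec_succ (h : IsCone φ r x a z) (v : Fin 2 → ℂ) (i : Fin d) :
    φ.vec v i.succ = toComplex r i * eval v x + eval v a * eval v (z i) := by
  rw [BirationalParam.vec_apply, h.form_succ]; simp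

lemma noCommonZero (h : IsCone φ r x a z) : NoCommonZero x a := by
  intro v hv hx ha
  refine φ.vec_ne_zero hv (funext fun i => ?_)
  refine Fin.cases ?_ (fun i => ?_) i
  · rw [h.vec_zero, hx]; rfl
  · rw [h.vec_succ, hx, ha]; simp

lemma map_eq_realPt_iff (h : IsCone φ r x a z) (hz : IsFormBasis e z) (t : CP 1) :
    φ.map t = realPt r ↔ eval t.rep a = 0 := by
  rw [φ.map_eq, realPt, affinePt_eq_mk_iff, h.vec_zero]
  simp only [h.vec_succ]
  constructor
  · rintro ⟨-, h2⟩
    obtain ⟨i, hi⟩ := hz.exists_eval_ne_zero t.rep_nonzero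
    have := h2 i
    rw [add_eq_left, mul_eq_zero] at this
    exact this.resolve_right hi
  · intro ha
    refine ⟨fun hx => h.noCommonZero _ t.rep_nonzero hx ha, fun i => ?_⟩
    rw [ha]; ring

/-- The multiplicity on the sphere at infinity is the order of the common factor `u` of `x` and
of the sum of the squares of the `z i`. -/
lemma multSigma_eq (h : IsCone φ r x a z) {u x' q : MvPolynomial (Fin 2) ℂ} {m n : ℕ}
    (hx : x = u * x') (hq : ∑ i, z i ^ 2 = u * q) (hx' : x'.IsHomogeneous m)
    (haq : (a ^ 2 * q).IsHomogeneous n) (hN : NoCommonZero x' (a ^ 2 * q)) (t : CP 1) :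
    φ.multSigma t = ordAt u t := by
  -- Modulo x only a² ∑ zᵢ² survives, so it can replace the sum of squares in the minimum of orders.
  have hsum : ∑ i : Fin d, φ.form i.succ ^ 2 =
      x * (x * ∑ i, C (toComplex r i) ^ 2 + 2 * a * ∑ i, C (toComplex r i) * z i) +
        u * (a ^ 2 * q) := by
    have : u * (a ^ 2 * q) = a ^ 2 * ∑ i, z i ^ 2 := by rw [hq]; ring
    rw [this]
    simp only [h.form_succ, Finset.mul_sum, mul_add, ← Finset.sum_add_distrib]
    refine Finset.sum_congr rfl fun i _ => ?_
    ring
  unfold BirationalParam.multSigma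
  rw [h.form_zero, hsum]
  set y := x * ∑ i, C (toComplex r i) ^ 2 + 2 * a * ∑ i, C (toComplex r i) * z i
  have hadd : ∀ y w : MvPolynomial (Fin 2) ℂ,
      min (ordAt x t) (ordAt w t) ≤ ordAt (x * y + w) t := by
    intro y w
    refine le_trans (min_le_min_right _ ?_) min_le_emultiplicity_add
    exact emultiplicity_le_emultiplicity_of_dvd_right (dvd_mul_right x y)
  have hmin : min (ordAt x t) (ordAt (x * y + u * (a ^ 2 * q)) t) =
      min (ordAt x t) (ordAt (u * (a ^ 2 * q)) t) := by
    refine le_antisymm (le_min (min_le_left _ _) ?_) (le_min (min_le_left _ _) (hadd _ _))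
    have := hadd (-y) (x * y + u * (a ^ 2 * q))
    rwa [show x * -y + (x * y + u * (a ^ 2 * q)) = u * (a ^ 2 * q) by ring] at this
  rw [hmin, hx]
  exact min_ordAt_mul hx' haq hN u t

/-- At a zero of a the form x is nonzero, so evaluating a relation there kills its x-part; what
remains is a relation among the `z i`. -/
lemma linearIndependent (h : IsCone φ r x a z) (hz : LinearIndependent ℂ z) (ha0 : a ≠ 0)
    {v : Fin 2 → ℂ} (hv : v ≠ 0) (hav : eval v a = 0) : LinearIndependent ℂ φ.form := by
  rw [Fintype.linearIndependent_iff] at hz ⊢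
  intro g hg
  have hg' : C (g 0 + ∑ i : Fin d, g i.succ * toComplex r i) * x + a * ∑ i : Fin d, g i.succ • z i
      = 0 := by
    rw [← hg, Fin.sum_univ_succ, h.form_zero]
    simp only [h.form_succ, smul_eq_C_mul, map_add, map_sum, map_mul, add_mul, Finset.sum_mul,
      Finset.mul_sum, add_assoc, ← Finset.sum_add_distrib]
    congr 1
    refine Finset.sum_congr rfl fun i _ => ?_
    ring
  have hx : eval v x ≠ 0 := fun hx => h.noCommonZero v hv hx hav
  have h0 : g 0 + ∑ i : Fin d, g i.succ * toComplex r i = 0 := by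
    have := congrArg (eval v) hg'
    rw [map_add, map_mul, map_mul, hav, zero_mul, add_zero, eval_C, map_zero] at this
    exact (mul_eq_zero.1 this).resolve_right hx
  rw [h0, C_0, zero_mul, zero_add] at hg'
  have h1 := hz _ ((mul_eq_zero.1 hg').resolve_left ha0)
  refine Fin.cases ?_ h1
  simpa [h1] using h0

end IsCone

/-! ### Inversion of curves on a cone -/

/-- Two curves on the same cone that are inverse to each other. -/
structure InversePair {d : ℕ} (e : ℕ) (φ ψ : BirationalParam d) (r : EuclideanSpace ℝ (Fin d))
    (a b c g : MvPolynomial (Fin 2) ℂ) (z : Fin d → MvPolynomial (Fin 2) ℂ) : Prop where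
  basis : IsFormBasis e z
  left : IsCone φ r (g * a) c z
  right : IsCone ψ r (c * b) a z
  quad_eq : ∑ i, z i ^ 2 = g * b

namespace InversePair

variable {d e : ℕ} {φ ψ : BirationalParam d} {r : EuclideanSpace ℝ (Fin d)}
  {a b c g : MvPolynomial (Fin 2) ℂ} {z : Fin d → MvPolynomial (Fin 2) ℂ}

/-- Inversion is an involution. This carries reality of points back from the inverse curve to the
original one. -/
lemma symm (h : InversePair e φ ψ r a b c g z) : InversePair e ψ φ r c g a b z where
  basis := h.basis
  left := by rw [mul_comm]; exact h.right
  right := by rw [mul_comm]; exact h.left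
  quad_eq := by rw [mul_comm]; exact h.quad_eq

lemma map_eq_affinePt (h : InversePair e φ ψ r a b c g z) {t : CP 1} {x : Fin d → ℂ}
    (hx : φ.map t = affinePt x) (hq : quad (x - toComplex r) ≠ 0) :
    ψ.map t = affinePt (inversion (toComplex r) x) := by
  rw [φ.map_eq, affinePt_eq_mk_iff, h.left.vec_zero] at hx
  obtain ⟨hx0, hx1⟩ := hx
  have hd : x - toComplex r =
      fun i => eval t.rep c / eval t.rep (g * a) * eval t.rep (z i) := by
    ext i
    have := hx1 i
    rw [h.left.vec_succ] at this
    simp only [Pi.sub_apply]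
    field_simp
    linear_combination -this
  have hqe : quad (x - toComplex r) =
      (eval t.rep c / eval t.rep (g * a)) ^ 2 * eval t.rep (g * b) := by
    rw [hd, ← h.quad_eq]
    simp only [quad, mul_pow, ← Finset.mul_sum, map_sum, map_pow]
  rw [hqe] at hq
  rw [map_mul] at hx0
  simp only [map_mul] at hq hqe hd
  have hg0 : eval t.rep g ≠ 0 := left_ne_zero_of_mul hx0
  have ha0 : eval t.rep a ≠ 0 := right_ne_zero_of_mul hx0
  have hb0 : eval t.rep b ≠ 0 := right_ne_zero_of_mul (right_ne_zero_of_mul hq)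
  have hc0 : eval t.rep c ≠ 0 := by
    intro h0
    rw [h0] at hq
    simp at hq
  rw [ψ.map_eq, affinePt_eq_mk_iff, h.right.vec_zero]
  refine ⟨by rw [map_mul]; exact mul_ne_zero hc0 hb0, fun i => ?_⟩
  rw [h.right.vec_succ, inversion, hqe, hd]
  simp only [Pi.add_apply, Pi.smul_apply, smul_eq_mul, map_mul]
  field_simp

lemma exists_affinePt (h : InversePair e φ ψ r a b c g z) {t : CP 1}
    (ht : eval t.rep (g * a * (c * b)) ≠ 0) :
    ∃ x, φ.map t = affinePt x ∧ quad (x - toComplex r) ≠ 0 := by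
  simp only [map_mul, mul_ne_zero_iff] at ht
  obtain ⟨⟨hg, ha⟩, hc, hb⟩ := ht
  refine ⟨fun i => toComplex r i + eval t.rep c * eval t.rep (z i) / eval t.rep (g * a), ?_, ?_⟩
  · rw [φ.map_eq, affinePt_eq_mk_iff, h.left.vec_zero]
    refine ⟨by rw [map_mul]; exact mul_ne_zero hg ha, fun i => ?_⟩
    rw [h.left.vec_succ, map_mul]
    field_simp
  · have : quad ((fun i => toComplex r i + eval t.rep c * eval t.rep (z i) / eval t.rep (g * a)) -
        toComplex r) = (eval t.rep c / eval t.rep (g * a)) ^ 2 * eval t.rep (g * b) := by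
      rw [← h.quad_eq]
      simp only [quad, map_sum, map_pow, Finset.mul_sum, Pi.sub_apply]
      refine Finset.sum_congr rfl fun i _ => ?_
      ring
    rw [this, map_mul, map_mul]
    positivity

lemma isRealPoint_map (h : InversePair e φ ψ r a b c g z) {t : CP 1}
    (ht : eval t.rep (g * a * (c * b)) ≠ 0) (hr : IsRealPoint (φ.map t)) :
    IsRealPoint (ψ.map t) := by
  obtain ⟨x, hx, hq⟩ := h.exists_affinePt ht
  rw [hx, isRealPoint_affinePt] at hr
  rw [h.map_eq_affinePt hx hq, isRealPoint_affinePt]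
  exact star_inversion r hr

/-- The inverted points lie on ψ and miss only the finitely many parameters where g a c b = 0, so
they are Zariski dense in it. -/
lemma inverseCurve_eq (h : InversePair e φ ψ r a b c g z) {n : ℕ}
    (hgacb : (g * a * (c * b)).IsHomogeneous n) (h0 : g * a * (c * b) ≠ 0) :
    inverseCurve r (Set.range φ.map) = Set.range ψ.map := by
  refine ψ.zariskiClosure_eq_range ?_ (zeros_finite hgacb h0).1 fun t ht => ?_
  · rintro _ ⟨x, ⟨t, ht⟩, hq, rfl⟩
    exact ⟨t, h.map_eq_affinePt ht hq⟩
  · obtain ⟨x, hx, hq⟩ := h.exists_affinePt ht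
    exact ⟨x, ⟨t, hx⟩, hq, h.map_eq_affinePt hx hq⟩

lemma isReal (h : InversePair e φ ψ r a b c g z) {n : ℕ}
    (hgacb : (g * a * (c * b)).IsHomogeneous n) (h0 : g * a * (c * b) ≠ 0)
    (hφ : IsReal (Set.range φ.map)) : IsReal (Set.range ψ.map) := by
  have hinf : {t | IsRealPoint (φ.map t)}.Infinite := by
    intro hf
    refine hφ ((hf.image φ.map).subset ?_)
    rintro _ ⟨⟨t, rfl⟩, ht⟩
    exact ⟨t, ht, rfl⟩
  refine (ψ.image_infinite (hinf.sdiff (zeros_finite hgacb h0).1)).mono ?_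
  rintro _ ⟨t, ⟨ht, htb⟩, rfl⟩
  exact ⟨⟨t, rfl⟩, h.isRealPoint_map htb ht⟩

end InversePair

/-! ### Zariski tangent spaces and smoothness off the vertex -/

/-- The directional derivative of `F` at `p` in direction `w`. -/
noncomputable def dirDeriv {σ : Type*} [Fintype σ] (p w : σ → ℂ) (F : MvPolynomial σ ℂ) : ℂ :=
  ∑ i, eval p (pderiv i F) * w i

section dirDeriv

variable {σ : Type*} [Fintype σ] (p w : σ → ℂ)

lemma dirDeriv_add (F G : MvPolynomial σ ℂ) :
    dirDeriv p w (F + G) = dirDeriv p w F + dirDeriv p w G := by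
  simp [dirDeriv, add_mul, Finset.sum_add_distrib]

lemma dirDeriv_sub (F G : MvPolynomial σ ℂ) :
    dirDeriv p w (F - G) = dirDeriv p w F - dirDeriv p w G := by
  simp [dirDeriv, sub_mul, Finset.sum_sub_distrib]

lemma dirDeriv_mul (F G : MvPolynomial σ ℂ) :
    dirDeriv p w (F * G) = dirDeriv p w F * eval p G + eval p F * dirDeriv p w G := by
  simp only [dirDeriv, Derivation.leibniz, smul_eq_mul, map_add, map_mul, Finset.sum_mul,
    Finset.mul_sum, ← Finset.sum_add_distrib]
  exact Finset.sum_congr rfl fun i _ => by ring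

lemma dirDeriv_C (c : ℂ) : dirDeriv p w (C c : MvPolynomial σ ℂ) = 0 := by
  simp [dirDeriv]

lemma dirDeriv_X [DecidableEq σ] (i : σ) : dirDeriv p w (X i : MvPolynomial σ ℂ) = w i := by
  simp [dirDeriv, pderiv_X, Pi.single_apply]

lemma dirDeriv_sum {ι : Type*} (s : Finset ι) (F : ι → MvPolynomial σ ℂ) :
    dirDeriv p w (∑ i ∈ s, F i) = ∑ i ∈ s, dirDeriv p w (F i) := by
  simp only [dirDeriv, map_sum, Finset.sum_mul]
  exact Finset.sum_comm

lemma dirDeriv_self {F : MvPolynomial σ ℂ} {n : ℕ} (hF : F.IsHomogeneous n) :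
    dirDeriv p p F = n * eval p F := by
  have := congrArg (eval p) hF.sum_X_mul_pderiv
  simp only [map_sum, map_mul, eval_X, nsmul_eq_mul, map_natCast] at this
  rw [← this]
  exact Finset.sum_congr rfl fun i _ => mul_comm _ _

lemma dirDeriv_smul {F : MvPolynomial σ ℂ} {n : ℕ} (hF : F.IsHomogeneous n) (c : ℂ) :
    dirDeriv (c • p) w F = c ^ (n - 1) * dirDeriv p w F := by
  simp only [dirDeriv, Finset.mul_sum]
  refine Finset.sum_congr rfl fun i _ => ?_
  rw [eval_smul hF.pderiv, mul_assoc]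

end dirDeriv

lemma dirDeriv_lin (p w v : Fin 2 → ℂ) : dirDeriv p w (lin v) = eval w (lin v) := by
  simp [lin, dirDeriv_sub, dirDeriv_mul, dirDeriv_C, dirDeriv_X]

/-- The chain rule. -/
lemma dirDeriv_bind₁ {σ τ : Type*} [Fintype σ] [Fintype τ] [DecidableEq σ] (p w : τ → ℂ)
    (f : σ → MvPolynomial τ ℂ) (F : MvPolynomial σ ℂ) :
    dirDeriv p w (bind₁ f F) =
      dirDeriv (fun i => eval p (f i)) (fun i => dirDeriv p w (f i)) F := by
  induction F using MvPolynomial.induction_on with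
  | C a => simp [dirDeriv_C]
  | add F G hF hG => rw [map_add, dirDeriv_add, dirDeriv_add, hF, hG]
  | mul_X F i hF =>
    rw [map_mul, bind₁_X_right, dirDeriv_mul, dirDeriv_mul, hF, dirDeriv_X, eval_X, eval_bind₁_eq]

lemma mem_zariskiTangent_iff {d : ℕ} {C : Set (CP d)} {p : CP d} {w : Fin (d + 1) → ℂ} :
    w ∈ zariskiTangent C p ↔ ∀ n F, VanishesOn C n F → dirDeriv p.rep w F = 0 := Iff.rfl

namespace BirationalParam

variable {d : ℕ} (φ : BirationalParam d)

lemma exists_rep_map (t : CP 1) : ∃ c : ℂ, c ≠ 0 ∧ (φ.map t).rep = c • φ.vec t.rep := by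
  obtain ⟨a, ha⟩ := Projectivization.exists_smul_eq_mk_rep ℂ (φ.vec t.rep)
    (φ.vec_ne_zero t.rep_nonzero)
  exact ⟨a, a.ne_zero, ha.symm⟩

/-- Tangent vectors of the curve are annihilated by the differentials of its equations. -/
lemma dirDeriv_eq_zero {t : CP 1} {w : Fin (d + 1) → ℂ}
    (hw : w ∈ zariskiTangent (Set.range φ.map) (φ.map t)) {n : ℕ}
    {F : MvPolynomial (Fin (d + 1)) ℂ} (hF : F.IsHomogeneous n) (h : bind₁ φ.form F = 0) :
    dirDeriv (φ.vec t.rep) w F = 0 := by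
  obtain ⟨c, hc, hrep⟩ := φ.exists_rep_map t
  have := mem_zariskiTangent_iff.1 hw n F (φ.vanishesOn_range_iff.2 ⟨hF, h⟩)
  rw [hrep, dirDeriv_smul _ _ hF] at this
  exact (mul_eq_zero.1 this).resolve_left (pow_ne_zero _ hc)

/-- The differential of the parametrization. -/
noncomputable def differential (t : CP 1) : (Fin 2 → ℂ) →ₗ[ℂ] (Fin (d + 1) → ℂ) where
  toFun v i := dirDeriv t.rep v (φ.form i)
  map_add' v w := by
    ext i; simp [dirDeriv, mul_add, Finset.sum_add_distrib]
  map_smul' c v := by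
    ext i; simp [dirDeriv]; ring

lemma differential_apply (t : CP 1) (v : Fin 2 → ℂ) (i : Fin (d + 1)) :
    φ.differential t v i = dirDeriv t.rep v (φ.form i) := rfl

lemma differential_mem_tangent (t : CP 1) (v : Fin 2 → ℂ) :
    φ.differential t v ∈ zariskiTangent (Set.range φ.map) (φ.map t) := by
  obtain ⟨c, hc, hrep⟩ := φ.exists_rep_map t
  rw [mem_zariskiTangent_iff]
  intro n F hF
  obtain ⟨hF1, hF2⟩ := φ.vanishesOn_range_iff.1 hF
  rw [hrep, dirDeriv_smul _ _ hF1]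
  have := dirDeriv_bind₁ t.rep v φ.form F
  rw [hF2] at this
  have h0 : dirDeriv t.rep v (0 : MvPolynomial (Fin 2) ℂ) = 0 := by simp [dirDeriv]
  rw [h0] at this
  exact mul_eq_zero_of_right _ this.symm

end BirationalParam

/-- The linear form `∑ c_i (x_{i+1} - r_i x_0)`. -/
noncomputable def relForm {d : ℕ} (r : EuclideanSpace ℝ (Fin d)) (c : Fin d → ℂ) :
    MvPolynomial (Fin (d + 1)) ℂ := ∑ i, C (c i) * (X i.succ - C (toComplex r i) * X 0)

lemma relForm_isHomogeneous {d : ℕ} (r : EuclideanSpace ℝ (Fin d)) (c : Fin d → ℂ) :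
    (relForm r c).IsHomogeneous 1 :=
  IsHomogeneous.sum _ _ _ fun _ _ =>
    ((isHomogeneous_X _ _).sub (isHomogeneous_C_mul_X _ _)).C_mul _

lemma dirDeriv_relForm {d : ℕ} (r : EuclideanSpace ℝ (Fin d)) (c : Fin d → ℂ)
    (p w : Fin (d + 1) → ℂ) : dirDeriv p w (relForm r c) = eval w (relForm r c) := by
  simp [relForm, dirDeriv_sum, dirDeriv_sub, dirDeriv_mul, dirDeriv_C, dirDeriv_X]

namespace IsCone

variable {d e n : ℕ} {φ : BirationalParam d} {r : EuclideanSpace ℝ (Fin d)}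
  {x a : MvPolynomial (Fin 2) ℂ} {z : Fin d → MvPolynomial (Fin 2) ℂ}

lemma bind₁_relForm (h : IsCone φ r x a z) (c : Fin d → ℂ) :
    bind₁ φ.form (relForm r c) = a * ∑ i, C (c i) * z i := by
  simp only [relForm, map_sum, map_mul, map_sub, bind₁_X_right, bind₁_C_right, h.form_zero,
    h.form_succ, Finset.mul_sum]
  exact Finset.sum_congr rfl fun i _ => by ring

lemma eval_vec_relForm (h : IsCone φ r x a z) (c : Fin d → ℂ) (v : Fin 2 → ℂ) :
    eval (φ.vec v) (relForm r c) = eval v a * eval v (∑ i, C (c i) * z i) := by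
  have := congrArg (eval v) (h.bind₁_relForm c)
  rw [eval_bind₁_eq, map_mul] at this
  exact this

/-- Away from the vertex, a tangent vector of the cone is determined by two coordinates. -/
lemma eval_relForm_eq_zero (h : IsCone φ r x a z) (hz : IsFormBasis e z) {t : CP 1}
    (hat : eval t.rep a ≠ 0) {u : Fin 2 → ℂ} (hu : eval t.rep (lin u) ≠ 0)
    {c₀ c₁ : Fin d → ℂ} (hc₀ : lin u ^ e = ∑ i, C (c₀ i) * z i)
    (hc₁ : lin t.rep * lin u ^ (e - 1) = ∑ i, C (c₁ i) * z i) {w : Fin (d + 1) → ℂ}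
    (hw : w ∈ zariskiTangent (Set.range φ.map) (φ.map t))
    (h₀ : eval w (relForm r c₀) = 0) (h₁ : eval w (relForm r c₁) = 0) (c : Fin d → ℂ) :
    eval w (relForm r c) = 0 := by
  have hlin : ∀ c, (∑ i, C (c i) * z i = 0) → eval w (relForm r c) = 0 := by
    intro c hc
    have := φ.dirDeriv_eq_zero hw (relForm_isHomogeneous r c) (by rw [h.bind₁_relForm, hc, mul_zero])
    rwa [dirDeriv_relForm] at this
  have hadd : ∀ c c' : Fin d → ℂ, ∀ k k' : ℂ, eval w (relForm r (k • c + k' • c')) =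
      k * eval w (relForm r c) + k' * eval w (relForm r c') := by
    intro c c' k k'
    simp only [relForm, map_sum, map_mul, eval_C, Finset.mul_sum, ← Finset.sum_add_distrib,
      Pi.add_apply, Pi.smul_apply, smul_eq_mul]
    exact Finset.sum_congr rfl fun i _ => by ring
  have hzadd : ∀ c c' : Fin d → ℂ, ∀ k k' : ℂ, ∑ i, C ((k • c + k' • c') i) * z i =
      C k * ∑ i, C (c i) * z i + C k' * ∑ i, C (c' i) * z i := by
    intro c c' k k'
    simp only [Finset.mul_sum, ← Finset.sum_add_distrib, Pi.add_apply, Pi.smul_apply, smul_eq_mul,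
      map_add, map_mul]
    exact Finset.sum_congr rfl fun i _ => by ring
  obtain ⟨m, rfl⟩ : ∃ m, e = m + 1 := ⟨e - 1, by have := hz.pos; omega⟩
  rw [Nat.add_sub_cancel] at hc₁
  have hf : (∑ i, C (c i) * z i).IsHomogeneous (m + 1) :=
    IsHomogeneous.sum _ _ _ fun i _ => (hz.homog i).C_mul _
  -- remove the value at `t`
  set k₀ := eval t.rep (∑ i, C (c i) * z i) / eval t.rep (lin u) ^ (m + 1) with hk₀
  obtain ⟨f₁, hf₁, e₁⟩ := exists_eq_lin_mul (v := t.rep) t.rep_nonzero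
    (hf.sub ((lin_pow_isHomogeneous u (m + 1)).C_mul k₀)) (by
      rw [map_sub, map_mul, eval_C, map_pow, hk₀]
      field_simp
      ring)
  -- remove the derivative at `t`
  set k₁ := eval t.rep f₁ / eval t.rep (lin u) ^ m with hk₁
  have hf₂ : (f₁ - C k₁ * lin u ^ m).IsHomogeneous m :=
    hf₁.sub ((lin_pow_isHomogeneous u m).C_mul k₁)
  have hf₂0 : eval t.rep (f₁ - C k₁ * lin u ^ m) = 0 := by
    rw [map_sub, map_mul, eval_C, map_pow, hk₁]
    field_simp
    ring
  have hrem : ∃ c₂ : Fin d → ℂ, lin t.rep * (f₁ - C k₁ * lin u ^ m) = ∑ i, C (c₂ i) * z i ∧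
      eval w (relForm r c₂) = 0 := by
    cases m with
    | zero =>
      obtain ⟨κ, hκ⟩ := eq_C_of_isHomogeneous_zero hf₂
      rw [hκ, eval_C] at hf₂0
      refine ⟨0, by rw [hκ, hf₂0]; simp, by simp [relForm]⟩
    | succ m =>
      obtain ⟨f₃, hf₃, e₃⟩ := exists_eq_lin_mul (v := t.rep) t.rep_nonzero hf₂ hf₂0
      have hL := lin_isHomogeneous t.rep
      obtain ⟨c₂, hc₂⟩ := hz.exists_sum (F := lin t.rep * (lin t.rep * f₃)) (by
        have := hL.mul (hL.mul hf₃)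
        rwa [show 1 + (1 + m) = m + 1 + 1 by ring] at this)
      obtain ⟨c₃, hc₃⟩ := hz.exists_sum (F := lin t.rep * (lin u * f₃)) (by
        have := hL.mul ((lin_isHomogeneous u).mul hf₃)
        rwa [show 1 + (1 + m) = m + 1 + 1 by ring] at this)
      refine ⟨c₂, by rw [e₃, hc₂], ?_⟩
      -- A quadric through the cone, from u^e · L² f₃ = L u^(e-1) · L u f₃ with u, L the linear
      -- forms `lin u`, `lin t.rep`. Its derivative along w reduces to a nonzero multiple of
      -- `relForm r c₂` at w.
      have hq := φ.dirDeriv_eq_zero hw (F := relForm r c₀ * relForm r c₂ - relForm r c₁ * relForm r c₃)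
        (((relForm_isHomogeneous r _).mul (relForm_isHomogeneous r _)).sub
          ((relForm_isHomogeneous r _).mul (relForm_isHomogeneous r _))) (by
            rw [map_sub, map_mul, map_mul]
            simp only [h.bind₁_relForm, ← hc₀, ← hc₁, ← hc₂, ← hc₃]
            ring)
      rw [dirDeriv_sub, dirDeriv_mul, dirDeriv_mul] at hq
      simp only [dirDeriv_relForm, h₀, h₁, h.eval_vec_relForm, ← hc₀, ← hc₁, map_mul, map_pow,
        eval_lin_self, zero_mul, mul_zero, zero_add, sub_zero] at hq
      exact (mul_eq_zero.1 hq).resolve_left (mul_ne_zero hat (pow_ne_zero _ hu))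
  obtain ⟨c₂, hc₂, hwc₂⟩ := hrem
  have hfin := hlin ((1 : ℂ) • c + (-1 : ℂ) • (((k₀ • c₀ + k₁ • c₁)) + (1 : ℂ) • c₂)) (by
    have hone : (k₀ • c₀ + k₁ • c₁) + (1 : ℂ) • c₂ = (1 : ℂ) • (k₀ • c₀ + k₁ • c₁) + (1 : ℂ) • c₂ := by
      simp
    rw [hone, hzadd, hzadd, hzadd, ← hc₀, ← hc₁, ← hc₂]
    simp only [C_1, map_neg]
    linear_combination e₁)
  have hone : (k₀ • c₀ + k₁ • c₁) + (1 : ℂ) • c₂ = (1 : ℂ) • (k₀ • c₀ + k₁ • c₁) + (1 : ℂ) • c₂ := by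
    simp
  rw [hone, hadd, hadd, hadd, h₀, h₁, hwc₂] at hfin
  simpa using hfin

/-- The curve is smooth away from the vertex of the cone. -/
lemma isSmoothAt (h : IsCone φ r x a z) (hz : IsFormBasis e z) (ha : a.IsHomogeneous n)
    (hx : x.IsHomogeneous (n + e)) (hn : n ≤ 2 * e) {t : CP 1} (hat : eval t.rep a ≠ 0) :
    IsSmoothAt (Set.range φ.map) (φ.map t) := by
  obtain ⟨u, hu0, hu⟩ := exists_lin_ne_zero t.rep_nonzero
  obtain ⟨m, rfl⟩ : ∃ m, e = m + 1 := ⟨e - 1, by have := hz.pos; omega⟩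
  have hLM : (lin t.rep * lin u ^ (m + 1 - 1)).IsHomogeneous (m + 1) := by
    have := (lin_isHomogeneous t.rep).mul (lin_pow_isHomogeneous u m)
    rwa [show 1 + m = m + 1 by omega] at this
  obtain ⟨c₀, hc₀⟩ := hz.exists_sum (lin_pow_isHomogeneous u (m + 1))
  obtain ⟨c₁, hc₁⟩ := hz.exists_sum hLM
  refine le_antisymm ?_ ?_
  · let T : zariskiTangent (Set.range φ.map) (φ.map t) →ₗ[ℂ] (Fin 2 → ℂ) :=
      { toFun := fun w => ![eval w.1 (relForm r c₀), eval w.1 (relForm r c₁)]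
        map_add' := fun v w => by
          ext j; fin_cases j <;>
          · simp [relForm, ← Finset.sum_add_distrib]
            exact Finset.sum_congr rfl fun i _ => by ring
        map_smul' := fun k v => by
          ext j; fin_cases j <;>
          · simp [relForm, Finset.mul_sum]
            exact Finset.sum_congr rfl fun i _ => by ring }
    have hT : Function.Injective T := by
      rw [injective_iff_map_eq_zero]
      rintro ⟨w, hw⟩ hTw
      have hzero := h.eval_relForm_eq_zero hz hat hu hc₀ hc₁ hw (congrFun hTw 0) (congrFun hTw 1)
      -- The coordinate `w 0` remains. Padding with a power of `lin u` brings a to degree 2e and x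
      -- to degree 3e, so both split into forms of degree e. The resulting cubic relation contains X
      -- 0 linearly, with nonzero coefficient at the point.
      have hM : (lin u ^ (2 * (m + 1) - n)).IsHomogeneous (2 * (m + 1) - n) :=
        lin_pow_isHomogeneous _ _
      obtain ⟨f₁, f₂, hf₁, hf₂, e₁₂⟩ := exists_mul_of_add (m := m + 1) (n := m + 1)
        (F := a * lin u ^ (2 * (m + 1) - n)) (by
          have := ha.mul hM
          rwa [show n + (2 * (m + 1) - n) = m + 1 + (m + 1) by omega] at this)
      obtain ⟨f₃, f', hf₃, hf', e₃⟩ := exists_mul_of_add (m := m + 1) (n := m + 1 + (m + 1))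
        (F := x * lin u ^ (2 * (m + 1) - n)) (by
          have := hx.mul hM
          rwa [show n + (m + 1) + (2 * (m + 1) - n) = m + 1 + (m + 1 + (m + 1)) by omega] at this)
      obtain ⟨f₄, f₅, hf₄, hf₅, rfl⟩ := exists_mul_of_add hf'
      obtain ⟨d₁, hd₁⟩ := hz.exists_sum hf₁
      obtain ⟨d₂, hd₂⟩ := hz.exists_sum hf₂
      obtain ⟨d₃, hd₃⟩ := hz.exists_sum hf₃
      obtain ⟨d₄, hd₄⟩ := hz.exists_sum hf₄
      obtain ⟨d₅, hd₅⟩ := hz.exists_sum hf₅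
      have hR := relForm_isHomogeneous r
      have hq := φ.dirDeriv_eq_zero hw (n := 3)
        (F := X 0 * (relForm r d₁ * relForm r d₂) - relForm r d₃ * (relForm r d₄ * relForm r d₅))
        (((isHomogeneous_X _ _).mul ((hR _).mul (hR _))).sub ((hR _).mul ((hR _).mul (hR _)))) (by
            simp only [map_sub, map_mul, bind₁_X_right, h.form_zero, h.bind₁_relForm, ← hd₁, ← hd₂,
              ← hd₃, ← hd₄, ← hd₅]
            linear_combination (-x * a ^ 2) * e₁₂ + a ^ 3 * e₃)
      have e₁₂' := congrArg (eval t.rep) e₁₂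
      rw [map_mul, map_mul, map_pow] at e₁₂'
      simp only [dirDeriv_sub, dirDeriv_mul, dirDeriv_relForm, dirDeriv_X, hzero, map_mul,
        h.eval_vec_relForm, ← hd₁, ← hd₂, zero_mul, mul_zero, add_zero, sub_zero] at hq
      have hne : eval t.rep a * eval t.rep f₁ * (eval t.rep a * eval t.rep f₂) ≠ 0 := by
        rw [show eval t.rep a * eval t.rep f₁ * (eval t.rep a * eval t.rep f₂) =
          eval t.rep a ^ 2 * (eval t.rep f₁ * eval t.rep f₂) by ring, ← e₁₂']
        exact mul_ne_zero (pow_ne_zero _ hat) (mul_ne_zero hat (pow_ne_zero _ hu))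
      have hw0 : w 0 = 0 := (mul_eq_zero.1 hq).resolve_right hne
      refine Subtype.ext (funext fun i => ?_)
      refine Fin.cases hw0 (fun i => ?_) i
      have := hzero (Pi.single i 1)
      simp only [relForm, map_sum, map_mul, eval_C, map_sub, eval_X, hw0, mul_zero, sub_zero] at this
      rw [Finset.sum_eq_single i (by intro b _ hb; simp [hb]) (by simp)] at this
      simpa using this
    have := LinearMap.finrank_le_finrank_of_injective hT
    simpa using this
  · have hinj : Function.Injective (φ.differential t) := by
      rw [injective_iff_map_eq_zero]
      intro v hv
      have h1 : ∀ i, dirDeriv t.rep v (a * z i) = 0 := by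
        intro i
        have h2 := congrFun hv i.succ
        have h3 := congrFun hv 0
        rw [φ.differential_apply, h.form_succ, dirDeriv_add, dirDeriv_mul, dirDeriv_C] at h2
        rw [φ.differential_apply, h.form_zero] at h3
        rw [h3] at h2
        simpa using h2
      -- For f = L u^(e-1) this makes v a multiple of `t.rep`; for f = u^e Euler's identity then
      -- makes it 0.
      have h2 : ∀ f : MvPolynomial (Fin 2) ℂ, f.IsHomogeneous (m + 1) →
          dirDeriv t.rep v (a * f) = 0 := by
        intro f hf
        obtain ⟨c, rfl⟩ := hz.exists_sum hf
        rw [show a * ∑ i, C (c i) * z i = ∑ i, C (c i) * (a * z i) by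
          rw [Finset.mul_sum]; exact Finset.sum_congr rfl fun i _ => by ring]
        rw [dirDeriv_sum]
        exact Finset.sum_eq_zero fun i _ => by rw [dirDeriv_mul, dirDeriv_C, h1]; ring
      have h3 := h2 _ hLM
      rw [show a * (lin t.rep * lin u ^ (m + 1 - 1)) = lin t.rep * (a * lin u ^ (m + 1 - 1)) by ring,
        dirDeriv_mul, eval_lin_self, zero_mul, add_zero, dirDeriv_lin, map_mul, map_pow] at h3
      have h4 := (mul_eq_zero.1 h3).resolve_right (mul_ne_zero hat (pow_ne_zero _ hu))
      obtain ⟨μ, rfl⟩ := exists_smul_of_eval_lin t.rep_nonzero h4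
      have h5 := h2 _ (lin_pow_isHomogeneous u (m + 1))
      have h6 : dirDeriv t.rep (μ • t.rep) (a * lin u ^ (m + 1)) =
          μ * dirDeriv t.rep t.rep (a * lin u ^ (m + 1)) := by
        simp only [dirDeriv, Finset.mul_sum, Pi.smul_apply, smul_eq_mul]
        exact Finset.sum_congr rfl fun i _ => by ring
      rw [h6, dirDeriv_self _ (ha.mul (lin_pow_isHomogeneous u (m + 1))), map_mul, map_pow] at h5
      have hne : ((n + (m + 1) : ℕ) : ℂ) * (eval t.rep a * eval t.rep (lin u) ^ (m + 1)) ≠ 0 :=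
        mul_ne_zero (Nat.cast_ne_zero.2 (by omega)) (mul_ne_zero hat (pow_ne_zero _ hu))
      rw [(mul_eq_zero.1 h5).resolve_right hne, zero_smul]
    have h1 : LinearMap.range (φ.differential t) ≤
        zariskiTangent (Set.range φ.map) (φ.map t) := by
      rintro _ ⟨v, rfl⟩
      exact φ.differential_mem_tangent t v
    have h2 := Submodule.finrank_mono h1
    rw [LinearMap.finrank_range_of_inj hinj] at h2
    simpa using h2

end IsCone

/-! ### The inverse of a given curve on a cone -/

/-- The inverse of a curve on a cone. -/
lemma IsCone.exists_inverse {d e p N : ℕ} {φ : BirationalParam d} {r : EuclideanSpace ℝ (Fin d)}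
    {x c : MvPolynomial (Fin 2) ℂ} {z : Fin d → MvPolynomial (Fin 2) ℂ} (h : IsCone φ r x c z)
    (hz : IsFormBasis e z) (hc : c.IsHomogeneous p) (hx : x.IsHomogeneous (p + e)) (hc0 : c ≠ 0)
    (hx0 : x ≠ 0) (hq0 : ∑ i, z i ^ 2 ≠ 0) (hN : ∑ᶠ t, φ.multSigma t = (N : ℕ∞)) :
    ∃ m n a b g, ∃ ψ : BirationalParam d, N + m = p + e ∧ N + n = e + e ∧ a.IsHomogeneous m ∧
      b.IsHomogeneous n ∧ a ≠ 0 ∧ x = g * a ∧ NoCommonZero a b ∧ ψ.deg = m + e ∧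
      InversePair e φ ψ r a b c g z ∧ (g * a * (c * b)).IsHomogeneous (p + e + (p + n)) ∧
      g * a * (c * b) ≠ 0 ∧ ∑ᶠ t, ψ.multSigma t = (n : ℕ∞) := by
  have hQ : (∑ i, z i ^ 2).IsHomogeneous (e + e) := by
    refine IsHomogeneous.sum _ _ _ fun i _ => ?_
    rw [sq]
    exact (hz.homog i).mul (hz.homog i)
  obtain ⟨k, m, n, g, a, b, hg, ha, hb, hm, hn, e₁, e₂, hab, -⟩ := exists_gcd hx hQ hx0 hq0
  have hg0 : g ≠ 0 := by rintro rfl; exact hx0 (by rw [e₁, zero_mul])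
  have ha0 : a ≠ 0 := by rintro rfl; exact hx0 (by rw [e₁, mul_zero])
  have hb0 : b ≠ 0 := by rintro rfl; exact hq0 (by rw [e₂, mul_zero])
  have hxc := h.noCommonZero
  have hac : NoCommonZero a (c ^ 2 * b) := by
    intro v hv hva
    rw [map_mul, map_pow]
    exact mul_ne_zero (pow_ne_zero _ (hxc v hv (by rw [e₁, map_mul, hva, mul_zero]))) (hab v hv hva)
  -- The multiplicity on the sphere at infinity is the degree of g. For the inverse, c b and g b
  -- have the common factor b, with cofactors c and g having no common zero, which gives `n` below.
  have hkN : k = N := by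
    have h1 : ∑ᶠ t, φ.multSigma t = (k : ℕ∞) := by
      rw [← finsum_ordAt hg hg0]
      exact finsum_congr fun t => h.multSigma_eq e₁ e₂ ha ((hc.pow 2).mul hb) hac t
    exact_mod_cast h1.symm.trans hN
  subst hkN
  have hcb : (c * b).IsHomogeneous (m + e) := by
    have := hc.mul hb
    rwa [show p + n = m + e by omega] at this
  have hcba : NoCommonZero (c * b) a := by
    intro v hv hcb hva
    rw [map_mul] at hcb
    rcases mul_eq_zero.1 hcb with h0 | h0
    · exact hxc v hv (by rw [e₁, map_mul, hva, mul_zero]) h0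
    · exact hab v hv hva h0
  obtain ⟨ψ, hψd, hψ⟩ := exists_isCone hz r ha hcb ha0 hcba
  refine ⟨m, n, a, b, g, ψ, hm, hn, ha, hb, ha0, e₁, hab, hψd, ⟨hz, e₁ ▸ h, hψ, e₂⟩, ?_, ?_, ?_⟩
  · rw [← e₁]
    exact hx.mul (hc.mul hb)
  · exact mul_ne_zero (mul_ne_zero hg0 ha0) (mul_ne_zero hc0 hb0)
  · rw [← finsum_ordAt hb hb0]
    refine finsum_congr fun t => hψ.multSigma_eq (x' := c) (q := g) (mul_comm _ _)
      (by rw [e₂, mul_comm]) hc ((ha.pow 2).mul hg) ?_ t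
    intro v hv hvc h0
    rw [map_mul, map_pow] at h0
    refine hxc v hv ?_ hvc
    rw [e₁, map_mul]
    rcases mul_eq_zero.1 h0 with h0 | h0
    · rw [pow_eq_zero_iff two_ne_zero |>.1 h0, mul_zero]
    · rw [h0, zero_mul]

/-- The differences `x_{i+1} - r_i x_0` of a nondegenerate parametrization are linearly
independent. -/
lemma linearIndependent_of_cone {d : ℕ} {φ : BirationalParam d} (hli : LinearIndependent ℂ φ.form)
    {r : EuclideanSpace ℝ (Fin d)} {x c : MvPolynomial (Fin 2) ℂ}
    {z : Fin d → MvPolynomial (Fin 2) ℂ} (h : IsCone φ r x c z) : LinearIndependent ℂ z := by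
  rw [Fintype.linearIndependent_iff] at hli ⊢
  intro g hg i
  have := hli (Fin.cons (-∑ i, g i * toComplex r i) g) (by
    rw [Fin.sum_univ_succ]
    simp only [Fin.cons_zero, Fin.cons_succ, h.form_zero, h.form_succ, smul_eq_C_mul] at hg ⊢
    have e1 : ∑ i, C (g i) * (C (toComplex r i) * x + c * z i) =
        (∑ i, C (g i) * C (toComplex r i)) * x + c * ∑ i, C (g i) * z i := by
      rw [Finset.sum_mul, Finset.mul_sum, ← Finset.sum_add_distrib]
      exact Finset.sum_congr rfl fun i _ => by ring
    rw [e1, hg, map_neg, map_sum]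
    simp only [map_mul]
    ring) i.succ
  simpa using this

/-! ### Boundedness and real parameters -/

lemma sum_sq_ne_zero {d : ℕ} {y : Fin d → ℂ} (hy : star y = y) (h0 : y ≠ 0) :
    ∑ i, y i ^ 2 ≠ 0 := by
  intro h
  have hre : ∀ i, ((y i).re : ℂ) = y i := fun i => Complex.conj_eq_iff_re.1 (congrFun hy i)
  have h1 : ((∑ i, (y i).re ^ 2 : ℝ) : ℂ) = 0 := by
    rw [← h]
    push_cast
    exact Finset.sum_congr rfl fun i _ => by rw [hre]
  have h2 : ∑ i, (y i).re ^ 2 = 0 := by exact_mod_cast h1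
  rw [Finset.sum_eq_zero_iff_of_nonneg fun i _ => sq_nonneg _] at h2
  refine h0 (funext fun i => ?_)
  rw [← hre i, pow_eq_zero_iff two_ne_zero |>.1 (h2 i (Finset.mem_univ i))]
  simp

lemma conjP_lin {v : Fin 2 → ℂ} (hv : star v = v) : conjP (lin v) = lin v := by
  have h : ∀ i, (starRingEnd ℂ) (v i) = v i := fun i => congrFun hv i
  simp [lin, h]

lemma conjPt_mk_real {d : ℕ} {v : Fin (d + 1) → ℂ} (hv : v ≠ 0) (h : star v = v) :
    conjPt (Projectivization.mk ℂ v hv) = Projectivization.mk ℂ v hv := by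
  rw [conjPt_mk]
  congr 1

lemma conjPt_realPt {d : ℕ} (r : EuclideanSpace ℝ (Fin d)) : conjPt (realPt r) = realPt r :=
  isRealPoint_iff.1 (isRealPoint_affinePt.2 (star_toComplex r))

lemma star_dirDeriv {σ : Type*} [Fintype σ] (p w : σ → ℂ) {F : MvPolynomial σ ℂ}
    (hF : conjP F = F) : star (dirDeriv p w F) = dirDeriv (star p) (star w) F := by
  simp only [dirDeriv, star_sum, star_mul']
  refine Finset.sum_congr rfl fun i _ => ?_
  congr 1
  have h := eval_conjP (pderiv i F) (star p)
  rw [star_star] at h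
  rw [← h, conjP, ← pderiv_map, ← conjP, hF]

lemma exists_rep_mk {d : ℕ} {v : Fin (d + 1) → ℂ} (hv : v ≠ 0) :
    ∃ c : ℂ, c ≠ 0 ∧ v = c • (Projectivization.mk ℂ v hv).rep := by
  obtain ⟨a, ha⟩ := Projectivization.exists_smul_eq_mk_rep ℂ v hv
  refine ⟨(a : ℂ)⁻¹, inv_ne_zero a.ne_zero, ?_⟩
  rw [← ha, Units.smul_def, smul_smul, inv_mul_cancel₀ a.ne_zero, one_smul]

lemma exists_conjPt_rep {d : ℕ} (p : CP d) : ∃ c : ℂ, c ≠ 0 ∧ star p.rep = c • (conjPt p).rep := by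
  have h := exists_rep_mk (star_ne_zero.2 p.rep_nonzero)
  rwa [← conjPt_mk p.rep_nonzero, Projectivization.mk_rep] at h

namespace BirationalParam

variable {d : ℕ} {φ : BirationalParam d}

lemma IsRealParam.conjP_form (h : φ.IsRealParam) (i : Fin (d + 1)) :
    conjP (φ.form i) = φ.form i := by
  refine MvPolynomial.funext fun v => ?_
  have := congrFun (h (star v)) i
  rw [star_star] at this
  rw [eval_conjP]
  exact this

lemma IsRealParam.map_conjPt (h : φ.IsRealParam) (t : CP 1) :
    φ.map (conjPt t) = conjPt (φ.map t) := by
  induction t using Projectivization.ind with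
  | h v hv => simp only [conjPt_mk, map_mk, h v]

lemma mem_branchTangent_iff (t : CP 1) (w : Fin (d + 1) → ℂ) :
    w ∈ φ.branchTangent t ↔ ∃ v, φ.differential t v = w := by
  rw [branchTangent, Submodule.mem_span_range_iff_exists_fun]
  have : ∀ v : Fin 2 → ℂ, ∑ j, v j • (fun i => eval t.rep (pderiv j (φ.form i))) =
      φ.differential t v := by
    intro v
    ext i
    simp [differential_apply, dirDeriv, mul_comm]
  simp only [this]

lemma branchTangent_eq_range (t : CP 1) :
    φ.branchTangent t = LinearMap.range (φ.differential t) := by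
  ext w
  rw [mem_branchTangent_iff, LinearMap.mem_range]

lemma comp_branchTangent (φ : BirationalParam d) (Λ : (Fin 2 → ℂ) ≃ₗ[ℂ] (Fin 2 → ℂ)) (t : CP 1) :
    (φ.comp Λ).branchTangent t = φ.branchTangent (act Λ t) := by
  obtain ⟨c, hc, hrep⟩ := exists_rep_mk ((map_ne_zero_iff Λ Λ.injective).2 t.rep_nonzero)
  rw [← act_eq] at hrep
  have key : ∀ v, (φ.comp Λ).differential t v = c ^ (φ.deg - 1) • φ.differential (act Λ t) (Λ v) := by
    intro v
    ext i
    change dirDeriv t.rep v (bind₁ (linSub Λ) (φ.form i)) = _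
    have e2 : (fun j => dirDeriv t.rep v (linSub Λ j)) = Λ v := by
      rw [← eval_linSub]
      ext j
      simp only [linSub, dirDeriv_sum, dirDeriv_mul, dirDeriv_C, dirDeriv_X, map_sum, map_mul,
        eval_C, eval_X, zero_mul, zero_add]
    rw [dirDeriv_bind₁, eval_linSub, e2, hrep, dirDeriv_smul _ _ (φ.homog i)]
    rfl
  ext w
  rw [mem_branchTangent_iff, mem_branchTangent_iff]
  constructor
  · rintro ⟨v, rfl⟩
    exact ⟨c ^ (φ.deg - 1) • Λ v, by rw [key, map_smul]⟩
  · rintro ⟨v, rfl⟩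
    refine ⟨Λ.symm ((c ^ (φ.deg - 1))⁻¹ • v), ?_⟩
    rw [key, Λ.apply_symm_apply, map_smul, smul_smul, mul_inv_cancel₀ (pow_ne_zero _ hc), one_smul]

lemma IsRealParam.star_mem_branchTangent (h : φ.IsRealParam) {t : CP 1} {w : Fin (d + 1) → ℂ}
    (hw : w ∈ φ.branchTangent t) : star w ∈ φ.branchTangent (conjPt t) := by
  rw [mem_branchTangent_iff] at hw ⊢
  obtain ⟨v, rfl⟩ := hw
  obtain ⟨c, hc, hrep⟩ := exists_conjPt_rep t
  refine ⟨c ^ (φ.deg - 1) • star v, ?_⟩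
  ext i
  rw [map_smul, Pi.smul_apply, Pi.star_apply, differential_apply, differential_apply,
    star_dirDeriv _ _ (h.conjP_form i), hrep, dirDeriv_smul _ _ (φ.homog i), smul_eq_mul]

/-- A bounded curve has no real points at infinity. -/
lemma IsRealParam.vec_zero_ne_zero (h : φ.IsRealParam) (hb : IsBoundedCurve (Set.range φ.map))
    (h0 : φ.form 0 ≠ 0) {v : Fin 2 → ℂ} (hv : v ≠ 0) (hvr : star v = v) : φ.vec v 0 ≠ 0 := by
  intro hv0
  obtain ⟨M, hM⟩ := hb.exists_norm_le
  have hbound : ∀ u : Fin 2 → ℂ, u ≠ 0 → star u = u → φ.vec u 0 ≠ 0 → ∀ i : Fin d,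
      ‖φ.vec u i.succ‖ ≤ M * ‖φ.vec u 0‖ := by
    intro u hu hur hu0 i
    have hreal : ∀ i, ((φ.vec u i).re : ℂ) = φ.vec u i := fun i =>
      Complex.conj_eq_iff_re.1 (congrFun ((h u).trans (by rw [hur])) i)
    set x : EuclideanSpace ℝ (Fin d) :=
      WithLp.toLp 2 fun i => (φ.vec u i.succ).re / (φ.vec u 0).re with hx
    have hxi : ∀ i, toComplex x i = φ.vec u i.succ / φ.vec u 0 := by
      intro i
      simp [hx, toComplex, hreal]
    have hmem : realPt x ∈ Set.range φ.map := by
      refine ⟨Projectivization.mk ℂ u hu, ?_⟩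
      rw [map_mk, realPt, affinePt_eq_mk_iff]
      exact ⟨hu0, fun i => by rw [hxi, div_mul_cancel₀ _ hu0]⟩
    have h1 := hM x hmem
    have h2 : ‖toComplex x i‖ ≤ M := by
      have : ‖toComplex x i‖ = ‖x i‖ := by simp [toComplex]
      rw [this]
      exact (PiLp.norm_apply_le x i).trans h1
    rw [hxi, norm_div, div_le_iff₀ (norm_pos_iff.2 hu0)] at h2
    exact h2
  -- A second real direction. The bound by M holds along v + ε w for all but finitely many real ε,
  -- hence by continuity at ε = 0, where it would make all coordinates vanish.
  set w : Fin 2 → ℂ := ![v 1, -v 0] with hw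
  have hwr : star w = w := by
    ext j
    have := congrFun hvr
    fin_cases j
    · exact this 1
    · simpa [hw] using this 0
  have hlin : eval w (lin v) ≠ 0 := by
    have := sum_sq_ne_zero hvr hv
    rw [Fin.sum_univ_two] at this
    intro h0
    apply this
    rw [← h0]
    simp [hw]
    ring
  have hne : ∀ ε : ℝ, v + (ε : ℂ) • w ≠ 0 := by
    intro ε h0
    have h1 := congrArg (fun u => eval u (lin v)) h0
    have h2 := congrArg (fun u => eval u (lin w)) h0
    simp only [eval_lin, Pi.add_apply, Pi.smul_apply, smul_eq_mul, Pi.zero_apply] at h1 h2 hlin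
    exact hlin (by linear_combination -h2)
  have hfin : {ε : ℝ | φ.vec (v + (ε : ℂ) • w) 0 = 0}.Finite := by
    refine ((zeros_finite (φ.homog 0) h0).1.preimage (f := fun ε : ℝ =>
      Projectivization.mk ℂ (v + (ε : ℂ) • w) (hne ε)) ?_).subset ?_
    · intro ε _ δ _ heq
      rw [mk_eq_mk_iff_lin] at heq
      have h1 : ((ε : ℂ) - δ) * eval w (lin v) = 0 := by
        simp only [eval_lin, Pi.add_apply, Pi.smul_apply, smul_eq_mul] at heq ⊢
        linear_combination heq
      have h2 := (mul_eq_zero.1 h1).resolve_right hlin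
      exact_mod_cast sub_eq_zero.1 h2
    · intro ε hε
      exact (eval_rep_mk (φ.homog 0) (hne ε)).2 hε
  have hcont : ∀ i, Continuous fun ε : ℝ => φ.vec (v + (ε : ℂ) • w) i := by
    intro i
    have : Continuous fun ε : ℝ => v + (ε : ℂ) • w := by fun_prop
    exact (MvPolynomial.continuous_eval (φ.form i)).comp this
  refine φ.vec_ne_zero hv (funext fun i => ?_)
  refine Fin.cases hv0 (fun i => ?_) i
  have hcl : IsClosed {ε : ℝ | ‖φ.vec (v + (ε : ℂ) • w) i.succ‖ ≤ M * ‖φ.vec (v + (ε : ℂ) • w) 0‖} :=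
    isClosed_le (hcont _).norm (continuous_const.mul (hcont _).norm)
  have hd : Dense {ε : ℝ | ‖φ.vec (v + (ε : ℂ) • w) i.succ‖ ≤ M * ‖φ.vec (v + (ε : ℂ) • w) 0‖} := by
    refine (hfin.countable.dense_compl ℝ).mono fun ε hε => hbound _ (hne ε) ?_ hε i
    rw [star_add, star_smul, hvr, hwr]
    simp
  have := hcl.closure_eq ▸ hd.closure_eq
  have h1 : (0 : ℝ) ∈ {ε : ℝ | ‖φ.vec (v + (ε : ℂ) • w) i.succ‖ ≤ M * ‖φ.vec (v + (ε : ℂ) • w) 0‖} := by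
    rw [this]; trivial
  simp only [Set.mem_ofPred_eq, Complex.ofReal_zero, zero_smul, add_zero, hv0, norm_zero,
    mul_zero] at h1
  exact norm_le_zero_iff.1 h1

lemma realPt_injective : Function.Injective (realPt (d := d)) := by
  intro x y h
  have h1 := (affinePt_eq_mk_iff _).1 h
  ext i
  have := h1.2 i
  simp [toComplex] at this
  exact this

/-- A curve is bounded if almost all its real points have real parameters and it has no real points
at infinity. -/
lemma isBoundedCurve {B : Set (CP 1)} (hB : B.Finite)
    (hreal : ∀ t ∉ B, IsRealPoint (φ.map t) → conjPt t = t)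
    (h0 : ∀ v : Fin 2 → ℂ, v ≠ 0 → star v = v → φ.vec v 0 ≠ 0) :
    IsBoundedCurve (Set.range φ.map) := by
  set f : (Fin 2 → ℝ) → EuclideanSpace ℝ (Fin d) := fun u =>
    WithLp.toLp 2 fun i => (φ.vec (fun j => (u j : ℂ)) i.succ / φ.vec (fun j => (u j : ℂ)) 0).re
    with hf
  have hsr : ∀ u : Fin 2 → ℝ, star (fun j => (u j : ℂ)) = fun j => (u j : ℂ) := by
    intro u; ext j; simp
  have hne : ∀ u : Fin 2 → ℝ, u ≠ 0 → (fun j => (u j : ℂ)) ≠ 0 := by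
    intro u hu h
    exact hu (funext fun j => by simpa using congrFun h j)
  have hcont : ContinuousOn f (Metric.sphere 0 1) := by
    refine (PiLp.continuous_toLp 2 _).comp_continuousOn ?_
    refine continuousOn_pi.2 fun i => Complex.continuous_re.comp_continuousOn ?_
    have hc : ∀ i, Continuous fun u : Fin 2 → ℝ => φ.vec (fun j => (u j : ℂ)) i := by
      intro i
      have : Continuous fun u : Fin 2 → ℝ => fun j => (u j : ℂ) := by fun_prop
      exact (MvPolynomial.continuous_eval (φ.form i)).comp this
    refine (hc _).continuousOn.div (hc _).continuousOn fun u hu => ?_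
    refine h0 _ (hne u ?_) (hsr u)
    rintro rfl
    simp at hu
  -- The real parameters form the image of a compact circle on which the affine coordinates are
  -- continuous; the exceptional set `B` adds finitely many points.
  have hbd := ((isCompact_sphere (0 : Fin 2 → ℝ) 1).image_of_continuousOn hcont).isBounded
  have hfin : (realPt ⁻¹' (φ.map '' B) : Set (EuclideanSpace ℝ (Fin d))).Finite :=
    (hB.image _).preimage realPt_injective.injOn
  refine (hfin.isBounded.union hbd).subset ?_
  rintro x ⟨t, ht⟩
  by_cases htB : t ∈ B
  · exact Or.inl ⟨t, htB, ht⟩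
  right
  have hr := hreal t htB (ht ▸ isRealPoint_iff.2 (conjPt_realPt x))
  obtain ⟨v, hv, hvr, rfl⟩ := exists_real_rep hr
  have hvre : v = fun j => ((v j).re : ℂ) := funext fun j =>
    (Complex.conj_eq_iff_re.1 (congrFun hvr j)).symm
  set u : Fin 2 → ℝ := fun j => (v j).re with hu
  have hu0 : u ≠ 0 := by
    intro h
    refine hv ?_
    rw [hvre]
    ext j
    simpa using congrFun h j
  have hun : ‖u‖ ≠ 0 := norm_ne_zero_iff.2 hu0
  refine ⟨(‖u‖)⁻¹ • u, ?_, ?_⟩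
  · rw [mem_sphere_zero_iff_norm, norm_smul, norm_inv, norm_norm, inv_mul_cancel₀ hun]
  · rw [map_mk, realPt, affinePt_eq_mk_iff] at ht
    have hsm : (fun j => (((‖u‖)⁻¹ • u) j : ℂ)) = ((‖u‖ : ℂ))⁻¹ • v := by
      rw [hvre]
      ext j
      simp [hu]
    have hun' : ((‖u‖ : ℂ))⁻¹ ^ φ.deg ≠ 0 :=
      pow_ne_zero _ (inv_ne_zero (Complex.ofReal_ne_zero.2 hun))
    ext i
    change (φ.vec (fun j => (((‖u‖)⁻¹ • u) j : ℂ)) i.succ /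
      φ.vec (fun j => (((‖u‖)⁻¹ • u) j : ℂ)) 0).re = x i
    rw [hsm, vec_smul, Pi.smul_apply, Pi.smul_apply, smul_eq_mul, smul_eq_mul,
      mul_div_mul_left _ _ hun', ht.2 i, mul_div_cancel_right₀ _ ht.1]
    simp [toComplex]

end BirationalParam

/-! ### Branches at the vertex and acnodes -/

namespace IsCone

variable {d e n : ℕ} {φ : BirationalParam d} {r : EuclideanSpace ℝ (Fin d)}
  {x a : MvPolynomial (Fin 2) ℂ} {z : Fin d → MvPolynomial (Fin 2) ℂ}

lemma differential_zero (h : IsCone φ r x a z) (t : CP 1) (v : Fin 2 → ℂ) :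
    φ.differential t v 0 = dirDeriv t.rep v x := by
  rw [φ.differential_apply, h.form_zero]

lemma differential_succ (h : IsCone φ r x a z) {t : CP 1} (ht : eval t.rep a = 0) (v : Fin 2 → ℂ)
    (i : Fin d) : φ.differential t v i.succ =
      toComplex r i * dirDeriv t.rep v x + dirDeriv t.rep v a * eval t.rep (z i) := by
  rw [φ.differential_apply, h.form_succ, dirDeriv_add, dirDeriv_mul, dirDeriv_mul, dirDeriv_C, ht]
  simp

/-- The branch tangents at the vertex of the cone. -/
lemma branchTangent (h : IsCone φ r x a z) (hz : IsFormBasis e z) (hn : 0 < n)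
    (hx : x.IsHomogeneous n) {t : CP 1} {a' : MvPolynomial (Fin 2) ℂ} (ha : a = lin t.rep * a')
    (ha' : eval t.rep a' ≠ 0) :
    Module.finrank ℂ (φ.branchTangent t) = 2 ∧ ∀ w, w ∈ φ.branchTangent t ↔
      ∃ β : ℂ, ∀ i : Fin d, w i.succ = toComplex r i * w 0 + β * eval t.rep (z i) := by
  have hat : eval t.rep a = 0 := by rw [ha, map_mul, eval_lin_self, zero_mul]
  have hda : ∀ v, dirDeriv t.rep v a = eval v (lin t.rep) * eval t.rep a' := by
    intro v
    rw [ha, dirDeriv_mul, eval_lin_self, zero_mul, add_zero, dirDeriv_lin]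
  have hxt : eval t.rep x ≠ 0 := fun hx0 => h.noCommonZero _ t.rep_nonzero hx0 hat
  have hnx : (n : ℂ) * eval t.rep x ≠ 0 := mul_ne_zero (Nat.cast_ne_zero.2 hn.ne') hxt
  constructor
  · have hinj : Function.Injective (φ.differential t) := by
      rw [injective_iff_map_eq_zero]
      intro v hv
      have h0 := congrFun hv 0
      rw [h.differential_zero] at h0
      obtain ⟨i, hi⟩ := hz.exists_eval_ne_zero t.rep_nonzero
      have h1 := congrFun hv i.succ
      rw [h.differential_succ hat, h0] at h1
      simp only [Pi.zero_apply, mul_zero, zero_add, hda, mul_eq_zero, hi, or_false, ha'] at h1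
      obtain ⟨μ, rfl⟩ := exists_smul_of_eval_lin t.rep_nonzero h1
      have h6 : dirDeriv t.rep (μ • t.rep) x = μ * dirDeriv t.rep t.rep x := by
        simp only [dirDeriv, Finset.mul_sum, Pi.smul_apply, smul_eq_mul]
        exact Finset.sum_congr rfl fun i _ => by ring
      rw [h6, dirDeriv_self _ hx] at h0
      rw [(mul_eq_zero.1 h0).resolve_right hnx, zero_smul]
    rw [BirationalParam.branchTangent_eq_range, LinearMap.finrank_range_of_inj hinj]
    simp
  · intro w
    rw [BirationalParam.mem_branchTangent_iff]
    constructor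
    · rintro ⟨v, rfl⟩
      refine ⟨dirDeriv t.rep v a, fun i => ?_⟩
      rw [h.differential_succ hat, h.differential_zero]
    · rintro ⟨β, hβ⟩
      obtain ⟨u, hu0, hu⟩ := exists_lin_ne_zero t.rep_nonzero
      have hu' : eval u (lin t.rep) ≠ 0 := by
        intro h0
        apply hu
        rw [eval_lin] at h0 ⊢
        linear_combination -h0
      -- The u-component prescribes the derivative of a. The `t.rep`-component does not affect it,
      -- since a vanishes at t, and adjusts the derivative of x by Euler's identity.
      set k := β / (eval u (lin t.rep) * eval t.rep a') with hk
      set l := (w 0 - k * dirDeriv t.rep u x) / (n * eval t.rep x) with hl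
      have hlin : ∀ F, dirDeriv t.rep (k • u + l • t.rep) F =
          k * dirDeriv t.rep u F + l * dirDeriv t.rep t.rep F := by
        intro F
        simp only [dirDeriv, Finset.mul_sum, ← Finset.sum_add_distrib, Pi.add_apply, Pi.smul_apply,
          smul_eq_mul]
        exact Finset.sum_congr rfl fun i _ => by ring
      have hx1 : dirDeriv t.rep (k • u + l • t.rep) x = w 0 := by
        rw [hlin, dirDeriv_self _ hx, hl, div_mul_cancel₀ _ hnx]
        ring
      have ha1 : dirDeriv t.rep (k • u + l • t.rep) a = β := by
        rw [hlin, hda, hda, eval_lin_self, hk]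
        field_simp
        ring
      refine ⟨k • u + l • t.rep, funext fun i => ?_⟩
      refine Fin.cases ?_ (fun i => ?_) i
      · rw [h.differential_zero, hx1]
      · rw [h.differential_succ hat, hx1, ha1, hβ]

/-- If the cone is real and the vertex has two complex conjugate parameters, then it is an
acnode. -/
lemma isAcnode (h : IsCone φ r x a z) (hz : IsFormBasis e z) (hn : 0 < n)
    (hx : x.IsHomogeneous n) (ha : a.IsHomogeneous 2) (ha0 : a ≠ 0)
    (hzr : ∀ i, conjP (z i) = z i) {t : CP 1} (ht : eval t.rep a = 0) (htt : conjPt t ≠ t)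
    (ht' : eval (conjPt t).rep a = 0) : IsAcnode (Set.range φ.map) r := by
  obtain ⟨a₁, ha₁, e₁⟩ := exists_eq_lin_mul t.rep_nonzero ha ht
  have hne : eval (conjPt t).rep (lin t.rep) ≠ 0 := fun h0 => htt (eval_rep_lin_rep.1 h0)
  have hne' : eval t.rep (lin (conjPt t).rep) ≠ 0 := fun h0 => htt (eval_rep_lin_rep.1 h0).symm
  have ha₁t : eval (conjPt t).rep a₁ = 0 := by
    rw [e₁, map_mul] at ht'
    exact (mul_eq_zero.1 ht').resolve_left hne
  obtain ⟨a₂, ha₂, e₂⟩ := exists_eq_lin_mul (conjPt t).rep_nonzero ha₁ ha₁t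
  obtain ⟨κ, rfl⟩ := eq_C_of_isHomogeneous_zero ha₂
  have hκ : κ ≠ 0 := by
    rintro rfl
    rw [e₂] at e₁
    simp at e₁
    exact ha0 e₁
  obtain ⟨f₁, m₁⟩ := h.branchTangent hz hn hx (t := t) (a' := lin (conjPt t).rep * C κ)
    (by rw [e₁, e₂]) (by rw [map_mul, eval_C]; exact mul_ne_zero hne' hκ)
  obtain ⟨f₂, m₂⟩ := h.branchTangent hz hn hx (t := conjPt t) (a' := lin t.rep * C κ)
    (by rw [e₁, e₂]; ring) (by rw [map_mul, eval_C]; exact mul_ne_zero hne hκ)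
  have hstar : ∀ s : CP 1, ∀ w : Fin (d + 1) → ℂ,
      (∃ β : ℂ, ∀ i : Fin d, w i.succ = toComplex r i * w 0 + β * eval s.rep (z i)) →
      ∃ β : ℂ, ∀ i : Fin d, star w i.succ =
        toComplex r i * star w 0 + β * eval (conjPt s).rep (z i) := by
    rintro s w ⟨β, hβ⟩
    obtain ⟨c, hc, hrep⟩ := exists_conjPt_rep s
    refine ⟨star β * c ^ e, fun i => ?_⟩
    have h1 : star (eval s.rep (z i)) = c ^ e * eval (conjPt s).rep (z i) := by
      rw [← eval_smul (hz.homog i), ← hrep]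
      have := eval_conjP (z i) (star s.rep)
      rw [star_star, hzr] at this
      exact this.symm
    have h2 : star (toComplex r i) = toComplex r i := congrFun (star_toComplex r) i
    rw [Pi.star_apply, Pi.star_apply, hβ, star_add, star_mul', star_mul', h1, h2]
    ring
  refine ⟨φ, rfl, t, conjPt t, Ne.symm htt, ?_, f₁, f₂, ?_, ?_⟩
  · ext s
    rw [Set.mem_preimage, Set.mem_singleton_iff, h.map_eq_realPt_iff hz, e₁, e₂]
    simp only [map_mul, eval_C, mul_eq_zero, hκ, or_false, eval_rep_lin_rep]
    rfl
  -- Equal tangent lines would make the values of z at t and at `conjPt t` proportional.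
  · intro heq
    have hmem : (Fin.cons 0 fun i => eval t.rep (z i) : Fin (d + 1) → ℂ) ∈ φ.branchTangent t :=
      (m₁ _).2 ⟨1, fun i => by simp⟩
    rw [heq, m₂] at hmem
    obtain ⟨β, hβ⟩ := hmem
    exact hne' (hz.eval_lin_eq_zero (l := β) fun i => by simpa using hβ i)
  · intro w
    rw [m₁, m₂]
    constructor
    · exact hstar t w
    · intro hw
      have := hstar _ _ hw
      rwa [star_star, conjPt_conjPt] at this

end IsCone

/-! ### The two halves of the theorem -/

namespace BirationalParam

variable {d : ℕ} {φ : BirationalParam d}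

lemma map_injective_of_linearIndependent (hd : φ.deg = d) (hli : LinearIndependent ℂ φ.form) :
    Function.Injective φ.map := by
  have hz : IsFormBasis d φ.form :=
    ⟨by have := φ.deg_pos; omega, rfl, fun i => by have := φ.homog i; rwa [hd] at this, hli⟩
  intro s t h
  rw [φ.map_eq, φ.map_eq, Projectivization.mk_eq_mk_iff'] at h
  obtain ⟨l, hl⟩ := h
  refine eval_rep_lin_rep.1 (hz.eval_lin_eq_zero (l := l) fun i => ?_)
  exact (congrFun hl i).symm

/-- A curve through `r` lies on a cone with vertex `[1, r]`. -/
lemma exists_isCone_lin {r : EuclideanSpace ℝ (Fin d)} {n : ℕ} (hd : φ.deg = n + 1)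
    {v : Fin 2 → ℂ} (hv : v ≠ 0) (h : φ.map (Projectivization.mk ℂ v hv) = realPt r) :
    ∃ y : Fin d → MvPolynomial (Fin 2) ℂ, (∀ i, (y i).IsHomogeneous n) ∧
      IsCone φ r (φ.form 0) (lin v) y := by
  rw [φ.map_mk, realPt, affinePt_eq_mk_iff] at h
  have hy : ∀ i : Fin d, ∃ y, y.IsHomogeneous n ∧
      φ.form i.succ - C (toComplex r i) * φ.form 0 = lin v * y := by
    intro i
    refine exists_eq_lin_mul hv ?_ ?_
    · rw [← hd]
      exact (φ.homog _).sub ((φ.homog 0).C_mul _)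
    · rw [map_sub, map_mul, eval_C, ← vec_apply, ← vec_apply, h.2 i, sub_self]
  choose y hy hy' using hy
  exact ⟨y, hy, rfl, fun i => by rw [← hy' i]; ring⟩

lemma conjPt_of_isRealPoint_map (h : φ.IsRealParam) {t : CP 1} (ht : t ∉ φ.nonInj)
    (hr : IsRealPoint (φ.map t)) : conjPt t = t := by
  refine (φ.eq_of_map_eq ht ?_).symm
  rw [h.map_conjPt, isRealPoint_iff.1 hr]

/-- The inverse of a bounded spherical rational normal curve in one of its points. -/
theorem inverseCurve_of_bounded {k : ℕ} (hk : 1 ≤ k) {φ : BirationalParam (2 * k)}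
    (hφ : φ.IsRealParam) (hd : φ.deg = 2 * k) (hli : LinearIndependent ℂ φ.form)
    (hsph : IsSpherical (k - 1) (Set.range φ.map)) (hb : IsBoundedCurve (Set.range φ.map))
    {r : EuclideanSpace ℝ (Fin (2 * k))} (hr : realPt r ∈ Set.range φ.map) :
    ∃ ψ : BirationalParam (2 * k), inverseCurve r (Set.range φ.map) = Set.range ψ.map ∧
      ψ.deg = 2 * k + 1 ∧ LinearIndependent ℂ ψ.form ∧ IsSpherical k (Set.range ψ.map) ∧
      IsAcnode (Set.range ψ.map) r ∧
      ∀ p ∈ Set.range ψ.map, p ≠ realPt r → IsSmoothAt (Set.range ψ.map) p := by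
  obtain ⟨e, he⟩ : ∃ e, 2 * k = e + 1 := ⟨2 * k - 1, by omega⟩
  have hx0 : φ.form 0 ≠ 0 := hli.ne_zero 0
  obtain ⟨s, hs⟩ := hr
  -- A rational normal curve is embedded, so the single parameter of the real point `r` is real.
  have hsc : conjPt s = s := map_injective_of_linearIndependent hd hli <| by
    rw [hφ.map_conjPt, hs, conjPt_realPt]
  obtain ⟨v, hv, hvr, rfl⟩ := exists_real_rep hsc
  obtain ⟨z, hzh, h⟩ := φ.exists_isCone_lin (hd.trans he) hv hs
  have hl0 : lin v ≠ 0 := lin_ne_zero hv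
  have hz : IsFormBasis e z := ⟨by omega, he, hzh, linearIndependent_of_cone hli h⟩
  have hzr : ∀ i, conjP (z i) = z i := by
    intro i
    have h1 := hφ.conjP_form i.succ
    have hC : conjP (C (toComplex r i) : MvPolynomial (Fin 2) ℂ) = C (toComplex r i) := by
      simp [toComplex]
    have h2 : conjP (φ.form i.succ) =
        conjP (C (toComplex r i)) * conjP (φ.form 0) + conjP (lin v) * conjP (z i) := by
      rw [h.form_succ]
      simp only [conjP, map_add, map_mul]
    rw [h1, hC, hφ.conjP_form, conjP_lin hvr, h.form_succ] at h2
    exact (mul_left_cancel₀ hl0 (add_left_cancel h2)).symm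
  have hq0 : ∑ i, z i ^ 2 ≠ 0 := by
    intro h0
    have h1 := congrArg (eval v) h0
    simp only [map_sum, map_pow, map_zero] at h1
    refine sum_sq_ne_zero (y := fun i => eval v (z i)) ?_ ?_ h1
    · ext i
      have := eval_conjP (z i) v
      rw [hzr, hvr] at this
      exact this.symm
    · intro h2
      obtain ⟨i, hi⟩ := hz.exists_eval_ne_zero hv
      exact hi (congrFun h2 i)
  obtain ⟨hreal, hsum⟩ := (isSpherical_iff φ _).1 hsph
  have hxh : (φ.form 0).IsHomogeneous (1 + e) := by
    have h1 : φ.deg = 1 + e := by omega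
    exact h1 ▸ φ.homog 0
  obtain ⟨m, n, a, b, g, ψ, hm, hn, ha, hbh, ha0, hx, hab, hψd, hp, hgh, hg0, hψs⟩ :=
    h.exists_inverse hz (lin_isHomogeneous v) hxh hl0 hx0 hq0 hsum
  -- From 2(k - 1) + m = 1 + e = 2k; then n = 2e - 2(k - 1) = 2k. The truncated k - 1 is genuine
  -- because 1 ≤ k.
  obtain rfl : m = 2 := by omega
  obtain rfl : n = 2 * k := by omega
  have hlb : (lin v * b).IsHomogeneous (2 * k + 1) := by
    rw [add_comm]
    exact (lin_isHomogeneous v).mul hbh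
  obtain ⟨w, hw, hwa⟩ := exists_eval_eq_zero (n := 1) ha
  have hψ := hp.right
  refine ⟨ψ, hp.inverseCurve_eq hgh hg0, by omega, hψ.linearIndependent hz.linInd ha0 hw hwa,
    (isSpherical_iff ψ k).2 ⟨hp.isReal hgh hg0 hreal, hψs⟩, ?_, ?_⟩
  · set t := Projectivization.mk ℂ w hw with ht
    have hta : eval t.rep a = 0 := (eval_rep_mk ha hw).2 hwa
    have htt : conjPt t ≠ t := by
      intro htc
      obtain ⟨u, hu, hur, htu⟩ := exists_real_rep htc
      refine hφ.vec_zero_ne_zero hb hx0 hu hur ?_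
      rw [htu, eval_rep_mk ha hu] at hta
      rw [vec_apply, hx, map_mul, hta, mul_zero]
    -- The quotient a / b = x / Q is real. As b ≠ 0 at the zero t of a, the conjugate parameter is a
    -- zero of a as well.
    have hac : a * conjP b = conjP a * b := by
      have hmul : ∀ F G : MvPolynomial (Fin 2) ℂ, conjP (F * G) = conjP F * conjP G :=
        map_mul (MvPolynomial.map (starRingEnd ℂ))
      have h1 := congrArg conjP hx
      rw [hφ.conjP_form, hx, hmul] at h1
      have h2 : ∑ i, z i ^ 2 = conjP (∑ i, z i ^ 2) := by
        conv_lhs => enter [2, i]; rw [← hzr i]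
        simp only [conjP, map_sum, map_pow]
      rw [hp.quad_eq, hmul] at h2
      have hg : g * conjP g ≠ 0 := by
        have h3 : g ≠ 0 := by
          rintro rfl
          simp at hg0
        refine mul_ne_zero h3 fun h4 => ?_
        rw [h4, zero_mul] at h1
        exact mul_ne_zero h3 ha0 h1
      refine mul_left_cancel₀ hg ?_
      linear_combination conjP g * conjP b * h1 - conjP a * conjP g * h2
    have hta' : eval (conjPt t).rep a = 0 := by
      have h1 := congrArg (eval t.rep) hac
      rw [map_mul, map_mul, hta, zero_mul, eq_comm, mul_eq_zero, eval_conjP] at h1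
      have h2 := star_eq_zero.1 (h1.resolve_right (hab _ t.rep_nonzero hta))
      obtain ⟨c, hc, hcr⟩ := exists_conjPt_rep t
      rw [hcr, eval_smul ha] at h2
      exact (mul_eq_zero.1 h2).resolve_left (pow_ne_zero _ hc)
    exact hψ.isAcnode hz (by omega) hlb ha ha0 hzr hta htt hta'
  · rintro _ ⟨t, rfl⟩ ht
    refine hψ.isSmoothAt hz ha ?_ (by omega) fun h0 => ht ((hψ.map_eq_realPt_iff hz t).2 h0)
    rwa [show 2 + e = 2 * k + 1 by omega]

/-- The inverse of a spherical rational curve in an acnode. -/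
theorem inverseCurve_of_acnode {k : ℕ} (hk : 1 ≤ k) {φ : BirationalParam (2 * k)}
    (hφ : φ.IsRealParam) (hd : φ.deg = 2 * k + 1) (hli : LinearIndependent ℂ φ.form)
    (hsph : IsSpherical k (Set.range φ.map)) {r : EuclideanSpace ℝ (Fin (2 * k))} {t₁ t₂ : CP 1}
    (ht₁ : φ.map t₁ = realPt r) (ht₂ : φ.map t₂ = realPt r) (ht : t₁ ≠ t₂)
    (hc₁ : conjPt t₁ ≠ t₁) (hc₂ : conjPt t₂ ≠ t₂) :
    ∃ ψ : BirationalParam (2 * k), inverseCurve r (Set.range φ.map) = Set.range ψ.map ∧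
      ψ.deg = 2 * k ∧ LinearIndependent ℂ ψ.form ∧ IsSpherical (k - 1) (Set.range ψ.map) ∧
      IsBoundedCurve (Set.range ψ.map) := by
  obtain ⟨e, he⟩ : ∃ e, 2 * k = e + 1 := ⟨2 * k - 1, by omega⟩
  have hx0 : φ.form 0 ≠ 0 := hli.ne_zero 0
  obtain ⟨y, hyh, hy⟩ := φ.exists_isCone_lin hd t₁.rep_nonzero (by rwa [t₁.mk_rep])
  have hy₂ : ∀ i, eval t₂.rep (y i) = 0 := by
    intro i
    have h1 := ht₂
    rw [φ.map_eq, realPt, affinePt_eq_mk_iff] at h1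
    have h2 := h1.2 i
    rw [hy.vec_succ, hy.vec_zero, add_eq_left, mul_eq_zero] at h2
    exact h2.resolve_left fun h3 => ht (eval_rep_lin_rep.1 h3).symm
  have hz : ∀ i, ∃ z, z.IsHomogeneous e ∧ y i = lin t₂.rep * z := fun i =>
    exists_eq_lin_mul t₂.rep_nonzero (he ▸ hyh i) (hy₂ i)
  choose z hzh hyz using hz
  set c := lin t₁.rep * lin t₂.rep with hc
  have hch : c.IsHomogeneous 2 := (lin_isHomogeneous _).mul (lin_isHomogeneous _)
  have hc0 : c ≠ 0 := mul_ne_zero (lin_ne_zero t₁.rep_nonzero) (lin_ne_zero t₂.rep_nonzero)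
  have h : IsCone φ r (φ.form 0) c z :=
    ⟨rfl, fun i => by rw [hy.form_succ, hyz, hc, mul_assoc]⟩
  have hz : IsFormBasis e z := ⟨by omega, he, hzh, linearIndependent_of_cone hli h⟩
  have hcr : ∀ v : Fin 2 → ℂ, v ≠ 0 → star v = v → eval v c ≠ 0 := by
    intro v hv hvr h0
    have key : ∀ t : CP 1, conjPt t ≠ t → eval v (lin t.rep) ≠ 0 := by
      intro t htc h1
      obtain ⟨c, hc⟩ := exists_smul_of_eval_lin t.rep_nonzero h1
      have : Projectivization.mk ℂ v hv = t := by
        rw [← t.mk_rep, Projectivization.mk_eq_mk_iff']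
        exact ⟨c, hc.symm⟩
      exact htc (this ▸ conjPt_mk_real hv hvr)
    rw [hc, map_mul] at h0
    exact (mul_eq_zero.1 h0).elim (key _ hc₁) (key _ hc₂)
  -- The factors c and z need not be real separately, as representatives of t₁ and t₂ were chosen
  -- freely. The products c zᵢ = φᵢ - rᵢ φ₀ are real at v, and c ≠ 0 there.
  have hqr : ∀ v : Fin 2 → ℂ, v ≠ 0 → star v = v → eval v (∑ i, z i ^ 2) ≠ 0 := by
    intro v hv hvr h0
    have hφv := hφ v
    rw [hvr] at hφv
    have h1 : ∑ i, (eval v c * eval v (z i)) ^ 2 = 0 := by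
      simp only [mul_pow, ← Finset.mul_sum]
      simp only [map_sum, map_pow] at h0
      rw [h0, mul_zero]
    refine sum_sq_ne_zero (y := fun i => eval v c * eval v (z i)) ?_ ?_ h1
    · have h2 : ∀ i, eval v c * eval v (z i) = φ.vec v i.succ - toComplex r i * φ.vec v 0 := by
        intro i
        rw [h.vec_succ, h.vec_zero]
        ring
      ext i
      have h3 : star (toComplex r i) = toComplex r i := congrFun (star_toComplex r) i
      rw [Pi.star_apply, h2, star_sub, star_mul', h3]
      exact congrArg₂ _ (congrFun hφv _) (congrArg _ (congrFun hφv _))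
    · intro h2
      obtain ⟨i, hi⟩ := hz.exists_eval_ne_zero hv
      exact mul_ne_zero (hcr v hv hvr) hi (congrFun h2 i)
  have hq0 : ∑ i, z i ^ 2 ≠ 0 := by
    intro h0
    refine hqr 1 one_ne_zero (star_one _) ?_
    rw [h0, map_zero]
  obtain ⟨hreal, hsum⟩ := (isSpherical_iff φ _).1 hsph
  have hxh : (φ.form 0).IsHomogeneous (2 + e) := by
    have h1 : φ.deg = 2 + e := by omega
    exact h1 ▸ φ.homog 0
  obtain ⟨m, n, a, b, g, ψ, hm, hn, ha, hbh, ha0, hx, hab, hψd, hp, hgh, hg0, hψs⟩ :=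
    h.exists_inverse hz hch hxh hc0 hx0 hq0 hsum
  obtain rfl : m = 1 := by omega
  obtain rfl : n = 2 * (k - 1) := by omega
  obtain ⟨w, hw, hwa⟩ := exists_eval_eq_zero (n := 0) ha
  refine ⟨ψ, hp.inverseCurve_eq hgh hg0, by omega, hp.right.linearIndependent hz.linInd ha0 hw hwa,
    (isSpherical_iff ψ _).2 ⟨hp.isReal hgh hg0 hreal, hψs⟩, ?_⟩
  -- A general real point of the inverse comes from a real point of φ, hence from a real parameter.
  refine isBoundedCurve ((zeros_finite hgh hg0).1.union φ.nonInj_finite) ?_ ?_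
  · intro t htB hr
    rw [Set.mem_union, not_or] at htB
    refine conjPt_of_isRealPoint_map hφ htB.2 (hp.symm.isRealPoint_map ?_ hr)
    rw [show b * c * (a * g) = g * a * (c * b) by ring]
    exact htB.1
  · intro v hv hvr
    rw [hp.right.vec_zero, map_mul]
    refine mul_ne_zero (hcr v hv hvr) fun hb0 => hqr v hv hvr ?_
    rw [hp.quad_eq, map_mul, hb0, mul_zero]

/-- The parameters of an acnode of a real parametrization are not real. -/
lemma exists_params_of_isAcnode {r : EuclideanSpace ℝ (Fin d)} (hφ : φ.IsRealParam)
    (h : IsAcnode (Set.range φ.map) r) : ∃ t₁ t₂ : CP 1, φ.map t₁ = realPt r ∧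
      φ.map t₂ = realPt r ∧ t₁ ≠ t₂ ∧ conjPt t₁ ≠ t₁ ∧ conjPt t₂ ≠ t₂ := by
  obtain ⟨χ, hχ, s₁, s₂, hs, hpre, -, -, hT, hstar⟩ := h
  obtain ⟨Λ, rfl⟩ := exists_comp_eq (show Set.range φ.map = Set.range χ.map from hχ.symm)
  have hmem : ∀ t, (χ.comp Λ).map t = realPt r ↔ t = (act Λ).symm s₁ ∨ t = (act Λ).symm s₂ := by
    intro t
    rw [comp_map, Equiv.eq_symm_apply, Equiv.eq_symm_apply]
    exact Set.ext_iff.1 hpre (act Λ t)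
  set t₁ := (act Λ).symm s₁ with ht₁
  set t₂ := (act Λ).symm s₂ with ht₂
  have hne : t₁ ≠ t₂ := fun h => hs ((act Λ).symm.injective h)
  have h₁ : (χ.comp Λ).map t₁ = realPt r := (hmem _).2 (Or.inl rfl)
  have h₂ : (χ.comp Λ).map t₂ = realPt r := (hmem _).2 (Or.inr rfl)
  have hb₁ : (χ.comp Λ).branchTangent t₁ = χ.branchTangent s₁ := by
    rw [comp_branchTangent, ht₁, Equiv.apply_symm_apply]
  have hb₂ : (χ.comp Λ).branchTangent t₂ = χ.branchTangent s₂ := by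
    rw [comp_branchTangent, ht₂, Equiv.apply_symm_apply]
  -- A real t₂ would have a self-conjugate tangent, equal to that of t₁. If then t₁ were real, the
  -- conjugate of t₂ would be a third parameter of `r`.
  have hc₂ : conjPt t₂ ≠ t₂ := by
    intro hc
    refine hT (Submodule.ext fun w => ?_)
    rw [hstar, ← hb₂]
    have key : ∀ w, w ∈ (χ.comp Λ).branchTangent t₂ → star w ∈ (χ.comp Λ).branchTangent t₂ := by
      intro w hw
      have := hφ.star_mem_branchTangent hw
      rwa [hc] at this
    exact ⟨fun hw => star_star w ▸ key _ hw, key w⟩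
  refine ⟨t₁, t₂, h₁, h₂, hne, fun hc₁ => ?_, hc₂⟩
  have h3 : (χ.comp Λ).map (conjPt t₂) = realPt r := by rw [hφ.map_conjPt, h₂, conjPt_realPt]
  rcases (hmem _).1 h3 with h4 | h4
  · exact hne (conjPt_injective (hc₁.trans h4.symm))
  · exact hc₂ h4

end BirationalParam
end SphCurve

open SphCurve

theorem corollary2p7 (k : ℕ) (hk : 1 ≤ k) :
    (∀ C : Set (CP (2 * k)), IsRationalNormalCurve C → IsSpherical (k - 1) C → IsBoundedCurve C →
      ∀ r : EuclideanSpace ℝ (Fin (2 * k)), realPt r ∈ C →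
        IsRationalCurve (inverseCurve r C) ∧
        HasDegree (inverseCurve r C) (2 * k + 1) ∧
        NonDegenerate (inverseCurve r C) ∧
        IsSpherical k (inverseCurve r C) ∧
        IsAcnode (inverseCurve r C) r ∧
        (∀ p ∈ inverseCurve r C, p ≠ realPt r → IsSmoothAt (inverseCurve r C) p)) ∧
    (∀ C : Set (CP (2 * k)), ∀ r : EuclideanSpace ℝ (Fin (2 * k)),
      IsRationalCurve C → HasDegree C (2 * k + 1) → NonDegenerate C → IsSpherical k C →
      IsAcnode C r → (∀ p ∈ C, p ≠ realPt r → IsSmoothAt C p) →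
        IsRationalNormalCurve (inverseCurve r C) ∧
        IsSpherical (k - 1) (inverseCurve r C) ∧
        IsBoundedCurve (inverseCurve r C)) := by
  constructor
  · rintro C ⟨φ, hd, hli, hC⟩ hsph hb r hr
    obtain rfl : Set.range φ.map = C := hC
    obtain ⟨Λ, hΛ⟩ := BirationalParam.exists_isRealParam hsph.1
    have hrange := φ.comp_range Λ
    have hli' : LinearIndependent ℂ (φ.comp Λ).form := by
      rw [← BirationalParam.nonDegenerate_iff, hrange, BirationalParam.nonDegenerate_iff]
      exact hli
    rw [← hrange] at hsph hb hr ⊢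
    obtain ⟨ψ, hψ, hψd, hψli, hψs, hac, hsm⟩ :=
      BirationalParam.inverseCurve_of_bounded hk hΛ hd hli' hsph hb hr
    rw [hψ]
    exact ⟨⟨ψ, rfl⟩, hψd ▸ ψ.hasDegree, (BirationalParam.nonDegenerate_iff _).2 hψli, hψs, hac, hsm⟩
  · rintro C r ⟨φ, hC⟩ hdeg hnd hsph hac -
    obtain rfl : Set.range φ.map = C := hC
    obtain ⟨Λ, hΛ⟩ := BirationalParam.exists_isRealParam hsph.1
    rw [← φ.comp_range Λ] at hdeg hnd hsph hac ⊢
    obtain ⟨t₁, t₂, h₁, h₂, hne, hc₁, hc₂⟩ := BirationalParam.exists_params_of_isAcnode hΛ hac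
    obtain ⟨ψ, hψ, hψd, hψli, hψs, hψb⟩ := BirationalParam.inverseCurve_of_acnode hk hΛ
      ((φ.comp Λ).hasDegree.unique hdeg) ((BirationalParam.nonDegenerate_iff _).1 hnd) hsph h₁ h₂ hne
      hc₁ hc₂
    rw [hψ]
    exact ⟨⟨ψ, hψd, hψli, rfl⟩, hψs, hψb⟩
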